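/- Let $\phi:\mathbb R\to\mathbb R$ be measurable and linearly bounded: there are $c,m\ge 0$ with $|\phi(z)|\le c+m|z|$ for all $z\in\mathbb R$ (for example, $\phi$ Lipschitz). Let $\sigma_w,\sigma_b\in\mathbb R$, let $L\ge 2$ be the depth, let $n_0$ be the (fixed) input width, and let $n_1,\dots,n_L$ be the widths of the other layers. A *random orthogonal $p\times q$ matrix* $\omega$ is the upper left $p\times q$ block of $\sqrt{N}\,Q$, where $N=\max(p,q)$ and $Q$ is distributed according to the Haar probability measure on $O(N)$; so its entries have variance $1$, $\omega\omega^T=q\mathbf I$ if $p\le q$, and $\omega^T\omega=p\mathbf I$ if $q\le p$. Below, the limit is along any sequence of widths with $n_1,\dots,n_{L-1}\to\infty$ simultaneously (the output width $n_L$ is arbitrary), and "random functions $h_i$ tend to i.i.d. centered Gaussian processes of covariance $K$" means that $K$ is a positive semidefinite kernel and that for every finite set of indices $i$ and finite set of arguments, the joint law of the corresponding values converges weakly to that of independent (over $i$) centered Gaussian processes, each of covariance $K$. For such a kernel, $f\sim\mathcal N(0,K)$ denotes a centered Gaussian process of covariance $K$. **FCN.** For $x\in\mathbb R^{n_0}$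 let $x^0=x$ and, for $1\le l\le L$, $$h^l_i=\frac{\sigma_w}{\sqrt{n_{l-1}}}\sum_{j=1}^{n_{l-1}}\omega^l_{ij}x^{l-1}_j+\sigma_b\beta^l_i,\qquad x^l_i=\phi(h^l_i),\qquad 1\le i\le n_l,$$ where the $\omega^l$ are random orthogonal $n_l\times n_{l-1}$ matrices, $\beta^l_i\sim\mathcal N(0,1)$, and all $\omega^l$ and $\beta^l_i$ are independent. Then for every $l\in\{1,\dots,L\}$ the pre-activations $h^l_i$, as functions of $x$, tend to i.i.d. centered Gaussian processes of covariance $\Sigma^l$, where $$\Sigma^1(x,x')=\frac{\sigma_w^2}{n_0}x^Tx'+\sigma_b^2,\qquad \Sigma^l(x,x')=\sigma_w^2\,\mathbb E_{f\sim\mathcal N(0,\Sigma^{l-1})}[\phi(f(x))\phi(f(x'))]+\sigma_b^2 .$$ **CNN.** Let $k\ge 0$, $m\ge 1$, $s\in\mathbb R$. Spatial locations $\alpha$ are taken in $\mathbb Z/m$ (periodic boundary). For an input $x=(x_{j,\alpha})_{j\le n_0,\,\alpha\in\mathbb Z/m}$ let $x^0=x$ and, for $1\le l\le L-1$, $$h^l_{i,\alpha}=\frac{\sigma_w}{\sqrt{(2k+1)n_{l-1}}}\sum_{j=1}^{n_{l-1}}\sum_{\beta=-k}^{k}\omega^l_{ij,\beta}\,x^{l-1}_{j,\alpha+\beta}+\sigma_b\beta^l_i,\qquad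 x^l_{i,\alpha}=\phi(h^l_{i,\alpha}),$$ and let the fully connected output layer be $$h^L_i=\frac{s}{\sqrt{n_{L-1}}}\sum_{j=1}^{n_{L-1}}\sum_{\alpha\in\mathbb Z/m}\omega^L_{ij,\alpha}\,x^{L-1}_{j,\alpha},$$ where for each $l$ and each offset $\beta$ (for $l=L$: each location $\alpha$) the matrix $(\omega^l_{ij,\beta})_{ij}$ is a random orthogonal $n_l\times n_{l-1}$ matrix, $\beta^l_i\sim\mathcal N(0,1)$, and all these matrices and biases are independent. Then for every $l\in\{1,\dots,L-1\}$ the pre-activations $h^l_i$, as functions of $(\alpha,x)$, tend to i.i.d. centered Gaussian processes of covariance $\Sigma^l_{\alpha,\alpha'}(x,x')$, where $$\Sigma^1_{\alpha,\alpha'}(x,x')=\frac{\sigma_w^2}{n_0(2k+1)}\sum_{\beta=-k}^{k}x_{\alpha+\beta}^Tx'_{\alpha'+\beta}+\sigma_b^2,$$ $$\Sigma^l_{\alpha,\alpha'}(x,x')=\frac{\sigma_w^2}{2k+1}\sum_{\beta=-k}^{k}\mathbb E_{f\sim\mathcal N(0,\Sigma^{l-1})}\big[\phi(f_{\alpha+\beta}(x))\,\phi(f_{\alpha'+\beta}(x'))\big]+\sigma_b^2,$$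 and the outputs $h^L_i$, as functions of $x$, tend to i.i.d. centered Gaussian processes of covariance $$\Sigma^L(x,x')=s^2\sum_{\alpha\in\mathbb Z/m}\mathbb E_{f\sim\mathcal N(0,\Sigma^{L-1})}\big[\phi(f_\alpha(x))\,\phi(f_\alpha(x'))\big].$$ -/

import Mathlib

open MeasureTheory ProbabilityTheory Filter Topology

noncomputable section

/-! ### Haar-distributed orthogonal matrices and rectangular orthogonal weights -/

instance orthogonalGroupMeasurableSpace (N : ℕ) :
    MeasurableSpace (Matrix.orthogonalGroup (Fin N) ℝ) := borel _

instance orthogonalGroupBorelSpace (N : ℕ) :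
    BorelSpace (Matrix.orthogonalGroup (Fin N) ℝ) := ⟨rfl⟩

instance orthogonalGroupCompactSpace (N : ℕ) :
    CompactSpace (Matrix.orthogonalGroup (Fin N) ℝ) := by
  refine isCompact_iff_compactSpace.mp ?_
  have hbox : IsCompact (Set.pi Set.univ fun _ : Fin N =>
      Set.pi Set.univ fun _ : Fin N => Set.Icc (-1 : ℝ) 1) :=
    isCompact_univ_pi fun _ => isCompact_univ_pi fun _ => isCompact_Icc
  refine IsCompact.of_isClosed_subset (X := Matrix (Fin N) (Fin N) ℝ) hbox ?_ ?_
  · exact isClosed_unitary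
  · intro A hA i _ j _
    have := entry_norm_bound_of_unitary hA i j
    rw [Real.norm_eq_abs] at this
    exact abs_le.mp this

/-- The Haar probability measure on the orthogonal group `O(N)`. -/
def haarOrthogonal (N : ℕ) : Measure (Matrix.orthogonalGroup (Fin N) ℝ) :=
  Measure.haarMeasure ⊤

instance haarOrthogonal_isProbabilityMeasure (N : ℕ) :
    IsProbabilityMeasure (haarOrthogonal N) :=
  ⟨Measure.haarMeasure_self⟩

/-- The `p × q` upper left block of `√N • Q`, where `Q` is an orthogonal matrix of size
`N = max p q`. Its shorter side is orthogonal: the block `ω` has `ω ωᵀ = q • 1` if `p ≤ q` and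
`ωᵀ ω = p • 1` if `q ≤ p`. -/
def orthBlock (p q : ℕ) (Q : Matrix.orthogonalGroup (Fin (max p q)) ℝ) : Fin p → Fin q → ℝ :=
  fun i j => √((max p q : ℕ) : ℝ) *
    (Q : Matrix (Fin (max p q)) (Fin (max p q)) ℝ)
      (Fin.castLE (le_max_left p q) i) (Fin.castLE (le_max_right p q) j)

/-- The law of a random orthogonal `p × q` weight matrix, scaled so that its entries have
variance one. For `p = q = n` this is `√n` times a Haar orthogonal matrix. -/
def orthWeight (p q : ℕ) : Measure (Fin p → Fin q → ℝ) :=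
  (haarOrthogonal (max p q)).map (orthBlock p q)

lemma measurable_orthBlock (p q : ℕ) : Measurable (orthBlock p q) := by
  refine Continuous.measurable ?_
  unfold orthBlock
  refine continuous_pi fun i => continuous_pi fun j => continuous_const.mul ?_
  exact continuous_subtype_val.matrix_elem _ _

instance orthWeight_isProbabilityMeasure (p q : ℕ) : IsProbabilityMeasure (orthWeight p q) :=
  Measure.isProbabilityMeasure_map (measurable_orthBlock p q).aemeasurable

/-- The law of a bias vector `β` with i.i.d. standard Gaussian entries. -/
def biasLaw (p : ℕ) : Measure (Fin p → ℝ) := Measure.pi fun _ => gaussianReal 0 1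

instance biasLaw_isProbabilityMeasure (p : ℕ) : IsProbabilityMeasure (biasLaw p) := by
  unfold biasLaw; infer_instance

/-- Width of layer `l`: the input width `n₀` for `l = 0`, and `n l` for `l ≥ 1`. -/
def width (n₀ : ℕ) (n : ℕ → ℕ) : ℕ → ℕ
  | 0 => n₀
  | l + 1 => n (l + 1)

/-! ### Centered Gaussian processes with a given covariance kernel -/

/-- The matrix of the kernel `K` at the points `X a`. -/
def kernelMatrix {T A : Type*} (K : T → T → ℝ) (X : A → T) : Matrix A A ℝ :=
  Matrix.of fun a b => K (X a) (X b)

/-- The law of `(f (X a))_a`, where `f` is a centered Gaussian process of covariance `K`. -/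
def gpMarginal {T : Type*} (K : T → T → ℝ) {D : ℕ} (X : Fin D → T) :
    Measure (EuclideanSpace ℝ (Fin D)) :=
  multivariateGaussian 0 (kernelMatrix K X)

instance gpMarginal_isProbabilityMeasure {T : Type*} (K : T → T → ℝ) {D : ℕ} (X : Fin D → T) :
    IsProbabilityMeasure (gpMarginal K X) := by
  unfold gpMarginal; infer_instance

/-- `𝔼 [φ (f s) φ (f t)]`, where `f` is a centered Gaussian process of covariance `K`. -/
def gpExp {T : Type*} (φ : ℝ → ℝ) (K : T → T → ℝ) (s t : T) : ℝ :=
  ∫ f, φ (f 0) * φ (f 1) ∂(gpMarginal K ![s, t])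

/-- The random functions `h ν θ i : T → ℝ`, for `i < p ν` and `θ` of law `P ν`, converge to
i.i.d. centered Gaussian processes of covariance `K` as `ν → ∞`: `K` is a covariance kernel, and
for every finite set `I` of indices (present for all large `ν`) and all points `X 0, …, X (D-1)`,
the joint law of `(h i (X a))` for `i ∈ I` and `a < D` converges weakly to the product over `i ∈ I`
of the centered Gaussian laws of covariance matrix `K (X a) (X b)`. -/
def TendstoIIDGaussianProcesses {T : Type*} {Θ : ℕ → Type*} [∀ ν, MeasurableSpace (Θ ν)]
    (P : ∀ ν, Measure (Θ ν)) [∀ ν, IsProbabilityMeasure (P ν)] (p : ℕ → ℕ)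
    (h : ∀ ν, Θ ν → Fin (p ν) → T → ℝ) (K : T → T → ℝ) : Prop :=
  (∀ (D : ℕ) (X : Fin D → T), (kernelMatrix K X).PosSemidef) ∧
  ∀ (D : ℕ) (X : Fin D → T) (I : Finset ℕ), (∀ᶠ ν in atTop, ∀ i ∈ I, i < p ν) →
    TendstoInDistribution
      (fun ν θ (i : I) => WithLp.toLp 2 fun a : Fin D =>
        if hi : (i : ℕ) < p ν then h ν θ ⟨i, hi⟩ (X a) else 0)
      atTop id P (Measure.pi fun _ : I => gpMarginal K X)

/-! ### Fully connected networks -/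

/-- Parameters of a fully connected network with `L` layers: the pair `(ω, β)` at `l : Fin L`
belongs to layer `l + 1`, which maps layer `l` to layer `l + 1`. -/
abbrev FCNParams (L n₀ : ℕ) (n : ℕ → ℕ) : Type :=
  ∀ l : Fin L, (Fin (n (l + 1)) → Fin (width n₀ n l) → ℝ) × (Fin (n (l + 1)) → ℝ)

/-- Orthogonal initialization: all weights and biases are independent. -/
def fcnInit (L n₀ : ℕ) (n : ℕ → ℕ) : Measure (FCNParams L n₀ n) :=
  Measure.pi fun l : Fin L => (orthWeight (n (l + 1)) (width n₀ n l)).prod (biasLaw (n (l + 1)))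

instance fcnInit_isProbabilityMeasure (L n₀ : ℕ) (n : ℕ → ℕ) :
    IsProbabilityMeasure (fcnInit L n₀ n) := by
  unfold fcnInit; infer_instance

/-- One layer, `y ↦ (σw / √q) ω y + σb β`. -/
def fcnLayer (σw σb : ℝ) {p q : ℕ} (θ : (Fin p → Fin q → ℝ) × (Fin p → ℝ)) (y : Fin q → ℝ) :
    Fin p → ℝ :=
  fun i => σw / √(q : ℝ) * ∑ j, θ.1 i j * y j + σb * θ.2 i

/-- The post-activations of layer `l`; layer `0` is the input. -/
def fcnPost (φ : ℝ → ℝ) (σw σb : ℝ) {L n₀ : ℕ} {n : ℕ → ℕ} (θ : FCNParams L n₀ n)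
    (x : Fin n₀ → ℝ) : (l : ℕ) → l ≤ L → Fin (width n₀ n l) → ℝ
  | 0, _ => x
  | l + 1, hl => fun i =>
      φ (fcnLayer σw σb (θ ⟨l, hl⟩) (fcnPost φ σw σb θ x l (Nat.le_of_succ_le hl)) i)

/-- The pre-activations of layer `l + 1`. -/
def fcnPre (φ : ℝ → ℝ) (σw σb : ℝ) {L n₀ : ℕ} {n : ℕ → ℕ} (θ : FCNParams L n₀ n)
    (x : Fin n₀ → ℝ) (l : ℕ) (hl : l < L) : Fin (n (l + 1)) → ℝ :=
  fcnLayer σw σb (θ ⟨l, hl⟩) (fcnPost φ σw σb θ x l hl.le)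

/-- The limiting covariance of layer `l + 1`. -/
def fcnCov (φ : ℝ → ℝ) (σw σb : ℝ) {n₀ : ℕ} : ℕ → (Fin n₀ → ℝ) → (Fin n₀ → ℝ) → ℝ
  | 0 => fun x x' => σw ^ 2 / n₀ * ∑ j, x j * x' j + σb ^ 2
  | l + 1 => fun x x' => σw ^ 2 * gpExp φ (fcnCov φ σw σb l) x x' + σb ^ 2

/-! ### One-dimensional convolutional networks with periodic boundary

Spatial locations are elements of `ZMod m`; `H` is the number of convolutional layers and layer
`H + 1` is the fully connected output layer. -/

/-- Filter offsets `-k, …, k`. -/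
abbrev Offset (k : ℕ) : Type := ↥(Finset.Icc (-(k : ℤ)) (k : ℤ))

/-- Parameters of a convolutional layer with `q` input and `p` output channels. -/
abbrev ConvParams (k p q : ℕ) : Type := (Offset k → Fin p → Fin q → ℝ) × (Fin p → ℝ)

/-- Parameters of the network: convolutional layers, then the weights of the output layer. -/
abbrev CNNParams (H k m n₀ : ℕ) (n : ℕ → ℕ) : Type :=
  (∀ l : Fin H, ConvParams k (n (l + 1)) (width n₀ n l)) ×
    (ZMod m → Fin (n (H + 1)) → Fin (width n₀ n H) → ℝ)

/-- Orthogonal initialization: one orthogonal weight matrix for each filter offset, and for each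
spatial location in the output layer; all weights and biases are independent. -/
def cnnInit (H k m : ℕ) [NeZero m] (n₀ : ℕ) (n : ℕ → ℕ) : Measure (CNNParams H k m n₀ n) :=
  (Measure.pi fun l : Fin H =>
    (Measure.pi fun _ : Offset k => orthWeight (n (l + 1)) (width n₀ n l)).prod
      (biasLaw (n (l + 1)))).prod
  (Measure.pi fun _ : ZMod m => orthWeight (n (H + 1)) (width n₀ n H))

instance cnnInit_isProbabilityMeasure (H k m : ℕ) [NeZero m] (n₀ : ℕ) (n : ℕ → ℕ) :
    IsProbabilityMeasure (cnnInit H k m n₀ n) := by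
  unfold cnnInit; infer_instance

/-- One convolutional layer, `y ↦ ∑_β σw / √((2k+1) q) ω_β y_{α+β} + σb b`. -/
def convLayer (σw σb : ℝ) {k m p q : ℕ} (θ : ConvParams k p q) (y : Fin q → ZMod m → ℝ) :
    Fin p → ZMod m → ℝ :=
  fun i α => σw / √((2 * (k : ℝ) + 1) * (q : ℝ)) *
    ∑ j, ∑ β : Offset k, θ.1 β i j * y j (α + ((β : ℤ) : ZMod m)) + σb * θ.2 i

/-- The post-activations of layer `l ≤ H`; layer `0` is the input. -/
def cnnPost (φ : ℝ → ℝ) (σw σb : ℝ) {H k m n₀ : ℕ} {n : ℕ → ℕ} (θ : CNNParams H k m n₀ n)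
    (x : Fin n₀ → ZMod m → ℝ) : (l : ℕ) → l ≤ H → Fin (width n₀ n l) → ZMod m → ℝ
  | 0, _ => x
  | l + 1, hl => fun i α =>
      φ (convLayer σw σb (θ.1 ⟨l, hl⟩) (cnnPost φ σw σb θ x l (Nat.le_of_succ_le hl)) i α)

/-- The pre-activations of the convolutional layer `l + 1 ≤ H`. -/
def cnnPre (φ : ℝ → ℝ) (σw σb : ℝ) {H k m n₀ : ℕ} {n : ℕ → ℕ} (θ : CNNParams H k m n₀ n)
    (x : Fin n₀ → ZMod m → ℝ) (l : ℕ) (hl : l < H) : Fin (n (l + 1)) → ZMod m → ℝ :=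
  convLayer σw σb (θ.1 ⟨l, hl⟩) (cnnPost φ σw σb θ x l hl.le)

/-- The output (layer `H + 1`): fully connected, without bias, with weights `(s / √n_H) ω_α`. -/
def cnnOut (φ : ℝ → ℝ) (σw σb s : ℝ) {H k m : ℕ} [NeZero m] {n₀ : ℕ} {n : ℕ → ℕ}
    (θ : CNNParams H k m n₀ n) (x : Fin n₀ → ZMod m → ℝ) : Fin (n (H + 1)) → ℝ :=
  fun i => s / √(width n₀ n H : ℝ) *
    ∑ j, ∑ α : ZMod m, θ.2 α i j * cnnPost φ σw σb θ x H le_rfl j α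

/-- The limiting covariance `Σ_{α,α'}(x,x')` of the convolutional layer `l + 1`, as a kernel on
pairs `(α, x)`. -/
def cnnCov (φ : ℝ → ℝ) (σw σb : ℝ) (k : ℕ) {m n₀ : ℕ} :
    ℕ → ZMod m × (Fin n₀ → ZMod m → ℝ) → ZMod m × (Fin n₀ → ZMod m → ℝ) → ℝ
  | 0 => fun u v => σw ^ 2 / (n₀ * (2 * k + 1)) *
      ∑ β : Offset k, ∑ j, u.2 j (u.1 + ((β : ℤ) : ZMod m)) * v.2 j (v.1 + ((β : ℤ) : ZMod m))
        + σb ^ 2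
  | l + 1 => fun u v => σw ^ 2 / (2 * k + 1) *
      ∑ β : Offset k, gpExp φ (cnnCov φ σw σb k l)
        (u.1 + ((β : ℤ) : ZMod m), u.2) (v.1 + ((β : ℤ) : ZMod m), v.2) + σb ^ 2

/-- The limiting covariance of the output after `H ≥ 1` convolutional layers: the trace over
spatial locations (`cnnCov` at `H - 1` is the covariance of layer `H`). -/
def cnnOutCov (φ : ℝ → ℝ) (σw σb s : ℝ) (H k : ℕ) {m : ℕ} [NeZero m] {n₀ : ℕ}
    (x x' : Fin n₀ → ZMod m → ℝ) : ℝ :=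
  s ^ 2 * ∑ α : ZMod m, gpExp φ (cnnCov φ σw σb k (H - 1)) (α, x) (α, x')

end

/-! Conditionally on its input `y`, a layer is a linear image of independent Haar weights and a
Gaussian bias. Two facts are alternated: such a layer is nearly Gaussian with covariance read off
from the empirical second moments `gram y`, and after the activation these second moments obey a law
of large numbers.

The first fact is a quantitative Borel theorem, `norm_haarOrthogonal_char_sub_le`. Let `g` be an `N
× r` array of standard Gaussians, independent of a Haar matrix `Q`. Integrating over `g` first, the
array `gᵀ Q` has exactly the Gaussian characteristic function, because `Q` is an isometry. On the
other hand `gᵀ = √N S O₁`, where `S` is the square root of the empirical covariance and `O₁`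
consists of `r` rows of an orthogonal matrix `O`. Left invariance of Haar measure absorbs `O`, and
`S` differs from the identity by `O(N^(-1/2))` in mean. So `r` rows of `√N Q`, tested against any
vectors, have a Gaussian characteristic function up to `O(N^(-1/2))` times the lengths of the
vectors. Only `N = max p q` enters, hence no condition on ratios of widths. Together with `L¹`
convergence of the Gram entries this gives `AsymptoticGram.asymptoticGaussian_layer`.

For the second fact, the law of the pre-activations is invariant under left multiplication by
`O(p)`, hence exchangeable in the channels, and two distinct channels are asymptotically
independent. A second moment computation then proves the law of large numbers for bounded continuous
activations (`tendsto_average`). Passing to a merely measurable `φ` of linear growth requires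
approximation in `L²` uniformly along the sequence (`UniformlyTame.exists_approx`). Tails are
controlled by convergence of second moments. Sets of small Lebesgue measure are controlled by
rotation invariance: averaging over rotations of two channels turns a coordinate into a radius times
a cosine, whose law is absolutely continuous, and the radius is rarely small when the limit is
nondegenerate.

A degenerate limit, `K u u = 0`, needs separate bookkeeping: a measurable `φ` can be wild near `0`,
so closeness to `0` is useless. The induction therefore carries the stronger statement that, with
probability tending to one, the whole layer vanishes at `u`. -/

open MeasureTheory ProbabilityTheory Filter Topology

noncomputable section

/-! ### Orthogonal matrices and Gram matrices -/

/-- Two families of vectors with the same Gram matrix differ by a linear isometry. -/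
theorem exists_linearIsometry_of_inner_eq {ι E : Type*} [Fintype ι] [NormedAddCommGroup E]
    [InnerProductSpace ℝ E] [FiniteDimensional ℝ E] (u v : ι → E)
    (h : ∀ i j, inner ℝ (u i) (u j) = inner ℝ (v i) (v j)) :
    ∃ O : E →ₗᵢ[ℝ] E, ∀ i, O (v i) = u i := by
  let U : (ι → ℝ) →ₗ[ℝ] E := Fintype.linearCombination ℝ u
  let V : (ι → ℝ) →ₗ[ℝ] E := Fintype.linearCombination ℝ v
  have hnorm : ∀ t, ‖U t‖ = ‖V t‖ := by
    intro t
    have : inner ℝ (U t) (U t) = inner ℝ (V t) (V t) := by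
      simp only [U, V, Fintype.linearCombination_apply, sum_inner, inner_sum, real_inner_smul_left,
        real_inner_smul_right, h]
    rw [real_inner_self_eq_norm_sq, real_inner_self_eq_norm_sq] at this
    exact (sq_eq_sq₀ (norm_nonneg _) (norm_nonneg _)).mp this
  -- Since `U t` and `V t` have the same length, `V t ↦ U t` is a well-defined isometry on the range
  -- of `V`; finite dimensionality extends it to `E`.
  have hker : LinearMap.ker V ≤ LinearMap.ker U := by
    intro t ht
    rw [LinearMap.mem_ker] at ht ⊢
    rw [← norm_eq_zero, hnorm, ht, norm_zero]
  let W : LinearMap.range V →ₗ[ℝ] E :=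
    (Submodule.liftQ (LinearMap.ker V) U hker) ∘ₗ V.quotKerEquivRange.symm.toLinearMap
  have hW : ∀ t, W ⟨V t, LinearMap.mem_range_self V t⟩ = U t := by
    intro t
    simp only [W, LinearMap.comp_apply, LinearEquiv.coe_coe]
    rw [LinearMap.quotKerEquivRange_symm_apply_image V t (LinearMap.mem_range_self V t)]
    simp
  let L : LinearMap.range V →ₗᵢ[ℝ] E := ⟨W, by
    rintro ⟨_, t, rfl⟩
    rw [hW, hnorm]
    rfl⟩
  refine ⟨L.extend, fun i => ?_⟩
  classical
  have hv : V (Pi.single i 1) = v i := by simp [V]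
  have hu : U (Pi.single i 1) = u i := by simp [U]
  have := L.extend_apply ⟨V (Pi.single i 1), LinearMap.mem_range_self V _⟩
  rw [← hv, ← hu, ← hW]
  exact this

/-- Two matrices with the same Gram matrix of rows differ by right multiplication by an orthogonal
matrix. -/
theorem exists_orthogonal_of_gram_eq {ι : Type*} [Fintype ι] {N : ℕ} (A B : ι → Fin N → ℝ)
    (h : ∀ i j, ∑ k, A i k * A j k = ∑ k, B i k * B j k) :
    ∃ O : Matrix.orthogonalGroup (Fin N) ℝ, ∀ i k, A i k = ∑ l, B i l * O.1 l k := by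
  obtain ⟨O, hO⟩ := exists_linearIsometry_of_inner_eq
    (fun i => (WithLp.toLp 2 (A i) : EuclideanSpace ℝ (Fin N))) (fun i => WithLp.toLp 2 (B i)) (by
      intro i j
      simp only [PiLp.inner_apply, RCLike.inner_apply, conj_trivial]
      have := h i j
      simpa only [mul_comm] using this)
  -- The images of the basis vectors are the rows, since the matrix acts on row vectors from the
  -- right.
  let M : Matrix (Fin N) (Fin N) ℝ := Matrix.of fun i j => O (EuclideanSpace.single i 1) j
  have hM : M ∈ Matrix.orthogonalGroup (Fin N) ℝ := by
    rw [Matrix.mem_orthogonalGroup_iff]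
    ext i j
    have := O.inner_map_map (EuclideanSpace.single i 1) (EuclideanSpace.single j 1)
    simp only [PiLp.inner_apply, RCLike.inner_apply, conj_trivial] at this
    rw [Matrix.mul_apply, Matrix.one_apply]
    refine (Finset.sum_congr rfl fun x _ => mul_comm _ _).trans (this.trans ?_)
    simp [eq_comm]
  refine ⟨⟨M, hM⟩, fun i k => ?_⟩
  have h1 : (WithLp.toLp 2 (B i) : EuclideanSpace ℝ (Fin N))
      = ∑ l, B i l • EuclideanSpace.single l (1 : ℝ) := by
    ext m
    simp [Finset.sum_apply, Pi.single_apply]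
  have h2 := congrArg (fun z : EuclideanSpace ℝ (Fin N) => z k) (hO i)
  simp only [h1, map_sum, map_smul] at h2
  rw [← h2]
  simp [M]

/-- `‖S - 1‖ ≤ ‖S² - 1‖` in Frobenius norm, for positive semidefinite `S`. -/
theorem Matrix.PosSemidef.sum_sq_sub_one_le {ι : Type*} [Fintype ι] [DecidableEq ι]
    {S : Matrix ι ι ℝ} (hS : S.PosSemidef) :
    ∑ i, ∑ k, (S - 1) i k ^ 2 ≤ ∑ i, ∑ k, (S * S - 1) i k ^ 2 := by
  have hT : S.transpose = S := by
    have := hS.isHermitian.eq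
    rwa [Matrix.conjTranspose_eq_transpose_of_trivial] at this
  have key : ∀ M : Matrix ι ι ℝ, M.transpose = M → ∑ i, ∑ k, M i k ^ 2 = (M * M).trace := by
    intro M hM
    simp only [Matrix.trace, Matrix.diag, Matrix.mul_apply]
    refine Finset.sum_congr rfl fun i _ => Finset.sum_congr rfl fun k _ => ?_
    have : M k i = M i k := by rw [← Matrix.transpose_apply M k i, hM]
    rw [this, sq]
  have h1 : (S - 1).transpose = S - 1 := by simp [hT]
  have h2 : (S * S - 1).transpose = S * S - 1 := by simp [hT]
  rw [key _ h1, key _ h2, ← sub_nonneg, ← Matrix.trace_sub]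
  -- From `S² - 1 = (S - 1)(S + 1)` and `(S + 1)² - 1 = S² + 2S`. The middle factor is positive
  -- semidefinite, so the conjugated product has nonnegative trace.
  have e : (S * S - 1) * (S * S - 1) - (S - 1) * (S - 1)
      = (S - 1) * (S * S + (S + S)) * (S - 1) := by noncomm_ring
  rw [e]
  have hP : (S * S + (S + S)).PosSemidef := by
    refine Matrix.PosSemidef.add ?_ (hS.add hS)
    have := Matrix.posSemidef_conjTranspose_mul_self S
    rwa [hS.isHermitian.eq] at this
  have := (hP.mul_mul_conjTranspose_same (S - 1)).trace_nonneg
  rwa [Matrix.conjTranspose_eq_transpose_of_trivial, h1] at this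

open scoped MatrixOrder in
theorem Matrix.PosSemidef.exists_mul_self_eq {ι : Type*} [Fintype ι] [DecidableEq ι]
    {A : Matrix ι ι ℝ} (h : A.PosSemidef) : ∃ S : Matrix ι ι ℝ, S.PosSemidef ∧ S * S = A :=
  ⟨CFC.sqrt A, Matrix.nonneg_iff_posSemidef.mp (CFC.sqrt_nonneg A), CFC.sqrt_mul_sqrt_self A h.nonneg⟩

/-! ### Moments of Haar orthogonal matrices -/

instance haarOrthogonal_isMulLeftInvariant (N : ℕ) : (haarOrthogonal N).IsMulLeftInvariant := by
  unfold haarOrthogonal; infer_instance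

theorem continuous_orthogonal_entry {N : ℕ} (i j : Fin N) :
    Continuous fun Q : Matrix.orthogonalGroup (Fin N) ℝ => Q.1 i j :=
  continuous_subtype_val.matrix_elem _ _

theorem Matrix.orthogonalGroup.sum_sq_mulVec {N : ℕ} (Q : Matrix.orthogonalGroup (Fin N) ℝ)
    (w : Fin N → ℝ) : ∑ i, (∑ j, Q.1 i j * w j) ^ 2 = ∑ j, w j ^ 2 := by
  have h : Matrix.transpose Q.1 * Q.1 = 1 := by
    exact (Matrix.mem_orthogonalGroup_iff' (Fin N) ℝ).mp Q.2
  have h2 : (Q.1.mulVec w) ⬝ᵥ (Q.1.mulVec w) = w ⬝ᵥ w := by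
    rw [Matrix.dotProduct_mulVec, Matrix.vecMul_mulVec, ← Matrix.dotProduct_mulVec, h, Matrix.one_mulVec]
  simp only [dotProduct, Matrix.mulVec] at h2
  simpa only [sq] using h2

/-- The permutation matrix of `σ`, as an orthogonal matrix. -/
def orthPerm {N : ℕ} (σ : Equiv.Perm (Fin N)) : Matrix.orthogonalGroup (Fin N) ℝ :=
  ⟨Matrix.of fun i j => if σ i = j then 1 else 0, by
    rw [Matrix.mem_orthogonalGroup_iff]
    ext i j
    simp [Matrix.mul_apply, Matrix.one_apply]⟩

theorem sum_orthPerm {N : ℕ} (σ : Equiv.Perm (Fin N)) (i : Fin N) (f : Fin N → ℝ) :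
    ∑ k, (orthPerm σ).1 i k * f k = f (σ i) := by
  simp [orthPerm]

theorem integrable_haarOrthogonal_of_continuous {N : ℕ} {F : Type*} [NormedAddCommGroup F]
    {f : Matrix.orthogonalGroup (Fin N) ℝ → F} (hf : Continuous f) :
    Integrable f (haarOrthogonal N) :=
  hf.integrable_of_hasCompactSupport (HasCompactSupport.of_compactSpace f)

theorem continuous_orthogonal_row {N : ℕ} (i : Fin N) (w : Fin N → ℝ) :
    Continuous fun Q : Matrix.orthogonalGroup (Fin N) ℝ => ∑ j, Q.1 i j * w j :=
  continuous_finsetSum _ fun j _ => (continuous_orthogonal_entry i j).mul continuous_const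

/-- Left invariance under permutation matrices gives all entries of `Q w` the same second moment,
and their squares sum to `|w|²`. -/
theorem integral_haarOrthogonal_row_sq {N : ℕ} (i : Fin N) (w : Fin N → ℝ) :
    (N : ℝ) * ∫ Q, (∑ j, Q.1 i j * w j) ^ 2 ∂(haarOrthogonal N) = ∑ j, w j ^ 2 := by
  have hrow : ∀ k, ∫ Q, (∑ j, Q.1 k j * w j) ^ 2 ∂(haarOrthogonal N)
      = ∫ Q, (∑ j, Q.1 i j * w j) ^ 2 ∂(haarOrthogonal N) := by
    intro k
    rw [← integral_mul_left_eq_self _ (orthPerm (Equiv.swap k i))]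
    refine integral_congr_ae (.of_forall fun Q => ?_)
    simp only [Matrix.UnitaryGroup.mul_val, Matrix.mul_apply, sum_orthPerm, Equiv.swap_apply_left]
  have hsum : ∑ k, ∫ Q, (∑ j, Q.1 k j * w j) ^ 2 ∂(haarOrthogonal N) = ∑ j, w j ^ 2 := by
    refine (integral_finsetSum _ fun k _ => integrable_haarOrthogonal_of_continuous
      ((continuous_orthogonal_row k w).pow 2)).symm.trans ?_
    simp [Matrix.orthogonalGroup.sum_sq_mulVec]
  rw [← hsum]
  simp [hrow]

/-- Since `-1` is orthogonal, left invariance makes the integral equal to its own negative. -/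
theorem integral_haarOrthogonal_row {N : ℕ} (i : Fin N) (w : Fin N → ℝ) :
    ∫ Q, (∑ j, Q.1 i j * w j) ∂(haarOrthogonal N) = 0 := by
  have h := integral_mul_left_eq_self (μ := haarOrthogonal N) (fun Q => ∑ j, Q.1 i j * w j) (-1)
  have h2 : ∀ Q : Matrix.orthogonalGroup (Fin N) ℝ,
      ∑ j, ((-1) * Q : Matrix.orthogonalGroup (Fin N) ℝ).1 i j * w j = -∑ j, Q.1 i j * w j := by
    intro Q
    rw [neg_mul, one_mul, ← Finset.sum_neg_distrib]
    exact Finset.sum_congr rfl fun j _ => neg_mul _ _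
  simp_rw [h2, integral_neg] at h
  linarith

theorem sqrt_mul_integral_abs_haarOrthogonal_row_le {N : ℕ} (i : Fin N) (w : Fin N → ℝ) :
    √N * ∫ Q, |∑ j, Q.1 i j * w j| ∂(haarOrthogonal N) ≤ √(∑ j, w j ^ 2) := by
  have hc := continuous_orthogonal_row i w
  have h1 : (∫ Q, |∑ j, Q.1 i j * w j| ∂(haarOrthogonal N)) ^ 2
      ≤ ∫ Q, (∑ j, Q.1 i j * w j) ^ 2 ∂(haarOrthogonal N) := by
    -- Nonnegativity of the variance of `|X|` is the inequality `(E|X|)² ≤ E X²`.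
    have := variance_nonneg (fun Q => |∑ j, Q.1 i j * w j|) (haarOrthogonal N)
    rw [variance_eq_sub] at this
    · simpa using this
    · exact (hc.abs.memLp_of_hasCompactSupport (HasCompactSupport.of_compactSpace _))
  refine Real.le_sqrt_of_sq_le ?_
  rw [mul_pow, Real.sq_sqrt (Nat.cast_nonneg _), ← integral_haarOrthogonal_row_sq i w]
  gcongr

/-! ### Gaussian arrays -/

theorem integral_pi_gaussian_char {κ : Type*} [Fintype κ] (a : κ → ℝ) :
    ∫ g, Complex.exp ((∑ k, g k * a k : ℝ) * Complex.I) ∂(Measure.pi fun _ : κ => gaussianReal 0 1)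
      = Complex.exp (-((∑ k, a k ^ 2 : ℝ) / 2)) := by
  have h : ∀ g : κ → ℝ, Complex.exp ((∑ k, g k * a k : ℝ) * Complex.I)
      = ∏ k, Complex.exp ((a k : ℂ) * (g k : ℂ) * Complex.I) := by
    intro g
    rw [← Complex.exp_sum, ← Finset.sum_mul]
    push_cast
    simp_rw [mul_comm]
  simp_rw [h]
  rw [integral_fintype_prod_eq_prod (𝕜 := ℂ)
    (fun k (x : ℝ) => Complex.exp ((a k : ℂ) * (x : ℂ) * Complex.I))]
  simp_rw [← charFun_apply_real, charFun_gaussianReal, ← Complex.exp_sum]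
  congr 1
  push_cast
  rw [Finset.sum_div, ← Finset.sum_neg_distrib]
  refine Finset.sum_congr rfl fun k _ => ?_
  simp

theorem memLp_pi_gaussian_mul {ι : Type*} [Fintype ι] (k l : ι) :
    MemLp (fun c : ι → ℝ => c k * c l) 2 (Measure.pi fun _ : ι => gaussianReal 0 1) := by
  have h : ∀ m : ι, MemLp (fun c : ι → ℝ => c m) 4 (Measure.pi fun _ : ι => gaussianReal 0 1) :=
    fun m => (memLp_id_gaussianReal (μ := 0) (v := 1) 4).comp_measurePreserving
      (measurePreserving_eval (fun _ : ι => gaussianReal 0 1) m)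
  have : ENNReal.HolderTriple 4 4 2 := ⟨by
    rw [← two_mul]
    have : (4 : ENNReal) = 2 * 2 := by norm_num
    rw [this, ENNReal.mul_inv (by simp) (by simp), ← mul_assoc,
      ENNReal.mul_inv_cancel (by simp) (by simp), one_mul]⟩
  exact (h l).mul (h k)

theorem integral_pi_gaussian_mul {ι : Type*} [Fintype ι] [DecidableEq ι] (k l : ι) :
    ∫ c, c k * c l ∂(Measure.pi fun _ : ι => gaussianReal 0 1) = (1 : Matrix ι ι ℝ) k l := by
  have hm : ∀ m, MemLp (fun c : ι → ℝ => c m) 2 (Measure.pi fun _ : ι => gaussianReal 0 1) :=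
    fun m => (memLp_id_gaussianReal (μ := 0) (v := 1) 2).comp_measurePreserving
      (measurePreserving_eval (fun _ : ι => gaussianReal 0 1) m)
  have h0 : ∀ m, ∫ c, c m ∂(Measure.pi fun _ : ι => gaussianReal 0 1) = 0 := fun m => by
    rw [integral_comp_eval (μ := fun _ : ι => gaussianReal 0 1) (i := m) (f := fun x : ℝ => x)
      (by fun_prop)]
    simp
  by_cases hkl : k = l
  · subst hkl
    rw [Matrix.one_apply_eq]
    have : ∫ x, x * x ∂(gaussianReal 0 1) = 1 := by
      have h := variance_fun_id_gaussianReal (μ := 0) (v := 1)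
      rw [variance_eq_sub (X := fun x : ℝ => x) (memLp_id_gaussianReal 2)] at h
      simpa [sq] using h
    rw [← this, integral_comp_eval (μ := fun _ : ι => gaussianReal 0 1) (i := k)
      (f := fun x : ℝ => x * x) (by fun_prop)]
  · rw [Matrix.one_apply_ne hkl]
    have hind := (iIndepFun_pi (μ := fun _ : ι => gaussianReal 0 1) (X := fun _ x => x)
      (fun _ => aemeasurable_id)).indepFun hkl
    rw [hind.integral_fun_mul_eq_mul_integral (hm k).1 (hm l).1, h0, zero_mul]

/-! ### Characteristic functions of finitely many rows of a Haar orthogonal matrix -/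

theorem norm_exp_mul_I_sub_exp_mul_I_le (x y : ℝ) :
    ‖Complex.exp (x * Complex.I) - Complex.exp (y * Complex.I)‖ ≤ |x - y| := by
  have h : Complex.exp (x * Complex.I) - Complex.exp (y * Complex.I)
      = Complex.exp (y * Complex.I) * (Complex.exp (Complex.I * ((x - y : ℝ) : ℂ)) - 1) := by
    rw [mul_sub, mul_one, ← Complex.exp_add]
    congr 2
    push_cast
    ring
  rw [h, norm_mul, Complex.norm_exp_ofReal_mul_I, one_mul]
  exact Real.norm_exp_I_mul_ofReal_sub_one_le

/-- The deviation of the empirical covariance of the rows of `g` from the identity. -/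
def covDev {ι : Type*} [Fintype ι] [DecidableEq ι] {N : ℕ} (g : Fin N → ι → ℝ) (k l : ι) : ℝ :=
  (N : ℝ)⁻¹ * ∑ j, g j k * g j l - (1 : Matrix ι ι ℝ) k l

/-- The law of an array of independent standard Gaussian variables. -/
def gaussArray (ι : Type*) [Fintype ι] (N : ℕ) : Measure (Fin N → ι → ℝ) :=
  Measure.pi fun _ => Measure.pi fun _ => gaussianReal 0 1

instance (ι : Type*) [Fintype ι] (N : ℕ) : IsProbabilityMeasure (gaussArray ι N) := by
  unfold gaussArray; infer_instance

theorem memLp_covDev {ι : Type*} [Fintype ι] [DecidableEq ι] {N : ℕ} (k l : ι) :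
    MemLp (fun g : Fin N → ι → ℝ => covDev g k l) 2 (gaussArray ι N) := by
  have h : ∀ j : Fin N, MemLp (fun g : Fin N → ι → ℝ => g j k * g j l) 2 (gaussArray ι N) :=
    fun j => (memLp_pi_gaussian_mul k l).comp_measurePreserving
      (measurePreserving_eval (fun _ : Fin N => Measure.pi fun _ : ι => gaussianReal 0 1) j)
  exact ((memLp_finsetSum Finset.univ fun j _ => h j).const_mul _).sub (memLp_const _)

/-- The deviation is a centered average of `N` independent identically distributed terms, so its
variance is that of one term divided by `N`; the `L¹` norm is at most the `L²` norm. -/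
theorem integral_abs_covDev_le {ι : Type*} [Fintype ι] [DecidableEq ι] {N : ℕ} (hN : 0 < N)
    (k l : ι) :
    ∫ g, |covDev g k l| ∂(gaussArray ι N) ≤
      √(Var[fun c : ι → ℝ => c k * c l; Measure.pi fun _ : ι => gaussianReal 0 1]) / √N := by
  have hNR : (0 : ℝ) < N := Nat.cast_pos.mpr hN
  set γ := Measure.pi fun _ : ι => gaussianReal 0 1
  have hmp := fun j => measurePreserving_eval (fun _ : Fin N => γ) j
  have hL : ∀ j : Fin N, MemLp (fun g : Fin N → ι → ℝ => g j k * g j l) 2 (gaussArray ι N) :=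
    fun j => (memLp_pi_gaussian_mul k l).comp_measurePreserving (hmp j)
  have hmean : ∫ g, covDev g k l ∂(gaussArray ι N) = 0 := by
    unfold covDev
    rw [integral_sub ((integrable_finsetSum _ fun j _ => (hL j).integrable one_le_two).const_mul _)
      (integrable_const _), integral_const_mul,
      integral_finsetSum _ fun j _ => (hL j).integrable one_le_two]
    have : ∀ j : Fin N, ∫ g, g j k * g j l ∂(gaussArray ι N) = (1 : Matrix ι ι ℝ) k l := by
      intro j
      rw [← integral_pi_gaussian_mul k l]
      exact integral_comp_eval (μ := fun _ : Fin N => γ) (i := j)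
        (f := fun c : ι → ℝ => c k * c l) (memLp_pi_gaussian_mul k l).1
    simp [this, hNR.ne']
  have hvar : ∫ g, covDev g k l ^ 2 ∂(gaussArray ι N) = Var[fun c : ι → ℝ => c k * c l; γ] / N := by
    have h1 : Var[fun g => covDev g k l; gaussArray ι N] = ∫ g, covDev g k l ^ 2 ∂(gaussArray ι N) := by
      rw [variance_of_integral_eq_zero (memLp_covDev k l).1.aemeasurable hmean]
    rw [← h1]
    unfold covDev
    rw [variance_sub_const (by
      exact ((memLp_finsetSum _ fun j _ => hL j).const_mul _).1), variance_const_mul]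
    have := variance_sum_pi (μ := fun _ : Fin N => γ) (X := fun _ c => c k * c l)
      (fun _ => memLp_pi_gaussian_mul k l)
    simp only [Finset.sum_const, Finset.card_univ, Fintype.card_fin, nsmul_eq_mul] at this
    have h2 : (fun g : Fin N → ι → ℝ => ∑ j, g j k * g j l)
        = ∑ j, fun g : Fin N → ι → ℝ => g j k * g j l := by
      ext g; simp
    rw [h2]
    refine (congrArg _ this).trans ?_
    field_simp
  have hle : (∫ g, |covDev g k l| ∂(gaussArray ι N)) ^ 2 ≤ ∫ g, covDev g k l ^ 2 ∂(gaussArray ι N) := by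
    have := variance_nonneg (fun g => |covDev g k l|) (gaussArray ι N)
    rw [variance_eq_sub (X := fun g => |covDev g k l|) (memLp_covDev k l).abs] at this
    simpa using this
  rw [← Real.sqrt_div' _ hNR.le]
  refine Real.le_sqrt_of_sq_le ?_
  rwa [← hvar]

/-- Polar decomposition of a wide matrix, with the deviation of the positive part from a multiple of
the identity controlled by that of the Gram matrix. -/
theorem exists_polar {ι : Type*} [Fintype ι] [DecidableEq ι] {N : ℕ} (hN : 0 < N) (e : ι ↪ Fin N)
    (g : Fin N → ι → ℝ) :
    ∃ (S : Matrix ι ι ℝ) (O : Matrix.orthogonalGroup (Fin N) ℝ),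
      (∀ k l, |(S - 1) k l| ≤ ∑ k, ∑ l, |covDev g k l|) ∧
      ∀ m k, g m k = √N * ∑ l, S k l * O.1 (e l) m := by
  have hNR : (0 : ℝ) < N := Nat.cast_pos.mpr hN
  let M : Matrix ι ι ℝ := Matrix.of fun k l => (N : ℝ)⁻¹ * ∑ j, g j k * g j l
  have hM : M.PosSemidef := by
    have h1 := (Matrix.posSemidef_conjTranspose_mul_self (Matrix.of g)).smul
      (inv_nonneg.mpr hNR.le)
    convert h1 using 1
    ext k l
    simp [M, Matrix.mul_apply]
  obtain ⟨S, hS, hSM⟩ := hM.exists_mul_self_eq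
  have hT : ∀ k l, S l k = S k l := fun k l => by
    have := hS.isHermitian.apply k l
    simpa using this
  -- `B` is `√N S` placed in the columns selected by `e`. Its Gram matrix is `N S² = N M`, which is
  -- also that of the columns of `g`, so the two differ by an orthogonal matrix `O`.
  let B : ι → Fin N → ℝ := fun k m => √N * ∑ l, if e l = m then S k l else 0
  have hBsum : ∀ k (f : Fin N → ℝ), ∑ m, B k m * f m = √N * ∑ l, S k l * f (e l) := by
    intro k f
    simp only [B, mul_assoc, ← Finset.mul_sum]
    congr 1
    simp_rw [Finset.sum_mul]
    rw [Finset.sum_comm]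
    simp
  have hBe : ∀ k l, B k (e l) = √N * S k l := by
    intro k l
    simp [B, e.injective.eq_iff]
  obtain ⟨O, hO⟩ := exists_orthogonal_of_gram_eq (fun k m => g m k) B (by
    intro k l
    rw [hBsum]
    simp only [hBe]
    have h1 : M k l = ∑ m, S k m * S m l := by rw [← hSM, Matrix.mul_apply]
    have h2 : ∑ j, g j k * g j l = N * M k l := by
      simp only [M, Matrix.of_apply]
      rw [mul_inv_cancel_left₀ hNR.ne']
    rw [h2, h1, Finset.mul_sum, Finset.mul_sum]
    refine Finset.sum_congr rfl fun m _ => ?_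
    have := Real.mul_self_sqrt hNR.le
    linear_combination (-(S k m * S l m)) * this + (↑N * S k m) * (hT l m))
  refine ⟨S, O, fun k l => ?_, fun m k => ?_⟩
  · have hdev : ∀ k l, (S * S - 1) k l = covDev g k l := fun k l => by
      rw [hSM]; rfl
    have h1 := hS.sum_sq_sub_one_le
    simp only [hdev] at h1
    have h2 : (S - 1) k l ^ 2 ≤ ∑ i, ∑ k, (S - 1) i k ^ 2 := by
      refine le_trans ?_ (Finset.single_le_sum (f := fun i => ∑ k, (S - 1) i k ^ 2)
        (fun i _ => by positivity) (Finset.mem_univ k))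
      exact Finset.single_le_sum (f := fun l => (S - 1) k l ^ 2)
        (fun i _ => by positivity) (Finset.mem_univ l)
    have h3 : ∑ k, ∑ l, covDev g k l ^ 2 ≤ (∑ k, ∑ l, |covDev g k l|) ^ 2 := by
      refine le_trans (Finset.sum_le_sum fun k _ => ?_)
        (Finset.sum_sq_le_sq_sum_of_nonneg fun k _ => by positivity)
      simpa only [sq_abs] using Finset.sum_sq_le_sq_sum_of_nonneg
        (f := fun l => |covDev g k l|) (s := Finset.univ) fun l _ => by positivity
    exact abs_le_of_sq_le_sq (h2.trans (h1.trans h3)) (by positivity)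
  · rw [hO k m, hBsum]

/-- With `g` fixed, the polar decomposition rewrites `gᵀ Q` as `√N S` applied to the selected rows
of `O Q`, and `O` disappears by left invariance. The phases then differ by `√N (S - 1)` applied to
rows of `Q`, and `√N E|row · w| ≤ |w|` cancels the factor `√N`. -/
theorem norm_integral_haarOrthogonal_sub_le {ι : Type*} [Fintype ι] [DecidableEq ι] {N : ℕ}
    (hN : 0 < N) (e : ι ↪ Fin N) (g : Fin N → ι → ℝ) (w : ι → Fin N → ℝ) :
    ‖∫ Q, Complex.exp ((∑ m, ∑ k, g m k * ∑ j, Q.1 m j * w k j : ℝ) * Complex.I) ∂(haarOrthogonal N)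
      - ∫ Q, Complex.exp ((√N * ∑ k, ∑ j, Q.1 (e k) j * w k j : ℝ) * Complex.I)
        ∂(haarOrthogonal N)‖
      ≤ (∑ k, ∑ l, |covDev g k l|) * (Fintype.card ι * ∑ k, √(∑ j, w k j ^ 2)) := by
  obtain ⟨S, O, hS, hO⟩ := exists_polar hN e g
  set Δ := ∑ k, ∑ l, |covDev g k l|
  let R : Matrix.orthogonalGroup (Fin N) ℝ → ι → ι → ℝ := fun Q l k => ∑ j, Q.1 (e l) j * w k j
  have hR : ∀ l k, Continuous fun Q => R Q l k := fun l k => continuous_orthogonal_row (e l) (w k)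
  have h1 : ∀ Q : Matrix.orthogonalGroup (Fin N) ℝ,
      ∑ m, ∑ k, g m k * ∑ j, Q.1 m j * w k j = √N * ∑ k, ∑ l, S k l * R (O * Q) l k := by
    intro Q
    rw [Finset.sum_comm, Finset.mul_sum]
    refine Finset.sum_congr rfl fun k _ => ?_
    simp only [R, Matrix.UnitaryGroup.mul_val, Matrix.mul_apply, hO]
    simp only [Finset.mul_sum, Finset.sum_mul]
    have h3 : ∀ m j : Fin N, (∑ l, √N * (S k l * O.1 (e l) m)) * (Q.1 m j * w k j)
        = ∑ l, √N * (S k l * (O.1 (e l) m * Q.1 m j * w k j)) := by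
      intro m j
      rw [Finset.sum_mul]
      exact Finset.sum_congr rfl fun l _ => by ring
    rw [Finset.sum_comm]
    trans ∑ j, ∑ m, ∑ l, √N * (S k l * (O.1 (e l) m * Q.1 m j * w k j))
    · refine Finset.sum_congr rfl fun j _ => Finset.sum_congr rfl fun m _ => ?_
      rw [← h3, Finset.sum_mul]
    trans ∑ j, ∑ l, ∑ m, √N * (S k l * (O.1 (e l) m * Q.1 m j * w k j))
    · exact Finset.sum_congr rfl fun j _ => Finset.sum_comm
    rw [Finset.sum_comm]
  simp_rw [h1]
  rw [integral_mul_left_eq_self (μ := haarOrthogonal N)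
    (fun Q => Complex.exp ((√N * ∑ k, ∑ l, S k l * R Q l k : ℝ) * Complex.I)) O]
  have hc1 : Continuous fun Q => Complex.exp ((√N * ∑ k, ∑ l, S k l * R Q l k : ℝ) * Complex.I) := by
    fun_prop
  have hc2 : Continuous fun Q => Complex.exp ((√N * ∑ k, R Q k k : ℝ) * Complex.I) := by
    fun_prop
  rw [← integral_sub (integrable_haarOrthogonal_of_continuous hc1)
    (integrable_haarOrthogonal_of_continuous hc2)]
  have hInt : ∀ l k, Integrable (fun Q => |R Q l k|) (haarOrthogonal N) := fun l k =>
    integrable_haarOrthogonal_of_continuous (hR l k).abs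
  calc _ ≤ ∫ Q, √N * ∑ k, ∑ l, Δ * |R Q l k| ∂(haarOrthogonal N) := by
        refine norm_integral_le_of_norm_le ?_ (.of_forall fun Q => ?_)
        · exact (integrable_finsetSum _ fun k _ => integrable_finsetSum _ fun l _ =>
            (hInt l k).const_mul _).const_mul _
        · refine (norm_exp_mul_I_sub_exp_mul_I_le _ _).trans ?_
          have : (√N * ∑ k, ∑ l, S k l * R Q l k) - √N * ∑ k, R Q k k
              = √N * ∑ k, ∑ l, (S - 1) k l * R Q l k := by
            rw [← mul_sub, ← Finset.sum_sub_distrib]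
            congr 1
            refine Finset.sum_congr rfl fun k _ => ?_
            simp [Matrix.sub_apply, sub_mul, Matrix.one_apply]
          rw [this, abs_mul, abs_of_nonneg (Real.sqrt_nonneg _)]
          gcongr
          refine (Finset.abs_sum_le_sum_abs _ _).trans (Finset.sum_le_sum fun k _ => ?_)
          refine (Finset.abs_sum_le_sum_abs _ _).trans (Finset.sum_le_sum fun l _ => ?_)
          rw [abs_mul]
          gcongr
          exact hS k l
    _ = Δ * ∑ k, ∑ l, √N * ∫ Q, |R Q l k| ∂(haarOrthogonal N) := by
        rw [integral_const_mul, integral_finsetSum _ fun k _ => integrable_finsetSum _ fun l _ =>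
            (hInt l k).const_mul _, Finset.mul_sum, Finset.mul_sum]
        refine Finset.sum_congr rfl fun k _ => ?_
        rw [integral_finsetSum _ fun l _ => (hInt l k).const_mul _, Finset.mul_sum, Finset.mul_sum]
        refine Finset.sum_congr rfl fun l _ => ?_
        rw [integral_const_mul]
        ring
    _ ≤ Δ * ∑ k, ∑ l : ι, √(∑ j, w k j ^ 2) := by
        have : 0 ≤ Δ := by positivity
        gcongr
        exact sqrt_mul_integral_abs_haarOrthogonal_row_le _ _
    _ = _ := by
        simp [Finset.mul_sum]

theorem integral_gaussArray_char {ι : Type*} [Fintype ι] {N : ℕ} (a : Fin N → ι → ℝ) :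
    ∫ g, Complex.exp ((∑ m, ∑ k, g m k * a m k : ℝ) * Complex.I) ∂(gaussArray ι N)
      = Complex.exp (-((∑ m, ∑ k, a m k ^ 2 : ℝ) / 2)) := by
  have h : ∀ g : Fin N → ι → ℝ, Complex.exp ((∑ m, ∑ k, g m k * a m k : ℝ) * Complex.I)
      = ∏ m, Complex.exp ((∑ k, g m k * a m k : ℝ) * Complex.I) := by
    intro g
    rw [← Complex.exp_sum, ← Finset.sum_mul]
    push_cast
    rfl
  simp_rw [h]
  rw [gaussArray, integral_fintype_prod_eq_prod (𝕜 := ℂ)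
    (fun m (c : ι → ℝ) => Complex.exp ((∑ k, c k * a m k : ℝ) * Complex.I))]
  simp_rw [integral_pi_gaussian_char, ← Complex.exp_sum]
  congr 1
  push_cast
  rw [Finset.sum_neg_distrib, Finset.sum_div]

/-- The constant in the comparison of Haar orthogonal and Gaussian matrices. -/
def haarConst (ι : Type*) [Fintype ι] : ℝ :=
  (∑ k : ι, ∑ l : ι, √(Var[fun c : ι → ℝ => c k * c l; Measure.pi fun _ : ι => gaussianReal 0 1]))
    * Fintype.card ι

theorem haarConst_nonneg (ι : Type*) [Fintype ι] : 0 ≤ haarConst ι := by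
  unfold haarConst; positivity

/-- Quantitative Borel theorem: finitely many rows of `√N Q`, tested against arbitrary vectors, are
asymptotically Gaussian. -/
theorem norm_haarOrthogonal_char_sub_le {ι : Type*} [Fintype ι] {N : ℕ} (hN : 0 < N)
    (e : ι ↪ Fin N) (w : ι → Fin N → ℝ) :
    ‖∫ Q, Complex.exp ((√N * ∑ k, ∑ j, Q.1 (e k) j * w k j : ℝ) * Complex.I) ∂(haarOrthogonal N)
      - Complex.exp (-((∑ k, ∑ j, w k j ^ 2 : ℝ) / 2))‖
      ≤ haarConst ι / √N * ∑ k, √(∑ j, w k j ^ 2) := by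
  classical
  set W := ∑ k, √(∑ j, w k j ^ 2)
  let F : (Fin N → ι → ℝ) → Matrix.orthogonalGroup (Fin N) ℝ → ℂ := fun g Q =>
    Complex.exp ((∑ m, ∑ k, g m k * ∑ j, Q.1 m j * w k j : ℝ) * Complex.I)
  have hF : Continuous (Function.uncurry F) := by
    have : ∀ m k, Continuous fun Q : Matrix.orthogonalGroup (Fin N) ℝ => ∑ j, Q.1 m j * w k j :=
      fun m k => continuous_orthogonal_row m (w k)
    have h2 : ∀ m k, Continuous fun x : (Fin N → ι → ℝ) × Matrix.orthogonalGroup (Fin N) ℝ =>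
        x.1 m k * ∑ j, x.2.1 m j * w k j := fun m k =>
      ((continuous_apply_apply m k).comp continuous_fst).mul ((this m k).comp continuous_snd)
    exact Complex.continuous_exp.comp ((Complex.continuous_ofReal.comp
      (continuous_finsetSum _ fun m _ => continuous_finsetSum _ fun k _ => h2 m k)).mul
        continuous_const)
  have hFint : Integrable (Function.uncurry F) ((gaussArray ι N).prod (haarOrthogonal N)) := by
    refine Integrable.of_bound hF.aestronglyMeasurable 1 (.of_forall fun x => ?_)
    exact (Complex.norm_exp_ofReal_mul_I _).le
  -- After exchanging the integrals, the Gaussian array is tested against the vectors `Q w k`, which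
  -- are as long as `w k`. The result does not depend on `Q` and is exactly the Gaussian
  -- characteristic function.
  have h1 : ∫ g, ∫ Q, F g Q ∂(haarOrthogonal N) ∂(gaussArray ι N)
      = Complex.exp (-((∑ k, ∑ j, w k j ^ 2 : ℝ) / 2)) := by
    rw [integral_integral_swap hFint]
    have : ∀ Q, ∫ g, F g Q ∂(gaussArray ι N)
        = Complex.exp (-((∑ k, ∑ j, w k j ^ 2 : ℝ) / 2)) := by
      intro Q
      refine (integral_gaussArray_char fun m k => ∑ j, Q.1 m j * w k j).trans ?_
      rw [Finset.sum_comm]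
      simp_rw [Matrix.orthogonalGroup.sum_sq_mulVec]
    simp [this]
  set c := ∫ Q, Complex.exp ((√N * ∑ k, ∑ j, Q.1 (e k) j * w k j : ℝ) * Complex.I)
    ∂(haarOrthogonal N)
  have h2 : ∫ g, ((∫ Q, F g Q ∂(haarOrthogonal N)) - c) ∂(gaussArray ι N)
      = Complex.exp (-((∑ k, ∑ j, w k j ^ 2 : ℝ) / 2)) - c := by
    refine (integral_sub hFint.integral_prod_left (integrable_const _)).trans ?_
    simp only [Function.uncurry_apply_pair, h1]
    simp
  rw [norm_sub_rev, ← h2]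
  have hInt : ∀ k l, Integrable (fun g : Fin N → ι → ℝ => |covDev g k l|) (gaussArray ι N) :=
    fun k l => ((memLp_covDev k l).integrable one_le_two).abs
  have hint2 : Integrable (fun g : Fin N → ι → ℝ => ∑ k, ∑ l, |covDev g k l|) (gaussArray ι N) :=
    integrable_finsetSum _ fun k _ => integrable_finsetSum _ fun l _ => hInt k l
  refine (norm_integral_le_of_norm_le (hint2.mul_const (Fintype.card ι * W))
    (.of_forall fun g => norm_integral_haarOrthogonal_sub_le hN e g w)).trans ?_
  rw [integral_mul_const, integral_finsetSum _ fun k _ => integrable_finsetSum _ fun l _ => hInt k l]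
  have hW : 0 ≤ W := by positivity
  have : haarConst ι / √N * W = (∑ k : ι, ∑ l : ι, √(Var[fun c : ι → ℝ => c k * c l;
      Measure.pi fun _ : ι => gaussianReal 0 1]) / √N) * (Fintype.card ι * W) := by
    simp_rw [← Finset.sum_div]
    unfold haarConst
    ring
  rw [this]
  gcongr with k
  rw [integral_finsetSum _ fun l _ => hInt k l]
  gcongr with l
  exact integral_abs_covDev_le hN k l

/-! ### Rectangular orthogonal weights -/

theorem sum_mul_extend {α β : Type*} [Fintype α] [Fintype β] {e : α → β}
    (he : Function.Injective e) (a : β → ℝ) (v : α → ℝ) :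
    ∑ m, a m * Function.extend e v 0 m = ∑ j, a (e j) * v j := by
  refine (Fintype.sum_of_injective e he _ _ (fun m hm => ?_) fun j => ?_).symm
  · rw [Function.extend_apply' _ _ _ (by simpa using hm)]
    simp
  · rw [he.extend_apply]

theorem sum_extend_sq {α β : Type*} [Fintype α] [Fintype β] {e : α → β}
    (he : Function.Injective e) (v : α → ℝ) :
    ∑ m, Function.extend e v 0 m ^ 2 = ∑ j, v j ^ 2 := by
  simp_rw [sq]
  rw [sum_mul_extend he]
  simp [he.extend_apply]

/-- Testing the block against `v` is testing the square matrix against `v` padded with zeros, so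
wide and tall blocks are treated alike. -/
theorem orthWeight_char_sub_le {ι : Type*} [Fintype ι] {p q : ℕ} (hN : 0 < max p q)
    (e : ι ↪ Fin p) (v : ι → Fin q → ℝ) :
    ‖∫ ω, Complex.exp ((∑ k, ∑ j, ω (e k) j * v k j : ℝ) * Complex.I) ∂(orthWeight p q)
      - Complex.exp (-((∑ k, ∑ j, v k j ^ 2 : ℝ) / 2))‖
      ≤ haarConst ι / √((max p q : ℕ) : ℝ) * ∑ k, √(∑ j, v k j ^ 2) := by
  have hinj := Fin.castLE_injective (le_max_right p q)
  have h := norm_haarOrthogonal_char_sub_le hN (e.trans (Fin.castLEEmb (le_max_left p q)))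
    (fun k => Function.extend (Fin.castLE (le_max_right p q)) (v k) 0)
  simp_rw [sum_extend_sq hinj, sum_mul_extend hinj] at h
  rw [orthWeight, integral_map (measurable_orthBlock p q).aemeasurable
    (Measurable.aestronglyMeasurable (by fun_prop))]
  convert h using 6
  simp only [orthBlock, Finset.mul_sum, mul_assoc]
  rfl

theorem integral_orthWeight_row_sq {p q : ℕ} (i : Fin p) (v : Fin q → ℝ) :
    ∫ ω, (∑ j, ω i j * v j) ^ 2 ∂(orthWeight p q) = ∑ j, v j ^ 2 := by
  have hinj := Fin.castLE_injective (le_max_right p q)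
  have h := integral_haarOrthogonal_row_sq (Fin.castLE (le_max_left p q) i)
    (Function.extend (Fin.castLE (le_max_right p q)) v 0)
  simp_rw [sum_extend_sq hinj, sum_mul_extend hinj] at h
  rw [orthWeight, integral_map (measurable_orthBlock p q).aemeasurable
    (Measurable.aestronglyMeasurable (by fun_prop)), ← h,
    ← integral_const_mul]
  refine integral_congr_ae (.of_forall fun Q => ?_)
  simp only [orthBlock, mul_assoc, ← Finset.mul_sum]
  rw [mul_pow, Real.sq_sqrt (Nat.cast_nonneg _)]

theorem integral_orthWeight_row {p q : ℕ} (i : Fin p) (v : Fin q → ℝ) :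
    ∫ ω, (∑ j, ω i j * v j) ∂(orthWeight p q) = 0 := by
  have hinj := Fin.castLE_injective (le_max_right p q)
  have h := integral_haarOrthogonal_row (Fin.castLE (le_max_left p q) i)
    (Function.extend (Fin.castLE (le_max_right p q)) v 0)
  simp_rw [sum_mul_extend hinj] at h
  rw [orthWeight, integral_map (measurable_orthBlock p q).aemeasurable
    (Measurable.aestronglyMeasurable (by fun_prop))]
  simp only [orthBlock, mul_assoc, ← Finset.mul_sum]
  rw [integral_const_mul, h, mul_zero]

theorem memLp_orthWeight_row {p q : ℕ} (i : Fin p) (v : Fin q → ℝ) :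
    MemLp (fun ω : Fin p → Fin q → ℝ => ∑ j, ω i j * v j) 2 (orthWeight p q) := by
  rw [orthWeight, memLp_map_measure_iff (Measurable.aestronglyMeasurable (by fun_prop))
    (measurable_orthBlock p q).aemeasurable]
  refine Continuous.memLp_of_hasCompactSupport ?_ (HasCompactSupport.of_compactSpace _)
  refine continuous_finsetSum _ fun j _ => Continuous.mul ?_ continuous_const
  exact continuous_const.mul (continuous_orthogonal_entry _ _)

/-- Left multiplication of a rectangular array by a square matrix. -/
def leftMul {p : ℕ} {κ : Type*} (R : Matrix.orthogonalGroup (Fin p) ℝ) (ω : Fin p → κ → ℝ) :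
    Fin p → κ → ℝ :=
  fun i j => ∑ k, R.1 i k * ω k j

theorem measurable_leftMul {p : ℕ} {κ : Type*} (R : Matrix.orthogonalGroup (Fin p) ℝ) :
    Measurable (leftMul (κ := κ) R) := by
  unfold leftMul; fun_prop

theorem sum_row_mul_row {p : ℕ} (R : Matrix.orthogonalGroup (Fin p) ℝ) (i j : Fin p) :
    ∑ k, R.1 i k * R.1 j k = if i = j then 1 else 0 := by
  have h := (Matrix.mem_orthogonalGroup_iff (Fin p) ℝ).mp R.2
  have h2 := congrFun (congrFun h i) j
  rw [Matrix.mul_apply, Matrix.one_apply] at h2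
  exact h2

/-- The padded rows of `R` are orthonormal, like the first `p` basis vectors. The remaining rows of
`O` are left free, since a block only reads the first `p` rows. -/
theorem exists_orthogonal_extension {p N : ℕ} (h : p ≤ N) (R : Matrix.orthogonalGroup (Fin p) ℝ) :
    ∃ O : Matrix.orthogonalGroup (Fin N) ℝ, ∀ i m,
      O.1 (Fin.castLE h i) m = Function.extend (Fin.castLE h) (R.1 i) 0 m := by
  have hinj := Fin.castLE_injective h
  obtain ⟨O, hO⟩ := exists_orthogonal_of_gram_eq
    (fun i => Function.extend (Fin.castLE h) (R.1 i) 0)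
    (fun i m => if Fin.castLE h i = m then (1 : ℝ) else 0) (by
      intro i j
      rw [sum_mul_extend hinj]
      simp only [hinj.extend_apply]
      rw [sum_row_mul_row]
      simp [hinj.eq_iff, eq_comm])
  refine ⟨O, fun i m => ?_⟩
  rw [hO i m]
  simp

/-- Multiplying the block by `R` amounts to multiplying `Q` by an orthogonal extension of `R`, which
preserves Haar measure. -/
theorem measurePreserving_leftMul_orthWeight {p q : ℕ} (R : Matrix.orthogonalGroup (Fin p) ℝ) :
    MeasurePreserving (leftMul R) (orthWeight p q) (orthWeight p q) := by
  refine ⟨measurable_leftMul R, ?_⟩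
  obtain ⟨O, hO⟩ := exists_orthogonal_extension (le_max_left p q) R
  have h : leftMul R ∘ orthBlock p q = orthBlock p q ∘ fun Q => O * Q := by
    ext Q i j
    simp only [Function.comp_apply, leftMul, orthBlock, Matrix.UnitaryGroup.mul_val,
      Matrix.mul_apply]
    rw [Finset.mul_sum]
    simp_rw [hO]
    have := sum_mul_extend (Fin.castLE_injective (le_max_left p q))
      (fun m => √((max p q : ℕ) : ℝ) * Q.1 m (Fin.castLE (le_max_right p q) j)) (R.1 i)
    simp only [mul_comm (R.1 i _), ← this]
    exact Finset.sum_congr rfl fun m _ => by ring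
  rw [orthWeight, Measure.map_map (measurable_leftMul R) (measurable_orthBlock p q), h,
    ← Measure.map_map (measurable_orthBlock p q) (measurable_const_mul O),
    map_mul_left_eq_self]

theorem measurePreserving_mulVec_biasLaw {p : ℕ} (R : Matrix.orthogonalGroup (Fin p) ℝ) :
    MeasurePreserving (fun (β : Fin p → ℝ) i => ∑ k, R.1 i k * β k) (biasLaw p) (biasLaw p) := by
  have hm : Measurable fun (β : Fin p → ℝ) i => ∑ k, R.1 i k * β k := by fun_prop
  refine ⟨hm, ?_⟩
  have : IsProbabilityMeasure ((biasLaw p).map fun (β : Fin p → ℝ) i => ∑ k, R.1 i k * β k) :=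
    Measure.isProbabilityMeasure_map hm.aemeasurable
  refine charFun_eq_pi_iff.mp fun t => ?_
  rw [charFun_apply, integral_map (by fun_prop) (by fun_prop), integral_map hm.aemeasurable
    (by fun_prop)]
  have h1 : ∀ β : Fin p → ℝ, inner ℝ (WithLp.toLp 2 fun i => ∑ k, R.1 i k * β k) t
      = ∑ k, β k * ∑ i, (star R).1 k i * t i := by
    intro β
    simp only [PiLp.inner_apply, RCLike.inner_apply, conj_trivial, Finset.mul_sum]
    rw [Finset.sum_comm]
    refine Finset.sum_congr rfl fun k _ => Finset.sum_congr rfl fun i _ => ?_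
    have : (star R).1 k i = R.1 i k := rfl
    rw [this]
    ring
  simp_rw [h1]
  rw [biasLaw, integral_pi_gaussian_char, Matrix.orthogonalGroup.sum_sq_mulVec]
  simp_rw [charFun_gaussianReal, ← Complex.exp_sum]
  congr 1
  push_cast
  rw [Finset.sum_div, ← Finset.sum_neg_distrib]
  refine Finset.sum_congr rfl fun k _ => ?_
  simp

/-! ### Independent families of weights and a bias -/

/-- The joint law of independent orthogonal weights, indexed by `B`, and a bias. -/
def layerWeights (B : Type*) [Fintype B] (p q : ℕ) :
    Measure ((B → Fin p → Fin q → ℝ) × (Fin p → ℝ)) :=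
  (Measure.pi fun _ : B => orthWeight p q).prod (biasLaw p)

instance (B : Type*) [Fintype B] (p q : ℕ) : IsProbabilityMeasure (layerWeights B p q) := by
  unfold layerWeights; infer_instance

theorem measurePreserving_layerWeights {B : Type*} [Fintype B] {p q : ℕ}
    (R : Matrix.orthogonalGroup (Fin p) ℝ) :
    MeasurePreserving (fun θ : (B → Fin p → Fin q → ℝ) × (Fin p → ℝ) =>
      ((fun b => leftMul R (θ.1 b)), fun i => ∑ k, R.1 i k * θ.2 k))
      (layerWeights B p q) (layerWeights B p q) :=
  (measurePreserving_pi _ _ fun _ => measurePreserving_leftMul_orthWeight R).prod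
    (measurePreserving_mulVec_biasLaw R)

theorem norm_prod_sub_prod_le_sum {B : Type*} (s : Finset B) (a b : B → ℂ) (ha : ∀ i, ‖a i‖ ≤ 1)
    (hb : ∀ i, ‖b i‖ ≤ 1) : ‖∏ i ∈ s, a i - ∏ i ∈ s, b i‖ ≤ ∑ i ∈ s, ‖a i - b i‖ := by
  classical
  induction s using Finset.induction_on with
  | empty => simp
  | insert i s hi ih =>
    rw [Finset.prod_insert hi, Finset.prod_insert hi, Finset.sum_insert hi]
    have h1 : ‖∏ i ∈ s, b i‖ ≤ 1 := by
      rw [norm_prod]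
      exact Finset.prod_le_one (fun _ _ => norm_nonneg _) fun i _ => hb i
    calc _ = ‖a i * (∏ i ∈ s, a i - ∏ i ∈ s, b i) + (a i - b i) * ∏ i ∈ s, b i‖ := by
          congr 1; ring
      _ ≤ ‖a i‖ * ‖∏ i ∈ s, a i - ∏ i ∈ s, b i‖ + ‖a i - b i‖ * ‖∏ i ∈ s, b i‖ := by
          refine (norm_add_le _ _).trans ?_
          rw [norm_mul, norm_mul]
      _ ≤ 1 * ‖∏ i ∈ s, a i - ∏ i ∈ s, b i‖ + ‖a i - b i‖ * 1 := by
          gcongr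
          exact ha i
      _ ≤ _ := by linarith

/-- By independence the characteristic function is a product. The bias factor is exactly Gaussian
and of modulus at most one, so only the weight matrices contribute errors, and these add up by
telescoping. -/
theorem layerWeights_char_sub_le {B ι : Type*} [Fintype B] [Fintype ι] {p q : ℕ}
    (hN : 0 < max p q) (e : ι ↪ Fin p) (v : B → ι → Fin q → ℝ) (s : ι → ℝ) :
    ‖∫ θ, Complex.exp (((∑ b, ∑ k, ∑ j, θ.1 b (e k) j * v b k j) + ∑ k, θ.2 (e k) * s k : ℝ)
        * Complex.I) ∂(layerWeights B p q)
      - Complex.exp (-(((∑ b, ∑ k, ∑ j, v b k j ^ 2) + ∑ k, s k ^ 2 : ℝ) / 2))‖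
      ≤ haarConst ι / √((max p q : ℕ) : ℝ) * ∑ b, ∑ k, √(∑ j, v b k j ^ 2) := by
  have h1 : ∀ θ : (B → Fin p → Fin q → ℝ) × (Fin p → ℝ),
      Complex.exp (((∑ b, ∑ k, ∑ j, θ.1 b (e k) j * v b k j) + ∑ k, θ.2 (e k) * s k : ℝ)
        * Complex.I)
      = (∏ b, Complex.exp ((∑ k, ∑ j, θ.1 b (e k) j * v b k j : ℝ) * Complex.I))
        * Complex.exp ((∑ i, θ.2 i * Function.extend e s 0 i : ℝ) * Complex.I) := by
    intro θ
    rw [← Complex.exp_sum, ← Complex.exp_add, sum_mul_extend e.injective]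
    congr 1
    push_cast
    rw [add_mul, Finset.sum_mul]
  simp_rw [h1]
  rw [layerWeights, integral_prod_mul
    (fun ω : B → Fin p → Fin q → ℝ =>
      ∏ b, Complex.exp ((∑ k, ∑ j, ω b (e k) j * v b k j : ℝ) * Complex.I))
    (fun β : Fin p → ℝ => Complex.exp ((∑ i, β i * Function.extend e s 0 i : ℝ) * Complex.I)),
    integral_fintype_prod_eq_prod (𝕜 := ℂ) (fun b (ω : Fin p → Fin q → ℝ) =>
      Complex.exp ((∑ k, ∑ j, ω (e k) j * v b k j : ℝ) * Complex.I)), biasLaw,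
    integral_pi_gaussian_char, sum_extend_sq e.injective]
  have h2 : Complex.exp (-(((∑ b, ∑ k, ∑ j, v b k j ^ 2) + ∑ k, s k ^ 2 : ℝ) / 2))
      = (∏ b, Complex.exp (-((∑ k, ∑ j, v b k j ^ 2 : ℝ) / 2)))
        * Complex.exp (-((∑ k, s k ^ 2 : ℝ) / 2)) := by
    rw [← Complex.exp_sum, ← Complex.exp_add]
    congr 1
    push_cast
    rw [Finset.sum_neg_distrib, add_div, neg_add, Finset.sum_div]
  have hle : ∀ x : ℝ, 0 ≤ x → ‖Complex.exp (-((x : ℂ) / 2))‖ ≤ 1 := by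
    intro x hx
    rw [Complex.norm_exp]
    simp
    positivity
  rw [h2, ← sub_mul, norm_mul]
  refine (mul_le_of_le_one_right (norm_nonneg _) (hle _ (by positivity))).trans ?_
  refine (norm_prod_sub_prod_le_sum _ _ _ (fun b => ?_) (fun b => hle _ (by positivity))).trans ?_
  · refine (norm_integral_le_integral_norm _).trans ?_
    simp only [Complex.norm_exp_ofReal_mul_I]
    simp
  · rw [Finset.mul_sum]
    exact Finset.sum_le_sum fun b _ => orthWeight_char_sub_le hN e (v b)

theorem memLp_layerWeights_row {B : Type*} [Fintype B] {p q : ℕ} (i : Fin p) (v : B → Fin q → ℝ)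
    (s : ℝ) :
    MemLp (fun θ : (B → Fin p → Fin q → ℝ) × (Fin p → ℝ) =>
      (∑ b, ∑ j, θ.1 b i j * v b j) + s * θ.2 i) 2 (layerWeights B p q) := by
  have h1 : MemLp (fun ω : B → Fin p → Fin q → ℝ => ∑ b, ∑ j, ω b i j * v b j) 2
      (Measure.pi fun _ : B => orthWeight p q) :=
    memLp_finsetSum _ fun b _ => (memLp_orthWeight_row i (v b)).comp_measurePreserving
      (measurePreserving_eval (fun _ : B => orthWeight p q) b)
  have h2 : MemLp (fun β : Fin p → ℝ => s * β i) 2 (biasLaw p) :=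
    ((memLp_id_gaussianReal (μ := 0) (v := 1) 2).comp_measurePreserving
      (measurePreserving_eval (fun _ : Fin p => gaussianReal 0 1) i)).const_mul s
  exact (h1.comp_measurePreserving measurePreserving_fst).add
    (h2.comp_measurePreserving measurePreserving_snd)

/-- Independence and centering remove all cross terms. The formula is exact at every finite width.
-/
theorem integral_layerWeights_row_sq {B : Type*} [Fintype B] {p q : ℕ} (i : Fin p)
    (v : B → Fin q → ℝ) (s : ℝ) :
    ∫ θ, ((∑ b, ∑ j, θ.1 b i j * v b j) + s * θ.2 i) ^ 2 ∂(layerWeights B p q)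
      = (∑ b, ∑ j, v b j ^ 2) + s ^ 2 := by
  let X : (B → Fin p → Fin q → ℝ) → ℝ := fun ω => ∑ b, ∑ j, ω b i j * v b j
  have hXb : ∀ b, MemLp (fun ω : B → Fin p → Fin q → ℝ => ∑ j, ω b i j * v b j) 2
      (Measure.pi fun _ : B => orthWeight p q) := fun b =>
    (memLp_orthWeight_row i (v b)).comp_measurePreserving
      (measurePreserving_eval (fun _ : B => orthWeight p q) b)
  have hX : MemLp X 2 (Measure.pi fun _ : B => orthWeight p q) :=
    memLp_finsetSum _ fun b _ => hXb b
  have hX0 : ∫ ω, X ω ∂(Measure.pi fun _ : B => orthWeight p q) = 0 := by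
    rw [integral_finsetSum _ fun b _ => (hXb b).integrable one_le_two]
    refine Finset.sum_eq_zero fun b _ => ?_
    rw [integral_comp_eval (μ := fun _ : B => orthWeight p q) (i := b)
      (f := fun ω : Fin p → Fin q → ℝ => ∑ j, ω i j * v b j) (memLp_orthWeight_row i (v b)).1,
      integral_orthWeight_row]
  have hX2 : ∫ ω, X ω ^ 2 ∂(Measure.pi fun _ : B => orthWeight p q) = ∑ b, ∑ j, v b j ^ 2 := by
    rw [← variance_of_integral_eq_zero hX.1.aemeasurable hX0]
    have h := variance_sum_pi (μ := fun _ : B => orthWeight p q)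
      (X := fun b ω => ∑ j, ω i j * v b j) (fun b => memLp_orthWeight_row i (v b))
    have h2 : X = ∑ b, fun ω : B → Fin p → Fin q → ℝ => ∑ j, ω b i j * v b j := by
      ext ω; simp [X]
    rw [h2, h]
    refine Finset.sum_congr rfl fun b _ => ?_
    rw [variance_of_integral_eq_zero (memLp_orthWeight_row i (v b)).1.aemeasurable
      (integral_orthWeight_row i (v b)), integral_orthWeight_row_sq]
  have hY : MemLp (fun β : Fin p → ℝ => β i) 2 (biasLaw p) :=
    (memLp_id_gaussianReal (μ := 0) (v := 1) 2).comp_measurePreserving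
      (measurePreserving_eval (fun _ : Fin p => gaussianReal 0 1) i)
  have hY2 : ∫ β, β i * β i ∂(biasLaw p) = 1 := by
    rw [biasLaw, integral_pi_gaussian_mul, Matrix.one_apply_eq]
  have e : ∀ θ : (B → Fin p → Fin q → ℝ) × (Fin p → ℝ),
      ((∑ b, ∑ j, θ.1 b i j * v b j) + s * θ.2 i) ^ 2
        = X θ.1 ^ 2 + (2 * s) * (X θ.1 * θ.2 i) + s ^ 2 * (θ.2 i * θ.2 i) := by
    intro θ
    simp only [X]
    ring
  simp_rw [e]
  have i1 : Integrable (fun θ : (B → Fin p → Fin q → ℝ) × (Fin p → ℝ) => X θ.1 ^ 2)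
      (layerWeights B p q) := hX.integrable_sq.comp_fst _
  have i2 : Integrable (fun θ : (B → Fin p → Fin q → ℝ) × (Fin p → ℝ) => (2 * s) * (X θ.1 * θ.2 i))
      (layerWeights B p q) :=
    ((hX.integrable one_le_two).mul_prod (hY.integrable one_le_two)).const_mul _
  have i3 : Integrable (fun θ : (B → Fin p → Fin q → ℝ) × (Fin p → ℝ) => s ^ 2 * (θ.2 i * θ.2 i))
      (layerWeights B p q) := by
    have := hY.integrable_sq.comp_snd (Measure.pi fun _ : B => orthWeight p q)
    simp_rw [sq] at this
    exact this.const_mul _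
  rw [integral_add (f := fun θ => X θ.1 ^ 2 + (2 * s) * (X θ.1 * θ.2 i)) (i1.add i2) i3,
    integral_add i1 i2, integral_const_mul, integral_const_mul]
  unfold layerWeights
  rw [integral_prod_mul X (fun β : Fin p → ℝ => β i), hX0,
    integral_fun_fst (fun ω => X ω ^ 2), integral_fun_snd (fun β : Fin p → ℝ => β i * β i),
    hX2, hY2]
  simp

/-! ### Convergence in distribution from characteristic functions -/

/-- Lévy's continuity theorem is applied in the `ℓ²` product, an inner product space in which the
characteristic function of a product measure factors; the continuous identity map then returns to
the plain product. -/
theorem tendstoInDistribution_pi_of_char {ι : Type*} [Fintype ι] {E : Type*} [NormedAddCommGroup E]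
    [InnerProductSpace ℝ E] [FiniteDimensional ℝ E] [MeasurableSpace E] [BorelSpace E]
    {Ω : ℕ → Type*} [∀ ν, MeasurableSpace (Ω ν)] (P : ∀ ν, Measure (Ω ν))
    [∀ ν, IsProbabilityMeasure (P ν)] (X : ∀ ν, Ω ν → ι → E) (hX : ∀ ν, Measurable (X ν))
    (μ : ι → Measure E) [∀ i, IsProbabilityMeasure (μ i)]
    (h : ∀ t : ι → E, Tendsto
      (fun ν => ∫ ω, Complex.exp ((∑ i, inner ℝ (X ν ω i) (t i) : ℝ) * Complex.I) ∂(P ν))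
      atTop (𝓝 (∏ i, charFun (μ i) (t i)))) :
    TendstoInDistribution X atTop id P (Measure.pi μ) := by
  have key : TendstoInDistribution (fun ν ω => (WithLp.toLp 2 (X ν ω) : PiLp 2 fun _ : ι => E))
      atTop (WithLp.toLp 2) P (Measure.pi μ) := by
    have hm : ∀ ν, Measurable fun ω => (WithLp.toLp 2 (X ν ω) : PiLp 2 fun _ : ι => E) :=
      fun ν => (WithLp.measurable_toLp 2 _).comp (hX ν)
    refine ⟨fun ν => (hm ν).aemeasurable, (WithLp.measurable_toLp 2 _).aemeasurable, ?_⟩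
    refine ProbabilityMeasure.tendsto_iff_tendsto_charFun.mpr fun t => ?_
    simp only [ProbabilityMeasure.coe_mk]
    rw [charFun_pi]
    refine (h t.ofLp).congr fun ν => ?_
    rw [charFun_apply, integral_map (hm ν).aemeasurable (by fun_prop)]
    simp [PiLp.inner_apply]
  exact key.continuous_comp (PiLp.continuous_ofLp 2 _)

/-! ### Layers -/

/-- The empirical second moment of the channels of `y` at the points `u` and `v`. -/
def gram {T : Type*} {q : ℕ} (y : Fin q → T → ℝ) (u v : T) : ℝ :=
  (q : ℝ)⁻¹ * ∑ j, y j u * y j v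

/-- A layer `y ↦ (c / √q) ∑_b ω_b y(τ_b ·) + σ β`. -/
def genLayer {B T T' : Type*} [Fintype B] (c σ : ℝ) (τ : B → T → T') {p q : ℕ}
    (θ : (B → Fin p → Fin q → ℝ) × (Fin p → ℝ)) (y : Fin q → T' → ℝ) : Fin p → T → ℝ :=
  fun i u => c / √(q : ℝ) * ∑ j, ∑ b, θ.1 b i j * y j (τ b u) + σ * θ.2 i

theorem measurable_genLayer {B T T' : Type*} [Fintype B] (c σ : ℝ) (τ : B → T → T') {p q : ℕ} :
    Measurable fun z : (Fin q → T' → ℝ) × ((B → Fin p → Fin q → ℝ) × (Fin p → ℝ)) =>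
      genLayer c σ τ z.2 z.1 := by
  unfold genLayer
  fun_prop

/-- The law of the output of a layer whose input has law `Λ` and is independent of the weights. -/
def layerLaw {B T T' : Type*} [Fintype B] (c σ : ℝ) (τ : B → T → T') (p : ℕ) {q : ℕ}
    (Λ : Measure (Fin q → T' → ℝ)) : Measure (Fin p → T → ℝ) :=
  (Λ.prod (layerWeights B p q)).map fun z => genLayer c σ τ z.2 z.1

instance {B T T' : Type*} [Fintype B] (c σ : ℝ) (τ : B → T → T') (p : ℕ) {q : ℕ}
    (Λ : Measure (Fin q → T' → ℝ)) [IsProbabilityMeasure Λ] :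
    IsProbabilityMeasure (layerLaw c σ τ p Λ) :=
  Measure.isProbabilityMeasure_map (measurable_genLayer c σ τ).aemeasurable

/-- The empirical second moments of random layers of width `q ν` and law `Λ ν` converge to `κ`. -/
structure AsymptoticGram {T : Type*} (q : ℕ → ℕ) (Λ : ∀ ν, Measure (Fin (q ν) → T → ℝ))
    (κ : T → T → ℝ) : Prop where
  integrable_sq : ∀ ν j u, Integrable (fun y => y j u ^ 2) (Λ ν)
  tendsto_gram : ∀ u v, Tendsto (fun ν => ∫ y, |gram y u v - κ u v| ∂(Λ ν)) atTop (𝓝 0)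
  -- For a merely measurable activation, smallness at `u` says nothing about the next layer; exact
  -- vanishing of all channels, with probability tending to one, does propagate.
  tendsto_support : ∀ u, κ u u = 0 →
    Tendsto (fun ν => (Λ ν).real {y | ∃ j, y j u ≠ 0}) atTop (𝓝 0)

/-- Random layers of width `p ν` and orthogonally invariant law `M ν` converge to i.i.d. Gaussian
processes of covariance `K`, together with their second moments. -/
structure AsymptoticGaussian {T : Type*} (p : ℕ → ℕ) (M : ∀ ν, Measure (Fin (p ν) → T → ℝ))
    [∀ ν, IsProbabilityMeasure (M ν)] (K : T → T → ℝ) : Prop where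
  tendsto_iid : TendstoIIDGaussianProcesses M p (fun _ h i u => h i u) K
  integrable_sq : ∀ ν i u, Integrable (fun h => h i u ^ 2) (M ν)
  -- This does not follow from weak convergence; it provides uniform integrability of the squares.
  tendsto_sq : ∀ u, ∃ s : ℕ → ℝ, Tendsto s atTop (𝓝 (K u u)) ∧ ∀ ν i, ∫ h, h i u ^ 2 ∂(M ν) = s ν
  -- Permutation matrices make the channels exchangeable; rotations of two channels smooth the law
  -- of a single one.
  map_leftMul : ∀ ν R, (M ν).map (leftMul R) = M ν
  tendsto_support : ∀ u, K u u = 0 →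
    Tendsto (fun ν => (M ν).real {h | ∃ i, h i u ≠ 0}) atTop (𝓝 0)

theorem integrable_gram_of_sq {T : Type*} {q : ℕ} {Λ : Measure (Fin q → T → ℝ)}
    (h : ∀ j u, Integrable (fun y => y j u ^ 2) Λ) (u v : T) :
    Integrable (fun y => gram y u v) Λ := by
  have hL : ∀ j w, MemLp (fun y : Fin q → T → ℝ => y j w) 2 Λ := fun j w =>
    (memLp_two_iff_integrable_sq (Measurable.aestronglyMeasurable (by fun_prop))).mpr (h j w)
  exact (integrable_finsetSum _ fun j _ => (hL j u).integrable_mul (hL j v)).const_mul _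

namespace AsymptoticGram

variable {T : Type*} {q : ℕ → ℕ} {Λ : ∀ ν, Measure (Fin (q ν) → T → ℝ)} {κ : T → T → ℝ}

theorem integrable_gram (hΛ : AsymptoticGram q Λ κ) (ν : ℕ) (u v : T) :
    Integrable (fun y => gram y u v) (Λ ν) :=
  integrable_gram_of_sq (hΛ.integrable_sq ν) u v

variable [∀ ν, IsProbabilityMeasure (Λ ν)]

theorem tendsto_linear (hΛ : AsymptoticGram q Λ κ) {S : Type*} (s : Finset S) (a : S → ℝ)
    (u v : S → T) :
    Tendsto (fun ν => ∫ y, |∑ i ∈ s, a i * gram y (u i) (v i) - ∑ i ∈ s, a i * κ (u i) (v i)| ∂(Λ ν))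
      atTop (𝓝 0) := by
  have hlim : Tendsto (fun ν => ∑ i ∈ s, |a i| * ∫ y, |gram y (u i) (v i) - κ (u i) (v i)| ∂(Λ ν))
      atTop (𝓝 0) := by
    have := tendsto_finsetSum s fun i _ => (hΛ.tendsto_gram (u i) (v i)).const_mul |a i|
    simpa using this
  refine squeeze_zero (fun ν => integral_nonneg fun _ => abs_nonneg _) (fun ν => ?_) hlim
  have hInt : ∀ i, Integrable (fun y => |a i| * |gram y (u i) (v i) - κ (u i) (v i)|) (Λ ν) :=
    fun i => (((hΛ.integrable_gram ν (u i) (v i)).sub (integrable_const _)).abs).const_mul _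
  simp_rw [← integral_const_mul]
  rw [← integral_finsetSum _ fun i _ => hInt i]
  refine integral_mono_of_nonneg (.of_forall fun _ => abs_nonneg _)
    (integrable_finsetSum _ fun i _ => hInt i) (.of_forall fun y => ?_)
  simp only
  rw [← Finset.sum_sub_distrib]
  refine (Finset.abs_sum_le_sum_abs _ _).trans (Finset.sum_le_sum fun i _ => ?_)
  rw [← mul_sub, abs_mul]

/-- If the limiting combination were negative, its distance from the nonnegative empirical one would
stay bounded below, against `L¹` convergence. Symmetry and positivity thus pass from Gram matrices
to `κ`. -/
theorem le_of_gram_linear (hΛ : AsymptoticGram q Λ κ) {S : Type*} (s : Finset S) (a : S → ℝ)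
    (u v : S → T) (h : ∀ ν (y : Fin (q ν) → T → ℝ), 0 ≤ ∑ i ∈ s, a i * gram y (u i) (v i)) :
    0 ≤ ∑ i ∈ s, a i * κ (u i) (v i) := by
  by_contra! hneg
  have hle : ∀ ν, -(∑ i ∈ s, a i * κ (u i) (v i)) ≤
      ∫ y, |∑ i ∈ s, a i * gram y (u i) (v i) - ∑ i ∈ s, a i * κ (u i) (v i)| ∂(Λ ν) := by
    intro ν
    have h1 : ∫ _y : Fin (q ν) → T → ℝ, -(∑ i ∈ s, a i * κ (u i) (v i)) ∂(Λ ν)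
        = -(∑ i ∈ s, a i * κ (u i) (v i)) := by simp
    rw [← h1]
    refine integral_mono (integrable_const _) ?_ fun y => ?_
    · exact ((integrable_finsetSum _ fun i _ => (hΛ.integrable_gram ν _ _).const_mul _).sub
        (integrable_const _)).abs
    · have := h ν y
      simp only
      rw [abs_of_nonneg (by linarith)]
      linarith
  have := ge_of_tendsto' (hΛ.tendsto_linear s a u v) hle
  linarith

theorem symm (hΛ : AsymptoticGram q Λ κ) (u v : T) : κ u v = κ v u := by
  have h : ∀ u v, κ u v ≤ κ v u := by
    intro u v
    have := hΛ.le_of_gram_linear (Finset.univ : Finset (Fin 2)) ![-1, 1] ![u, v] ![v, u] (by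
      intro ν y
      simp [Fin.sum_univ_two, gram, mul_comm])
    simp [Fin.sum_univ_two] at this
    linarith
  exact le_antisymm (h u v) (h v u)

theorem sum_mul_gram {q : ℕ} {S : Type*} (s : Finset S) (x : S → ℝ) (u : S → T)
    (y : Fin q → T → ℝ) :
    ∑ i ∈ s ×ˢ s, (x i.1 * x i.2) * gram y (u i.1) (u i.2)
      = (q : ℝ)⁻¹ * ∑ j, (∑ a ∈ s, x a * y j (u a)) ^ 2 := by
  have h : ∀ j, (∑ a ∈ s, x a * y j (u a)) ^ 2
      = ∑ i ∈ s ×ˢ s, (x i.1 * x i.2) * (y j (u i.1) * y j (u i.2)) := fun j => by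
    rw [sq, Finset.sum_mul_sum, Finset.sum_product]
    exact Finset.sum_congr rfl fun a _ => Finset.sum_congr rfl fun b _ => by ring
  simp_rw [h]
  rw [Finset.sum_comm, Finset.mul_sum]
  refine Finset.sum_congr rfl fun i _ => ?_
  rw [gram, ← Finset.mul_sum]
  ring

theorem nonneg (hΛ : AsymptoticGram q Λ κ) {S : Type*} (s : Finset S) (x : S → ℝ) (u : S → T) :
    0 ≤ ∑ i ∈ s ×ˢ s, (x i.1 * x i.2) * κ (u i.1) (u i.2) :=
  hΛ.le_of_gram_linear _ _ (fun i : S × S => u i.1) (fun i => u i.2) fun ν y => by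
    rw [sum_mul_gram]; positivity

theorem diag_nonneg (hΛ : AsymptoticGram q Λ κ) (u : T) : 0 ≤ κ u u := by
  simpa using hΛ.nonneg {()} (fun _ => 1) (fun _ => u)

end AsymptoticGram

theorem norm_exp_neg_half_sub_le {x y : ℝ} (hx : 0 ≤ x) (hy : 0 ≤ y) :
    ‖Complex.exp (-((x : ℂ) / 2)) - Complex.exp (-((y : ℂ) / 2))‖ ≤ 1 / 2 * |x - y| := by
  have key : ∀ a b : ℝ, 0 ≤ a → a ≤ b → |Real.exp (-a) - Real.exp (-b)| ≤ b - a := by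
    intro a b ha hab
    have h1 : Real.exp (-b) ≤ Real.exp (-a) := Real.exp_le_exp.mpr (by linarith)
    rw [abs_of_nonneg (by linarith)]
    have h2 : Real.exp (-b) = Real.exp (-a) * Real.exp (-(b - a)) := by
      rw [← Real.exp_add]; congr 1; ring
    have h3 := Real.one_sub_le_exp_neg (b - a)
    have h4 : Real.exp (-a) ≤ 1 := Real.exp_le_one_iff.mpr (by linarith)
    have h5 := Real.exp_pos (-a)
    rw [h2]
    nlinarith
  have h : Complex.exp (-((x : ℂ) / 2)) - Complex.exp (-((y : ℂ) / 2))
      = ((Real.exp (-(x / 2)) - Real.exp (-(y / 2)) : ℝ) : ℂ) := by push_cast; rfl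
  rw [h, Complex.norm_real, Real.norm_eq_abs]
  rcases le_total x y with hxy | hxy
  · refine (key _ _ (by linarith) (by linarith)).trans ?_
    rw [abs_of_nonpos (by linarith)]
    linarith
  · rw [abs_sub_comm]
    refine (key _ _ (by linarith) (by linarith)).trans ?_
    rw [abs_of_nonneg (by linarith)]
    linarith

theorem measurableSet_exists_ne_zero {r : ℕ} {S : Type*} (w : S) :
    MeasurableSet {h : Fin r → S → ℝ | ∃ i, h i w ≠ 0} := by
  rw [Set.ofPred_exists]
  exact MeasurableSet.iUnion fun i => (measurableSet_eq_fun (by fun_prop) measurable_const).compl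

/-! ### From convergent Gram matrices to Gaussian pre-activations -/

section Layer

variable {B T T' : Type*} [Fintype B] {τ : B → T → T'} {c σ : ℝ}

/-- The quadratic form of the kernel `κ` at the points `X`. -/
def quadForm {T : Type*} {D : ℕ} (κ : T → T → ℝ) (X : Fin D → T) (x : Fin D → ℝ) : ℝ :=
  ∑ i ∈ (Finset.univ : Finset (Fin D)) ×ˢ (Finset.univ : Finset (Fin D)),
    (x i.1 * x i.2) * κ (X i.1) (X i.2)

theorem quadForm_gram {q D : ℕ} (y : Fin q → T → ℝ) (X : Fin D → T) (x : Fin D → ℝ) :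
    quadForm (gram y) X x = (q : ℝ)⁻¹ * ∑ j, (∑ a, x a * y j (X a)) ^ 2 :=
  AsymptoticGram.sum_mul_gram _ _ _ _

theorem sum_scaled_sq {q D : ℕ} (y : Fin q → T → ℝ) (X : Fin D → T) (x : Fin D → ℝ) :
    ∑ j, (c / √(q : ℝ) * ∑ a, x a * y j (X a)) ^ 2 = c ^ 2 * quadForm (gram y) X x := by
  rw [quadForm_gram]
  simp_rw [mul_pow, ← Finset.mul_sum, div_pow, Real.sq_sqrt (Nat.cast_nonneg q)]
  ring

theorem integral_layerLaw {F : Type*} [NormedAddCommGroup F] [NormedSpace ℝ F] {p q : ℕ}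
    {Λ : Measure (Fin q → T' → ℝ)} [IsProbabilityMeasure Λ] (f : (Fin p → T → ℝ) → F)
    (hf : AEStronglyMeasurable f (layerLaw c σ τ p Λ))
    (hInt : Integrable (fun z : (Fin q → T' → ℝ) × ((B → Fin p → Fin q → ℝ) × (Fin p → ℝ)) =>
      f (genLayer c σ τ z.2 z.1)) (Λ.prod (layerWeights B p q))) :
    ∫ h, f h ∂(layerLaw c σ τ p Λ)
      = ∫ y, ∫ θ, f (genLayer c σ τ θ y) ∂(layerWeights B p q) ∂Λ := by
  rw [layerLaw, integral_map (measurable_genLayer c σ τ).aemeasurable hf, integral_prod _ hInt]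

/-- Given the input `y`, the phase is a linear form in weights and bias, so the Haar comparison
applies with vectors of squared length `c² V`, where `V` is a quadratic form of `gram y`. Replacing
`V` by its limit in the Gaussian exponential costs half the difference. The bound `√x ≤ 1 + x` makes
the Haar error affine in `|V - V₀|` as well, so that `L¹` convergence of the Gram entries suffices.
-/
theorem layerLaw_char_sub_le {ι : Type*} [Fintype ι] {p q D : ℕ} (hN : 0 < max p q)
    (e : ι ↪ Fin p) {Λ : Measure (Fin q → T' → ℝ)} [IsProbabilityMeasure Λ]
    (hInt : ∀ j u, Integrable (fun y => y j u ^ 2) Λ) (κ : T' → T' → ℝ) (X : Fin D → T)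
    (t : ι → Fin D → ℝ) (hκ : ∀ b k, 0 ≤ quadForm κ (fun a => τ b (X a)) (t k)) :
    ‖∫ h, Complex.exp ((∑ k, ∑ a, t k a * h (e k) (X a) : ℝ) * Complex.I) ∂(layerLaw c σ τ p Λ)
      - Complex.exp (-(((∑ b, ∑ k, c ^ 2 * quadForm κ (fun a => τ b (X a)) (t k))
          + ∑ k, (σ * ∑ a, t k a) ^ 2 : ℝ) / 2))‖
      ≤ ∑ b, ∑ k, (haarConst ι / √((max p q : ℕ) : ℝ)
          * (1 + c ^ 2 * quadForm κ (fun a => τ b (X a)) (t k))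
        + (haarConst ι / √((max p q : ℕ) : ℝ) + 1 / 2) * c ^ 2
          * ∫ y, |quadForm (gram y) (fun a => τ b (X a)) (t k)
            - quadForm κ (fun a => τ b (X a)) (t k)| ∂Λ) := by
  set A := haarConst ι / √((max p q : ℕ) : ℝ)
  have hA : 0 ≤ A := div_nonneg (haarConst_nonneg ι) (Real.sqrt_nonneg _)
  let V : (Fin q → T' → ℝ) → B → ι → ℝ := fun y b k => quadForm (gram y) (fun a => τ b (X a)) (t k)
  let V₀ : B → ι → ℝ := fun b k => quadForm κ (fun a => τ b (X a)) (t k)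
  have hV0 : ∀ y b k, 0 ≤ V y b k := fun y b k => by
    simp only [V, quadForm_gram]; positivity
  have hVint : ∀ b k, Integrable (fun y => |V y b k - V₀ b k|) Λ := fun b k =>
    ((integrable_finsetSum _ fun i _ => (integrable_gram_of_sq hInt _ _).const_mul _).sub
      (integrable_const _)).abs
  let v : (Fin q → T' → ℝ) → B → ι → Fin q → ℝ := fun y b k j =>
    c / √(q : ℝ) * ∑ a, t k a * y j (τ b (X a))
  let s : ι → ℝ := fun k => σ * ∑ a, t k a
  have hv : ∀ y b k, ∑ j, v y b k j ^ 2 = c ^ 2 * V y b k := fun y b k =>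
    sum_scaled_sq y (fun a => τ b (X a)) (t k)
  have hexp : ∀ (θ : (B → Fin p → Fin q → ℝ) × (Fin p → ℝ)) (y : Fin q → T' → ℝ),
      ∑ k, ∑ a, t k a * genLayer c σ τ θ y (e k) (X a)
        = (∑ b, ∑ k, ∑ j, θ.1 b (e k) j * v y b k j) + ∑ k, θ.2 (e k) * s k := by
    intro θ y
    rw [Finset.sum_comm (s := (Finset.univ : Finset B)), ← Finset.sum_add_distrib]
    refine Finset.sum_congr rfl fun k _ => ?_
    simp only [genLayer, v, s, mul_add, Finset.sum_add_distrib]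
    congr 1
    · simp only [Finset.mul_sum]
      rw [Finset.sum_comm]
      trans ∑ j, ∑ b, ∑ a, t k a * (c / √(q : ℝ) * (θ.1 b (e k) j * y j (τ b (X a))))
      · exact Finset.sum_congr rfl fun j _ => Finset.sum_comm
      rw [Finset.sum_comm]
      refine Finset.sum_congr rfl fun b _ => Finset.sum_congr rfl fun j _ =>
        Finset.sum_congr rfl fun a _ => ?_
      ring
    · rw [Finset.mul_sum, Finset.mul_sum]
      exact Finset.sum_congr rfl fun a _ => by ring
  have hmeas : Measurable fun h : Fin p → T → ℝ =>
      Complex.exp ((∑ k, ∑ a, t k a * h (e k) (X a) : ℝ) * Complex.I) := by fun_prop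
  have hpint : Integrable (fun z : (Fin q → T' → ℝ) × ((B → Fin p → Fin q → ℝ) × (Fin p → ℝ)) =>
      Complex.exp ((∑ k, ∑ a, t k a * genLayer c σ τ z.2 z.1 (e k) (X a) : ℝ) * Complex.I))
      (Λ.prod (layerWeights B p q)) := by
    refine Integrable.of_bound (C := 1)
      (hmeas.comp (measurable_genLayer c σ τ)).aestronglyMeasurable (.of_forall fun z => ?_)
    exact (Complex.norm_exp_ofReal_mul_I _).le
  rw [integral_layerLaw _ hmeas.aestronglyMeasurable hpint]
  set L := Complex.exp (-(((∑ b, ∑ k, c ^ 2 * V₀ b k) + ∑ k, s k ^ 2 : ℝ) / 2)) with hL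
  have hsub : ∫ y, ((∫ θ, Complex.exp ((∑ k, ∑ a, t k a * genLayer c σ τ θ y (e k) (X a) : ℝ)
        * Complex.I) ∂(layerWeights B p q)) - L) ∂Λ
      = (∫ y, ∫ θ, Complex.exp ((∑ k, ∑ a, t k a * genLayer c σ τ θ y (e k) (X a) : ℝ)
        * Complex.I) ∂(layerWeights B p q) ∂Λ) - L := by
    refine (integral_sub hpint.integral_prod_left (integrable_const _)).trans ?_
    simp
  refine (congrArg norm hsub).symm.le.trans ?_
  let bound : (Fin q → T' → ℝ) → ℝ := fun y =>
    ∑ b, ∑ k, (A * (1 + c ^ 2 * V₀ b k) + (A + 1 / 2) * c ^ 2 * |V y b k - V₀ b k|)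
  have hbint : ∀ b k, Integrable
      (fun y => A * (1 + c ^ 2 * V₀ b k) + (A + 1 / 2) * c ^ 2 * |V y b k - V₀ b k|) Λ :=
    fun b k => (integrable_const _).add ((hVint b k).const_mul _)
  have hb : ∀ y, ‖(∫ θ, Complex.exp ((∑ k, ∑ a, t k a * genLayer c σ τ θ y (e k) (X a) : ℝ)
        * Complex.I) ∂(layerWeights B p q)) - L‖ ≤ bound y := by
    intro y
    simp_rw [hexp]
    have h1 := layerWeights_char_sub_le hN e (v y) s
    simp_rw [hv] at h1
    have h2 := norm_exp_neg_half_sub_le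
      (x := (∑ b, ∑ k, c ^ 2 * V y b k) + ∑ k, s k ^ 2)
      (y := (∑ b, ∑ k, c ^ 2 * V₀ b k) + ∑ k, s k ^ 2)
      (add_nonneg (Finset.sum_nonneg fun b _ => Finset.sum_nonneg fun k _ =>
        mul_nonneg (sq_nonneg _) (hV0 y b k)) (by positivity))
      (add_nonneg (Finset.sum_nonneg fun b _ => Finset.sum_nonneg fun k _ =>
        mul_nonneg (sq_nonneg _) (hκ b k)) (by positivity))
    refine (norm_sub_le_norm_sub_add_norm_sub _ _ _).trans ((add_le_add h1 h2).trans ?_)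
    have h3 : ∀ b k, A * √(c ^ 2 * V y b k) ≤
        A * (1 + c ^ 2 * V₀ b k) + A * c ^ 2 * |V y b k - V₀ b k| := by
      intro b k
      have h4 : √(c ^ 2 * V y b k) ≤ 1 + c ^ 2 * V y b k := by
        have h5 : 0 ≤ c ^ 2 * V y b k := mul_nonneg (sq_nonneg _) (hV0 y b k)
        rw [Real.sqrt_le_left (by linarith)]
        nlinarith
      have h6 := le_abs_self (V y b k - V₀ b k)
      have h7 : c ^ 2 * V y b k ≤ c ^ 2 * V₀ b k + c ^ 2 * |V y b k - V₀ b k| := by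
        nlinarith [sq_nonneg c]
      calc _ ≤ A * (1 + (c ^ 2 * V₀ b k + c ^ 2 * |V y b k - V₀ b k|)) := by gcongr; linarith
        _ = _ := by ring
    have h8 : |((∑ b, ∑ k, c ^ 2 * V y b k) + ∑ k, s k ^ 2)
        - ((∑ b, ∑ k, c ^ 2 * V₀ b k) + ∑ k, s k ^ 2)|
        ≤ ∑ b, ∑ k, c ^ 2 * |V y b k - V₀ b k| := by
      rw [add_sub_add_right_eq_sub, ← Finset.sum_sub_distrib]
      refine (Finset.abs_sum_le_sum_abs _ _).trans (Finset.sum_le_sum fun b _ => ?_)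
      rw [← Finset.sum_sub_distrib]
      refine (Finset.abs_sum_le_sum_abs _ _).trans (Finset.sum_le_sum fun k _ => ?_)
      rw [← mul_sub, abs_mul, abs_of_nonneg (sq_nonneg c)]
    calc _ ≤ (∑ b, ∑ k, (A * (1 + c ^ 2 * V₀ b k) + A * c ^ 2 * |V y b k - V₀ b k|))
          + 1 / 2 * ∑ b, ∑ k, c ^ 2 * |V y b k - V₀ b k| := by
          gcongr
          simp_rw [Finset.mul_sum]
          exact Finset.sum_le_sum fun b _ => Finset.sum_le_sum fun k _ => h3 b k
      _ = bound y := by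
          simp only [bound, Finset.mul_sum, ← Finset.sum_add_distrib]
          exact Finset.sum_congr rfl fun b _ => Finset.sum_congr rfl fun k _ => by ring
  refine (norm_integral_le_of_norm_le (integrable_finsetSum _ fun b _ =>
    integrable_finsetSum _ fun k _ => hbint b k) (.of_forall hb)).trans ?_
  rw [integral_finsetSum _ fun b _ => integrable_finsetSum _ fun k _ => hbint b k]
  refine Finset.sum_le_sum fun b _ => ?_
  rw [integral_finsetSum _ fun k _ => hbint b k]
  refine Finset.sum_le_sum fun k _ => ?_
  rw [integral_add (integrable_const _) ((hVint b k).const_mul _)]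
  simp [V, V₀, integral_const_mul]

/-- The conditional second moment is affine in diagonal Gram entries, and these are integrable;
joint integrability follows by Tonelli. The value is the same for every channel `i`. -/
theorem integrable_layerLaw_sq {p q : ℕ} {Λ : Measure (Fin q → T' → ℝ)} [IsProbabilityMeasure Λ]
    (hInt : ∀ j u, Integrable (fun y => y j u ^ 2) Λ) (i : Fin p) (u : T) :
    Integrable (fun z : (Fin q → T' → ℝ) × ((B → Fin p → Fin q → ℝ) × (Fin p → ℝ)) =>
      genLayer c σ τ z.2 z.1 i u ^ 2) (Λ.prod (layerWeights B p q)) ∧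
    ∀ y, ∫ θ, genLayer c σ τ θ y i u ^ 2 ∂(layerWeights B p q)
      = c ^ 2 * ∑ b, gram y (τ b u) (τ b u) + σ ^ 2 := by
  have hform : ∀ (θ : (B → Fin p → Fin q → ℝ) × (Fin p → ℝ)) (y : Fin q → T' → ℝ),
      genLayer c σ τ θ y i u
        = (∑ b, ∑ j, θ.1 b i j * (c / √(q : ℝ) * y j (τ b u))) + σ * θ.2 i := by
    intro θ y
    rw [genLayer, Finset.mul_sum, Finset.sum_comm]
    simp_rw [Finset.mul_sum]
    rw [Finset.sum_comm]
    congr 1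
    rw [Finset.sum_comm]
    exact Finset.sum_congr rfl fun b _ => Finset.sum_congr rfl fun j _ => by ring
  have hsec : ∀ y, ∫ θ, genLayer c σ τ θ y i u ^ 2 ∂(layerWeights B p q)
      = c ^ 2 * ∑ b, gram y (τ b u) (τ b u) + σ ^ 2 := by
    intro y
    simp_rw [hform]
    rw [integral_layerWeights_row_sq, Finset.mul_sum]
    congr 1
    refine Finset.sum_congr rfl fun b _ => ?_
    simp_rw [gram, mul_pow, ← Finset.mul_sum, div_pow, Real.sq_sqrt (Nat.cast_nonneg q), sq]
    ring
  refine ⟨?_, hsec⟩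
  have hmeas : Measurable fun z : (Fin q → T' → ℝ) × ((B → Fin p → Fin q → ℝ) × (Fin p → ℝ)) =>
      genLayer c σ τ z.2 z.1 i u ^ 2 := by
    have := measurable_genLayer (p := p) (q := q) c σ τ
    fun_prop
  rw [integrable_prod_iff hmeas.aestronglyMeasurable]
  refine ⟨.of_forall fun y => ?_, ?_⟩
  · simp_rw [hform]
    exact (memLp_layerWeights_row i (fun b j => c / √(q : ℝ) * y j (τ b u)) σ).integrable_sq
  · simp only [norm_pow, Real.norm_eq_abs, sq_abs, hsec]
    exact ((integrable_finsetSum _ fun b _ => integrable_gram_of_sq hInt _ _).const_mul _).add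
      (integrable_const _)

theorem dotProduct_kernelMatrix_mulVec {D : ℕ} (K : T → T → ℝ) (X : Fin D → T) (x : Fin D → ℝ) :
    x ⬝ᵥ (kernelMatrix K X).mulVec x = quadForm K X x := by
  simp only [quadForm, dotProduct, Matrix.mulVec, kernelMatrix, Matrix.of_apply, Finset.sum_product,
    Finset.mul_sum]
  exact Finset.sum_congr rfl fun a _ => Finset.sum_congr rfl fun b _ => by ring

theorem quadForm_layer {D : ℕ} (κ : T' → T' → ℝ) (X : Fin D → T) (x : Fin D → ℝ) :
    quadForm (fun u v => c ^ 2 * ∑ b, κ (τ b u) (τ b v) + σ ^ 2) X x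
      = (∑ b, c ^ 2 * quadForm κ (fun a => τ b (X a)) x) + (σ * ∑ a, x a) ^ 2 := by
  simp only [quadForm, mul_add, Finset.sum_add_distrib]
  congr 1
  · simp only [Finset.mul_sum]
    rw [Finset.sum_comm]
    exact Finset.sum_congr rfl fun b _ => Finset.sum_congr rfl fun i _ => by ring
  · rw [Finset.sum_product, mul_pow, sq (∑ a, x a), Finset.sum_mul_sum, Finset.mul_sum]
    refine Finset.sum_congr rfl fun a _ => ?_
    rw [Finset.mul_sum]
    exact Finset.sum_congr rfl fun b _ => by ring

variable {q : ℕ → ℕ} {Λ : ∀ ν, Measure (Fin (q ν) → T' → ℝ)} [∀ ν, IsProbabilityMeasure (Λ ν)]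
  {κ : T' → T' → ℝ}

theorem AsymptoticGram.quadForm_nonneg (hΛ : AsymptoticGram q Λ κ) {D : ℕ} (X : Fin D → T')
    (x : Fin D → ℝ) : 0 ≤ quadForm κ X x :=
  hΛ.nonneg Finset.univ x X

theorem AsymptoticGram.posSemidef_layer (hΛ : AsymptoticGram q Λ κ) (c σ : ℝ) (τ : B → T → T')
    {D : ℕ} (X : Fin D → T) :
    (kernelMatrix (fun u v => c ^ 2 * ∑ b, κ (τ b u) (τ b v) + σ ^ 2) X).PosSemidef := by
  refine Matrix.PosSemidef.of_dotProduct_mulVec_nonneg ?_ fun x => ?_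
  · ext a b
    simp [kernelMatrix, hΛ.symm (τ _ (X a)) (τ _ (X b))]
  · rw [star_trivial, dotProduct_kernelMatrix_mulVec, quadForm_layer]
    have : ∀ b, 0 ≤ quadForm κ (fun a => τ b (X a)) x := fun b => hΛ.quadForm_nonneg _ _
    have h2 : 0 ≤ ∑ b, c ^ 2 * quadForm κ (fun a => τ b (X a)) x :=
      Finset.sum_nonneg fun b _ => mul_nonneg (sq_nonneg c) (this b)
    positivity

/-- It is enough that the larger of the two widths diverges. This covers both a first layer of fixed
input width and an output layer of arbitrary width. -/
theorem AsymptoticGram.tendsto_iid_layer (hΛ : AsymptoticGram q Λ κ) (c σ : ℝ) (τ : B → T → T')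
    (p : ℕ → ℕ) (hpq : Tendsto (fun ν => max (p ν) (q ν)) atTop atTop) :
    TendstoIIDGaussianProcesses (fun ν => layerLaw c σ τ (p ν) (Λ ν)) p (fun _ h i u => h i u)
      (fun u v => c ^ 2 * ∑ b, κ (τ b u) (τ b v) + σ ^ 2) := by
  refine ⟨fun D X => hΛ.posSemidef_layer c σ τ X, fun D X I hI => ?_⟩
  refine tendstoInDistribution_pi_of_char _ _ (fun ν => ?_) _ fun t => ?_
  · refine measurable_pi_lambda _ fun i => (WithLp.measurable_toLp 2 _).comp
      (measurable_pi_lambda _ fun a => ?_)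
    by_cases hi : (i : ℕ) < p ν
    · simp only [hi, dite_true]; fun_prop
    · simp only [hi, dite_false]; fun_prop
  set Q : B → I → ℝ := fun b k => quadForm κ (fun a => τ b (X a)) (t k).ofLp with hQ
  have hQ0 : ∀ b k, 0 ≤ Q b k := fun b k => hΛ.quadForm_nonneg _ _
  have hlim : ∏ i, charFun (gpMarginal (fun u v => c ^ 2 * ∑ b, κ (τ b u) (τ b v) + σ ^ 2) X) (t i)
      = Complex.exp (-(((∑ b, ∑ k, c ^ 2 * Q b k)
          + ∑ k, (σ * ∑ a, (t k).ofLp a) ^ 2 : ℝ) / 2)) := by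
    simp_rw [gpMarginal, charFun_multivariateGaussian (hΛ.posSemidef_layer c σ τ X),
      ← Complex.exp_sum, dotProduct_kernelMatrix_mulVec, quadForm_layer]
    congr 1
    simp only [inner_zero_right, Complex.ofReal_zero, zero_mul, zero_sub, Finset.sum_neg_distrib,
      ← Finset.sum_div]
    rw [Finset.sum_comm, ← Finset.sum_add_distrib]
    push_cast
    rfl
  rw [hlim, tendsto_iff_norm_sub_tendsto_zero]
  set A : ℕ → ℝ := fun ν => haarConst I / √((max (p ν) (q ν) : ℕ) : ℝ) with hAdef
  have hA : Tendsto A atTop (𝓝 0) :=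
    tendsto_const_nhds.div_atTop (Real.tendsto_sqrt_atTop.comp
      (tendsto_natCast_atTop_atTop.comp hpq))
  have hd : ∀ b k, Tendsto (fun ν => ∫ y, |quadForm (gram y) (fun a => τ b (X a)) (t k).ofLp
      - Q b k| ∂(Λ ν)) atTop (𝓝 0) := fun b k =>
    hΛ.tendsto_linear _ _ (fun i : Fin D × Fin D => τ b (X i.1)) (fun i => τ b (X i.2))
  have hbound : Tendsto (fun ν => ∑ b, ∑ k, (A ν * (1 + c ^ 2 * Q b k) + (A ν + 1 / 2) * c ^ 2
      * ∫ y, |quadForm (gram y) (fun a => τ b (X a)) (t k).ofLp - Q b k| ∂(Λ ν))) atTop (𝓝 0) := by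
    have := tendsto_finsetSum (Finset.univ : Finset B) fun b _ =>
      tendsto_finsetSum (Finset.univ : Finset I) fun k _ =>
        (hA.mul_const (1 + c ^ 2 * Q b k)).add
          (((hA.add_const (1 / 2)).mul_const (c ^ 2)).mul (hd b k))
    simpa using this
  refine squeeze_zero' (.of_forall fun _ => norm_nonneg _) ?_ hbound
  filter_upwards [hI, hpq.eventually_gt_atTop 0] with ν hν hN
  let e : I ↪ Fin (p ν) := ⟨fun k => ⟨k, hν k k.2⟩, fun k l h => by
    exact Subtype.ext (Fin.mk.inj_iff.mp h)⟩
  have key := layerLaw_char_sub_le (c := c) (σ := σ) (τ := τ) hN e (hΛ.integrable_sq ν) κ X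
    (fun k => (t k).ofLp) hQ0
  refine le_trans (le_of_eq ?_) key
  congr 4
  ext h
  congr 3
  refine Finset.sum_congr rfl fun k _ => ?_
  simp only [PiLp.inner_apply, RCLike.inner_apply, conj_trivial]
  refine Finset.sum_congr rfl fun a _ => ?_
  rw [dif_pos (hν k k.2)]
  rfl

theorem AsymptoticGram.asymptoticGaussian_layer (hΛ : AsymptoticGram q Λ κ) (c σ : ℝ)
    (τ : B → T → T') (p : ℕ → ℕ) (hpq : Tendsto (fun ν => max (p ν) (q ν)) atTop atTop) :
    AsymptoticGaussian p (fun ν => layerLaw c σ τ (p ν) (Λ ν))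
      (fun u v => c ^ 2 * ∑ b, κ (τ b u) (τ b v) + σ ^ 2) := by
  have hmeas : ∀ (ν : ℕ) (i : Fin (p ν)) (u : T),
      Measurable fun h : Fin (p ν) → T → ℝ => h i u ^ 2 := fun ν i u => by fun_prop
  refine ⟨hΛ.tendsto_iid_layer c σ τ p hpq, fun ν i u => ?_, fun u => ?_, fun ν R => ?_,
    fun u hu => ?_⟩
  · rw [layerLaw, integrable_map_measure (hmeas ν i u).aestronglyMeasurable
      (measurable_genLayer c σ τ).aemeasurable]
    exact (integrable_layerLaw_sq (hΛ.integrable_sq ν) i u).1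
  · refine ⟨fun ν => ∫ y, (c ^ 2 * ∑ b, gram y (τ b u) (τ b u) + σ ^ 2) ∂(Λ ν), ?_, fun ν i => ?_⟩
    · have h1 : ∀ b, Tendsto (fun ν => ∫ y, gram y (τ b u) (τ b u) ∂(Λ ν)) atTop
          (𝓝 (κ (τ b u) (τ b u))) := by
        intro b
        rw [tendsto_iff_norm_sub_tendsto_zero]
        refine squeeze_zero (fun _ => norm_nonneg _) (fun ν => ?_) (hΛ.tendsto_gram (τ b u) (τ b u))
        have : ∫ y, (gram y (τ b u) (τ b u) - κ (τ b u) (τ b u)) ∂(Λ ν)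
            = (∫ y, gram y (τ b u) (τ b u) ∂(Λ ν)) - κ (τ b u) (τ b u) := by
          rw [integral_sub (hΛ.integrable_gram ν _ _) (integrable_const _)]
          simp
        rw [← this]
        exact norm_integral_le_integral_norm _
      have h2 := ((tendsto_finsetSum (Finset.univ : Finset B) fun b _ => h1 b).const_mul
        (c ^ 2)).add_const (σ ^ 2)
      refine h2.congr fun ν => ?_
      have hi : ∀ b, Integrable (fun y : Fin (q ν) → T' → ℝ => gram y (τ b u) (τ b u)) (Λ ν) :=
        fun b => hΛ.integrable_gram ν _ _
      rw [integral_add ((integrable_finsetSum _ fun b _ => hi b).const_mul _) (integrable_const _),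
        integral_const_mul, integral_finsetSum _ fun b _ => hi b]
      simp
    · have h := integrable_layerLaw_sq (c := c) (σ := σ) (τ := τ) (hΛ.integrable_sq ν) i u
      rw [integral_layerLaw _ (hmeas ν i u).aestronglyMeasurable h.1]
      simp_rw [h.2]
  -- Rotating the output channels is the same as rotating the weights and the bias, whose joint law
  -- is invariant.
  · have hcomm : ∀ z : (Fin (q ν) → T' → ℝ) × ((B → Fin (p ν) → Fin (q ν) → ℝ) × (Fin (p ν) → ℝ)),
        leftMul R (genLayer c σ τ z.2 z.1) = genLayer c σ τ
          ((fun b => leftMul R (z.2.1 b)), fun i => ∑ k, R.1 i k * z.2.2 k) z.1 := by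
      intro z
      ext i u
      simp only [leftMul, genLayer, mul_add, Finset.sum_add_distrib, Finset.mul_sum, Finset.sum_mul]
      congr 1
      · rw [Finset.sum_comm]
        refine Finset.sum_congr rfl fun j _ => ?_
        rw [Finset.sum_comm]
        exact Finset.sum_congr rfl fun b _ => Finset.sum_congr rfl fun k _ => by ring
      · exact Finset.sum_congr rfl fun k _ => by ring
    have hmp := (MeasurePreserving.id (Λ ν)).prod
      (measurePreserving_layerWeights (B := B) (q := q ν) R)
    conv_rhs => rw [layerLaw, ← hmp.map_eq, Measure.map_map (measurable_genLayer c σ τ)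
      hmp.measurable]
    rw [layerLaw, Measure.map_map (measurable_leftMul R) (measurable_genLayer c σ τ)]
    congr 1
    ext z : 1
    exact hcomm z
  -- A vanishing sum of nonnegative terms forces `σ = 0` and either `c = 0` or every `κ (τ b u) (τ b
  -- u) = 0`. In the latter case the output at `u` can be nonzero only if some input at `τ b u` is,
  -- and a union bound over `b` applies.
  · have hnn : ∀ b, 0 ≤ κ (τ b u) (τ b u) := fun b => hΛ.diag_nonneg _
    have hs : 0 ≤ ∑ b, κ (τ b u) (τ b u) := Finset.sum_nonneg fun b _ => hnn b
    have hσ : σ = 0 := by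
      have : σ ^ 2 = 0 := by nlinarith [mul_nonneg (sq_nonneg c) hs, sq_nonneg σ]
      exact pow_eq_zero_iff two_ne_zero |>.mp this
    have hc : c ^ 2 * ∑ b, κ (τ b u) (τ b u) = 0 := by simpa [hσ] using hu
    have hlaw : ∀ ν, (layerLaw c σ τ (p ν) (Λ ν)).real {h | ∃ i, h i u ≠ 0}
        = ((Λ ν).prod (layerWeights B (p ν) (q ν))).real
          {z | ∃ i, genLayer c σ τ z.2 z.1 i u ≠ 0} := fun ν => by
      rw [layerLaw, map_measureReal_apply (measurable_genLayer c σ τ) (measurableSet_exists_ne_zero u)]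
      rfl
    simp_rw [hlaw]
    rcases eq_or_ne c 0 with rfl | hc0
    · simp [genLayer, hσ]
    have hz : ∀ b, κ (τ b u) (τ b u) = 0 := by
      have h0 := (mul_eq_zero.mp hc).resolve_left (pow_ne_zero 2 hc0)
      intro b
      exact (Finset.sum_eq_zero_iff_of_nonneg fun b _ => hnn b).mp h0 b (Finset.mem_univ b)
    have hlim := tendsto_finsetSum (Finset.univ : Finset B) fun b _ =>
      hΛ.tendsto_support (τ b u) (hz b)
    simp only [Finset.sum_const_zero] at hlim
    refine squeeze_zero (fun _ => measureReal_nonneg) (fun ν => ?_) hlim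
    calc _ ≤ ((Λ ν).prod (layerWeights B (p ν) (q ν))).real
          (⋃ b, Prod.fst ⁻¹' {y : Fin (q ν) → T' → ℝ | ∃ j, y j (τ b u) ≠ 0}) := by
          refine measureReal_mono ?_
          rintro z ⟨i, hi⟩
          by_contra hcon
          simp only [Set.mem_iUnion, Set.mem_preimage, Set.mem_ofPred_eq, not_exists, not_not] at hcon
          apply hi
          simp [genLayer, hσ, hcon]
      _ ≤ ∑ b, ((Λ ν).prod (layerWeights B (p ν) (q ν))).real
          (Prod.fst ⁻¹' {y : Fin (q ν) → T' → ℝ | ∃ j, y j (τ b u) ≠ 0}) :=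
          measureReal_iUnion_fintype_le _
      _ = _ := by
          refine Finset.sum_congr rfl fun b _ => ?_
          rw [measureReal_def, measureReal_def, measurePreserving_fst.measure_preimage
            (measurableSet_exists_ne_zero (τ b u)).nullMeasurableSet]

end Layer

/-! ### Uniform absolute continuity -/

/-- `arccos` is differentiable on `(-1, 1)` and so maps null sets to null sets. Apart from the
countably many zeros of the sine, the preimage is covered by countably many translates and
reflections of such an image. -/
theorem volume_preimage_cos_eq_zero {Z : Set ℝ} (hZ : volume Z = 0) :
    volume (Real.cos ⁻¹' Z) = 0 := by
  have h1 : volume (Real.arccos '' (Z ∩ Set.Ioo (-1) 1)) = 0 := by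
    refine addHaar_image_eq_zero_of_differentiableOn_of_addHaar_eq_zero volume
      (fun x hx => ?_) (measure_mono_null Set.inter_subset_left hZ)
    exact (Real.differentiableAt_arccos.mpr ⟨hx.2.1.ne', hx.2.2.ne⟩).differentiableWithinAt
  have hsub : Real.cos ⁻¹' Z ⊆ (⋃ n : ℤ, {(n : ℝ) * Real.pi}) ∪
      ⋃ n : ℤ, ((fun x => x - 2 * n * Real.pi) ⁻¹' (Real.arccos '' (Z ∩ Set.Ioo (-1) 1)) ∪
        (fun x => 2 * n * Real.pi - x) ⁻¹' (Real.arccos '' (Z ∩ Set.Ioo (-1) 1))) := by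
    intro x hx
    by_cases hs : Real.sin x = 0
    · obtain ⟨n, hn⟩ := Real.sin_eq_zero_iff.mp hs
      exact Or.inl (Set.mem_iUnion.mpr ⟨n, hn.symm⟩)
    · right
      have hsq := Real.sin_sq_add_cos_sq x
      have hpos : 0 < Real.sin x ^ 2 := by positivity
      have hlt : Real.cos x ∈ Set.Ioo (-1 : ℝ) 1 := by
        constructor <;> nlinarith
      have hcos : Real.cos (Real.arccos (Real.cos x)) = Real.cos x :=
        Real.cos_arccos hlt.1.le hlt.2.le
      obtain ⟨n, hn | hn⟩ := Real.cos_eq_cos_iff.mp hcos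
      · refine Set.mem_iUnion.mpr ⟨n, Or.inl ⟨Real.cos x, ⟨hx, hlt⟩, ?_⟩⟩
        simp only
        linarith
      · refine Set.mem_iUnion.mpr ⟨n, Or.inr ⟨Real.cos x, ⟨hx, hlt⟩, ?_⟩⟩
        simp only
        linarith
  refine measure_mono_null hsub (measure_union_null ?_ ?_)
  · exact measure_iUnion_null fun n => measure_singleton _
  · refine measure_iUnion_null fun n => measure_union_null ?_ ?_
    · rw [(measurePreserving_sub_right volume _).measure_preimage (.of_null h1), h1]
    · rw [(Measure.measurePreserving_sub_left volume _).measure_preimage (.of_null h1), h1]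

/-- The law of the cosine on a bounded interval. -/
def cosLaw : Measure ℝ := (volume.restrict (Set.Ioo (-4) 10)).map Real.cos

instance : IsFiniteMeasure cosLaw := by unfold cosLaw; infer_instance

theorem cosLaw_absolutelyContinuous : cosLaw ≪ volume := by
  refine Measure.AbsolutelyContinuous.mk fun Z hZm hZ => ?_
  rw [cosLaw, Measure.map_apply Real.measurable_cos hZm]
  exact Measure.restrict_le_self.absolutelyContinuous (volume_preimage_cos_eq_zero hZ)

/-- A finite measure has an integrable density, which gives absolute continuity in its `ε`-`δ` form.
-/
theorem MeasureTheory.Measure.AbsolutelyContinuous.exists_pos_forall_lt {α : Type*}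
    {m : MeasurableSpace α} {μ ν : Measure α} [IsFiniteMeasure μ] [SigmaFinite ν] (h : μ ≪ ν)
    {ε : ENNReal} (hε : ε ≠ 0) : ∃ δ > 0, ∀ A, ν A < δ → μ A < ε := by
  have hd := Measure.withDensity_rnDeriv_eq μ ν h
  obtain ⟨δ, hδ, H⟩ := exists_pos_setLIntegral_lt_of_measure_lt
    (Measure.lintegral_rnDeriv_lt_top μ ν).ne hε
  refine ⟨δ, hδ, fun A hA => ?_⟩
  have := H A hA
  rwa [← withDensity_apply' _ A, hd] at this

/-- The angles at which a nonzero linear combination of cosine and sine lies in `A`. -/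
theorem volume_angle_le_cosLaw {a b : ℝ} {A : Set ℝ} (hA : MeasurableSet A) :
    volume {θ ∈ Set.Ioo 0 (2 * Real.pi) | Real.cos θ * a + Real.sin θ * b ∈ A}
      ≤ cosLaw ((fun x => √(a ^ 2 + b ^ 2) * x) ⁻¹' A) := by
  let z : ℂ := ⟨a, b⟩
  have hz : ‖z‖ = √(a ^ 2 + b ^ 2) := by
    rw [Complex.norm_def, Complex.normSq_apply]
    simp [z, sq]
  set ρ := √(a ^ 2 + b ^ 2)
  have ha : a = ρ * Real.cos z.arg := by rw [← hz, Complex.norm_mul_cos_arg]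
  have hb : b = ρ * Real.sin z.arg := by rw [← hz, Complex.norm_mul_sin_arg]
  have hform : ∀ θ, Real.cos θ * a + Real.sin θ * b = ρ * Real.cos (θ - z.arg) := by
    intro θ
    rw [Real.cos_sub, ha, hb, ← ha, ← hb]
    linear_combination (Real.cos θ) * ha + (Real.sin θ) * hb
  have hm : MeasurableSet ((fun x => ρ * x) ⁻¹' A) := (measurable_const_mul ρ) hA
  rw [cosLaw, Measure.map_apply Real.measurable_cos hm,
    Measure.restrict_apply (Real.measurable_cos hm)]
  rw [← (measurePreserving_sub_right volume z.arg).measure_preimage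
    ((Real.measurable_cos hm).inter measurableSet_Ioo).nullMeasurableSet]
  refine measure_mono ?_
  rintro θ ⟨⟨h0, h1⟩, h2⟩
  rw [hform] at h2
  -- The shifted angle `θ - arg z` lies in `(-π, 3π)`, which is contained in the interval `(-4, 10)`
  -- of `cosLaw`.
  have h3 := Complex.neg_pi_lt_arg z
  have h4 := Complex.arg_le_pi z
  have h5 := Real.pi_lt_d2
  refine ⟨h2, ?_, ?_⟩ <;> linarith

/-! ### Approximation of measurable functions along a sequence of measures -/

/-- A sequence of measures on the line with uniformly integrable second moments, uniformly
absolutely continuous away from the origin. -/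
structure UniformlyTame (μ : ℕ → Measure ℝ) : Prop where
  mass : ∃ C : ENNReal, C ≠ ⊤ ∧ ∀ ν, μ ν Set.univ ≤ C
  tail : ∀ ε : ENNReal, ε ≠ 0 → ∃ R : ℝ, 1 ≤ R ∧ ∀ᶠ ν in atTop,
    ∫⁻ x in {x | R < |x|}, ENNReal.ofReal (x ^ 2) ∂(μ ν) ≤ ε
  -- The origin is excluded because the laws may have an atom there, as in the degenerate case. The
  -- threshold `δ` is uniform in `A`, but the index from which the bound holds may depend on `A`.
  abs_cont : ∀ ε : ENNReal, ε ≠ 0 → ∃ δ : ENNReal, δ ≠ 0 ∧ ∀ A, MeasurableSet A → volume A ≤ δ →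
    (0 : ℝ) ∉ A → ∀ᶠ ν in atTop, μ ν A ≤ ε

/-- Adding measures lets one approximating function serve several laws at once. -/
theorem UniformlyTame.add {μ μ' : ℕ → Measure ℝ} (h : UniformlyTame μ) (h' : UniformlyTame μ') :
    UniformlyTame fun ν => μ ν + μ' ν := by
  refine ⟨?_, fun ε hε => ?_, fun ε hε => ?_⟩
  · obtain ⟨C, hC, H⟩ := h.mass
    obtain ⟨C', hC', H'⟩ := h'.mass
    refine ⟨C + C', ENNReal.add_ne_top.mpr ⟨hC, hC'⟩, fun ν => ?_⟩
    rw [Measure.add_apply]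
    exact add_le_add (H ν) (H' ν)
  · have hε2 : ε / 2 ≠ 0 := by simpa using hε
    obtain ⟨R, hR, H⟩ := h.tail _ hε2
    obtain ⟨R', _, H'⟩ := h'.tail _ hε2
    refine ⟨max R R', hR.trans (le_max_left _ _), ?_⟩
    filter_upwards [H, H'] with ν h1 h2
    rw [Measure.restrict_add, lintegral_add_measure, ← ENNReal.add_halves ε]
    refine add_le_add (le_trans (lintegral_mono_set fun x hx => ?_) h1)
      (le_trans (lintegral_mono_set fun x hx => ?_) h2)
    · exact lt_of_le_of_lt (le_max_left R R') (show max R R' < |x| from hx)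
    · exact lt_of_le_of_lt (le_max_right R R') (show max R R' < |x| from hx)
  · have hε2 : ε / 2 ≠ 0 := by simpa using hε
    obtain ⟨δ, hδ, H⟩ := h.abs_cont _ hε2
    obtain ⟨δ', hδ', H'⟩ := h'.abs_cont _ hε2
    refine ⟨min δ δ', by simp [min_eq_iff, hδ, hδ'], fun A hA hle h0 => ?_⟩
    filter_upwards [H A hA (hle.trans (min_le_left _ _)) h0,
      H' A hA (hle.trans (min_le_right _ _)) h0] with ν h1 h2
    rw [Measure.add_apply, ← ENNReal.add_halves ε]
    exact add_le_add h1 h2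

/-- Bounded continuous functions are dense in `L¹` of Lebesgue measure on `[-R, R]` plus a unit mass
at `0`; Markov's inequality converts this into closeness off a small set. Clipping to `[-b, b]` does
not increase the distance to `φ`. -/
theorem exists_boundedContinuous_close {φ : ℝ → ℝ} (hφ : Measurable φ) {R b : ℝ} (hb : 0 ≤ b)
    (hbd : ∀ x, |x| ≤ R → |φ x| ≤ b) {η : ℝ} (hη : 0 < η) {δ : ENNReal} (hδ : δ ≠ 0) (hR : 0 ≤ R) :
    ∃ ψ : BoundedContinuousFunction ℝ ℝ, (∀ x, |ψ x| ≤ b) ∧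
      volume {x | |x| ≤ R ∧ η ≤ |φ x - ψ x|} ≤ δ ∧ |φ 0 - ψ 0| < η := by
  let S : Set ℝ := Set.Icc (-R) R
  let ref : Measure ℝ := volume.restrict S + Measure.dirac 0
  have : IsFiniteMeasure (volume.restrict S) := ⟨by simp [S]⟩
  let φR : ℝ → ℝ := S.indicator φ
  have hφR : Measurable φR := hφ.indicator measurableSet_Icc
  have hInt : MemLp φR 1 ref := by
    refine memLp_one_iff_integrable.mpr (Integrable.of_bound (C := b) hφR.aestronglyMeasurable
      (.of_forall fun x => ?_))
    by_cases hx : x ∈ S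
    · simp only [φR, Set.indicator_of_mem hx, Real.norm_eq_abs]
      exact hbd x (abs_le.mpr hx)
    · simp [φR, Set.indicator_of_notMem hx, hb]
  -- An exceptional set of reference measure at most `1/2` cannot contain `0`, which carries mass
  -- one; hence the closeness at the origin.
  set δ' := min δ 2⁻¹ with hδ'
  have hδ'0 : δ' ≠ 0 := by simp [hδ', min_eq_iff, hδ]
  have hηE : ENNReal.ofReal η ≠ 0 := by simpa using hη
  obtain ⟨g, hg, -⟩ := hInt.exists_boundedContinuous_eLpNorm_sub_le ENNReal.one_ne_top
    (mul_ne_zero hηE hδ'0)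
  let ψ : BoundedContinuousFunction ℝ ℝ := BoundedContinuousFunction.ofNormedAddCommGroup
    (fun x => max (-b) (min b (g x))) (by fun_prop) b (fun x => by
      rw [Real.norm_eq_abs, abs_le]
      exact ⟨le_max_left _ _, max_le (by linarith) (min_le_left _ _)⟩)
  have hψ : ∀ x, ψ x = max (-b) (min b (g x)) := fun x => rfl
  have hψb : ∀ x, |ψ x| ≤ b := fun x => by
    rw [hψ, abs_le]
    exact ⟨le_max_left _ _, max_le (by linarith) (min_le_left _ _)⟩
  have hclose : ∀ x, |x| ≤ R → |φ x - ψ x| ≤ |φ x - g x| := by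
    intro x hx
    have h1 := abs_le.mp (hbd x hx)
    rw [hψ]
    have h2 : φ x = max (-b) (min b (φ x)) := by
      rw [min_eq_right h1.2, max_eq_right h1.1]
    calc |φ x - max (-b) (min b (g x))| = |max (-b) (min b (φ x)) - max (-b) (min b (g x))| := by
          rw [← h2]
      _ ≤ |min b (φ x) - min b (g x)| := by
          have := abs_max_sub_max_le_abs (min b (φ x)) (min b (g x)) (-b)
          simpa only [max_comm] using this
      _ ≤ |φ x - g x| := by
          have := abs_min_sub_min_le_max b (φ x) b (g x)
          simpa using this
  let A : Set ℝ := {x | |x| ≤ R ∧ η ≤ |φ x - ψ x|}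
  have hψm := ψ.continuous.measurable
  have hAm : MeasurableSet A := by
    have e1 : MeasurableSet {x : ℝ | |x| ≤ R} := measurableSet_le (by fun_prop) measurable_const
    have e2 : MeasurableSet {x : ℝ | η ≤ |φ x - ψ x|} :=
      measurableSet_le measurable_const (by fun_prop)
    exact e1.inter e2
  have hAref : ref A ≤ δ' := by
    have h1 : ENNReal.ofReal η * ref A ≤ ENNReal.ofReal η * δ' := by
      refine le_trans ?_ hg
      rw [eLpNorm_one_eq_lintegral_enorm]
      refine le_trans (mul_le_mul_right (measure_mono (fun x hx => ?_)) _)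
        (mul_meas_ge_le_lintegral ?_ (ENNReal.ofReal η))
      · have hxS : x ∈ S := abs_le.mp hx.1
        simp only [Set.mem_ofPred_eq, Pi.sub_apply, φR, Set.indicator_of_mem hxS]
        rw [← ofReal_norm, Real.norm_eq_abs]
        exact ENNReal.ofReal_le_ofReal (hx.2.trans (hclose x hx.1))
      · have := g.continuous.measurable
        fun_prop
    exact (ENNReal.mul_le_mul_iff_right hηE ENNReal.ofReal_ne_top).mp h1
  have hvol : volume A ≤ δ := by
    have h1 : volume.restrict S A = volume A := by
      rw [Measure.restrict_apply hAm]
      congr 1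
      exact Set.inter_eq_left.mpr fun x hx => abs_le.mp hx.1
    rw [← h1]
    refine le_trans ?_ (hAref.trans (min_le_left _ _))
    rw [Measure.add_apply]
    exact le_self_add
  have h0 : (0 : ℝ) ∉ A := by
    intro h
    have h1 : (1 : ENNReal) ≤ ref A := by
      rw [Measure.add_apply, Measure.dirac_apply_of_mem h]
      exact le_add_self
    have h2 := h1.trans (hAref.trans (min_le_right _ _))
    simp at h2
  refine ⟨ψ, hψb, hvol, ?_⟩
  by_contra! hcon
  exact h0 ⟨by simpa using hR, hcon⟩

/-- Three regions receive `ε / 3` each. For `|x| > R ≥ 1` both functions are at most `(c + m)|x|`,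
and the second moment tail is small. On the part of `[-R, R]` where `φ` and `ψ` differ by at least
`η`, both are bounded by `b` and the set has small mass, since it has small volume and avoids `0`.
Elsewhere the squared difference is at most `η²`. -/
theorem UniformlyTame.exists_approx {μ : ℕ → Measure ℝ} (hμ : UniformlyTame μ) {φ : ℝ → ℝ}
    (hφ : Measurable φ) {c m : ℝ} (hc : 0 ≤ c) (hm : 0 ≤ m) (hlin : ∀ x, |φ x| ≤ c + m * |x|)
    {ε : ENNReal} (hε : ε ≠ 0) :
    ∃ ψ : BoundedContinuousFunction ℝ ℝ, ∀ᶠ ν in atTop,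
      ∫⁻ x, ENNReal.ofReal ((φ x - ψ x) ^ 2) ∂(μ ν) ≤ ε := by
  have key : ∀ (C : ENNReal), C ≠ ⊤ → ∃ ε' : ENNReal, ε' ≠ 0 ∧ C * ε' ≤ ε / 3 := by
    intro C hC
    have h3 : ε / 3 ≠ 0 := by simp [hε]
    refine ⟨ε / 3 / (C + 1), ?_, ?_⟩
    · exact ENNReal.div_ne_zero.mpr ⟨h3, ENNReal.add_ne_top.mpr ⟨hC, ENNReal.one_ne_top⟩⟩
    · calc C * (ε / 3 / (C + 1)) ≤ (C + 1) * (ε / 3 / (C + 1)) := by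
            gcongr; exact le_self_add
        _ ≤ ε / 3 := ENNReal.mul_div_le
  obtain ⟨C, hC, hmass⟩ := hμ.mass
  obtain ⟨ε₁, hε₁, h1⟩ := key (ENNReal.ofReal (4 * (c + m) ^ 2)) ENNReal.ofReal_ne_top
  obtain ⟨R, hR, htail⟩ := hμ.tail ε₁ hε₁
  have hR0 : 0 ≤ R := by linarith
  set b := c + m * R with hb
  have hb0 : 0 ≤ b := by positivity
  obtain ⟨ε₂, hε₂, h2⟩ := key (ENNReal.ofReal (4 * b ^ 2)) ENNReal.ofReal_ne_top
  obtain ⟨δ, hδ, hac⟩ := hμ.abs_cont ε₂ hε₂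
  obtain ⟨ε₃, hε₃, h3⟩ := key C hC
  obtain ⟨η, hη, hη3⟩ : ∃ η : ℝ, 0 < η ∧ ENNReal.ofReal (η ^ 2) ≤ ε₃ := by
    rcases eq_or_ne ε₃ ⊤ with rfl | ht
    · exact ⟨1, one_pos, le_top⟩
    · refine ⟨√ε₃.toReal, Real.sqrt_pos.mpr (ENNReal.toReal_pos hε₃ ht), ?_⟩
      rw [Real.sq_sqrt ENNReal.toReal_nonneg, ENNReal.ofReal_toReal ht]
  obtain ⟨ψ, hψb, hvol, h0⟩ := exists_boundedContinuous_close hφ hb0 (R := R)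
    (fun x hx => (hlin x).trans (by rw [hb]; gcongr)) hη hδ hR0
  let A : Set ℝ := {x | |x| ≤ R ∧ η ≤ |φ x - ψ x|}
  have hψm := ψ.continuous.measurable
  have hAm : MeasurableSet A := by
    have e1 : MeasurableSet {x : ℝ | |x| ≤ R} := measurableSet_le (by fun_prop) measurable_const
    have e2 : MeasurableSet {x : ℝ | η ≤ |φ x - ψ x|} :=
      measurableSet_le measurable_const (by fun_prop)
    exact e1.inter e2
  have h0A : (0 : ℝ) ∉ A := fun h => absurd h.2 (not_le.mpr h0)
  have hTm : MeasurableSet {x : ℝ | R < |x|} := measurableSet_lt measurable_const (by fun_prop)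
  refine ⟨ψ, ?_⟩
  filter_upwards [htail, hac A hAm hvol h0A] with ν ht hA
  have hpt : ∀ x, ENNReal.ofReal ((φ x - ψ x) ^ 2) ≤
      {x : ℝ | R < |x|}.indicator (fun x => ENNReal.ofReal (4 * (c + m) ^ 2)
        * ENNReal.ofReal (x ^ 2)) x + A.indicator (fun _ => ENNReal.ofReal (4 * b ^ 2)) x
        + ENNReal.ofReal (η ^ 2) := by
    intro x
    by_cases hx : R < |x|
    · refine le_trans ?_ (le_trans le_self_add le_self_add)
      rw [Set.indicator_of_mem (by exact hx), ← ENNReal.ofReal_mul (by positivity)]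
      refine ENNReal.ofReal_le_ofReal ?_
      have hx1 : 1 ≤ |x| := by linarith
      have e1 : |φ x| ≤ (c + m) * |x| := (hlin x).trans (by nlinarith)
      have e2 : |ψ x| ≤ (c + m) * |x| := (hψb x).trans (by rw [hb]; nlinarith)
      have e3 : |φ x - ψ x| ≤ 2 * (c + m) * |x| := by
        have := abs_sub (φ x) (ψ x)
        linarith
      calc (φ x - ψ x) ^ 2 = |φ x - ψ x| ^ 2 := (sq_abs _).symm
        _ ≤ (2 * (c + m) * |x|) ^ 2 := by gcongr
        _ = 4 * (c + m) ^ 2 * x ^ 2 := by rw [mul_pow, sq_abs]; ring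
    · push Not at hx
      by_cases hxA : η ≤ |φ x - ψ x|
      · refine le_trans ?_ (le_trans le_add_self le_self_add)
        rw [Set.indicator_of_mem (show x ∈ A from ⟨hx, hxA⟩)]
        refine ENNReal.ofReal_le_ofReal ?_
        have e1 : |φ x| ≤ b := (hlin x).trans (by rw [hb]; gcongr)
        have e3 : |φ x - ψ x| ≤ 2 * b := by
          have := abs_sub (φ x) (ψ x)
          linarith [hψb x]
        calc (φ x - ψ x) ^ 2 = |φ x - ψ x| ^ 2 := (sq_abs _).symm
          _ ≤ (2 * b) ^ 2 := by gcongr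
          _ = 4 * b ^ 2 := by ring
      · refine le_trans (ENNReal.ofReal_le_ofReal ?_) le_add_self
        push Not at hxA
        rw [← sq_abs]
        gcongr
  calc ∫⁻ x, ENNReal.ofReal ((φ x - ψ x) ^ 2) ∂(μ ν) ≤ _ := lintegral_mono hpt
    _ = ENNReal.ofReal (4 * (c + m) ^ 2) * (∫⁻ x in {x | R < |x|}, ENNReal.ofReal (x ^ 2) ∂(μ ν))
        + ENNReal.ofReal (4 * b ^ 2) * μ ν A + ENNReal.ofReal (η ^ 2) * μ ν Set.univ := by
        rw [lintegral_add_right _ measurable_const, lintegral_add_right _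
          (measurable_const.indicator hAm), lintegral_indicator hTm, lintegral_indicator hAm,
          lintegral_const_mul _ (by fun_prop)]
        simp
    _ ≤ ENNReal.ofReal (4 * (c + m) ^ 2) * ε₁ + ENNReal.ofReal (4 * b ^ 2) * ε₂ + C * ε₃ := by
        rw [mul_comm C]
        gcongr
        exact hmass ν
    _ ≤ ε / 3 + ε / 3 + ε / 3 := by gcongr
    _ = ε := ENNReal.add_thirds ε

/-! ### Orthogonally invariant random vectors -/

/-- Only row `i` is prescribed, as a unit vector in the plane of `i` and `k`; any orthogonal matrix
with that row serves. -/
theorem exists_orthogonal_plane {p : ℕ} {i k : Fin p} (hik : i ≠ k) (θ : ℝ) :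
    ∃ R : Matrix.orthogonalGroup (Fin p) ℝ, ∀ f : Fin p → ℝ,
      ∑ m, R.1 i m * f m = Real.cos θ * f i + Real.sin θ * f k := by
  let w : Fin p → ℝ := fun m => (if m = i then Real.cos θ else 0) + (if m = k then Real.sin θ else 0)
  have hw : ∀ f : Fin p → ℝ, ∑ m, w m * f m = Real.cos θ * f i + Real.sin θ * f k := by
    intro f
    simp [w, add_mul, Finset.sum_add_distrib]
  obtain ⟨O, hO⟩ := exists_orthogonal_of_gram_eq (fun (_ : Unit) => w)
    (fun _ m => if m = i then (1 : ℝ) else 0) (by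
      intro _ _
      rw [hw]
      simp [w, hik, hik.symm]
      nlinarith [Real.sin_sq_add_cos_sq θ])
  refine ⟨O, fun f => ?_⟩
  rw [← hw]
  refine Finset.sum_congr rfl fun m _ => ?_
  rw [hO () m]
  simp

section Invariant

variable {T : Type*} {p : ℕ} {M : Measure (Fin p → T → ℝ)}

theorem map_perm_eq_self (hinv : ∀ R, M.map (leftMul R) = M) (σ : Equiv.Perm (Fin p)) :
    M.map (fun h i => h (σ i)) = M := by
  have : (fun (h : Fin p → T → ℝ) i => h (σ i)) = leftMul (orthPerm σ) := by
    ext h i u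
    rw [leftMul, sum_orthPerm σ i fun k => h k u]
  rw [this, hinv]

variable [IsProbabilityMeasure M]

/-- The probability is unchanged when channel `i` is rotated towards channel `k` by any angle, so it
may be integrated over the angle; Tonelli then exchanges the order. -/
theorem two_pi_mul_measure_eq (hinv : ∀ R, M.map (leftMul R) = M) {i k : Fin p} (hik : i ≠ k) (u : T)
    {A : Set ℝ} (hA : MeasurableSet A) :
    ENNReal.ofReal (2 * Real.pi) * M {h | h i u ∈ A} = ∫⁻ h, volume
      {θ ∈ Set.Ioo 0 (2 * Real.pi) | Real.cos θ * h i u + Real.sin θ * h k u ∈ A} ∂M := by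
  let S : Set ((Fin p → T → ℝ) × ℝ) := {z | Real.cos z.2 * z.1 i u + Real.sin z.2 * z.1 k u ∈ A}
  have hSm : MeasurableSet S := by
    have : Measurable fun z : (Fin p → T → ℝ) × ℝ =>
        Real.cos z.2 * z.1 i u + Real.sin z.2 * z.1 k u := by fun_prop
    exact this hA
  have hm : MeasurableSet {h : Fin p → T → ℝ | h i u ∈ A} := by
    have : Measurable fun h : Fin p → T → ℝ => h i u := by fun_prop
    exact this hA
  have h1 := Measure.prod_apply (μ := M)
    (ν := volume.restrict (Set.Ioo (0 : ℝ) (2 * Real.pi))) hSm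
  have h2 := Measure.prod_apply_symm (μ := M)
    (ν := volume.restrict (Set.Ioo (0 : ℝ) (2 * Real.pi))) hSm
  have h3 : ∀ θ, M ((fun h => (h, θ)) ⁻¹' S) = M {h | h i u ∈ A} := by
    intro θ
    obtain ⟨R, hR⟩ := exists_orthogonal_plane hik θ
    conv_rhs => rw [← hinv R, Measure.map_apply (measurable_leftMul R) hm]
    congr 1
    ext h
    simp only [S, Set.mem_preimage, Set.mem_ofPred_eq, leftMul, hR fun m => h m u]
  simp_rw [h3] at h2
  rw [lintegral_const, Measure.restrict_apply_univ, Real.volume_Ioo, sub_zero] at h2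
  rw [mul_comm, ← h2, h1]
  refine lintegral_congr fun h => ?_
  rw [Measure.restrict_apply (measurable_prodMk_left hSm), Set.inter_comm]
  rfl

/-- For a fixed `h`, the rotated coordinate is `ρ` times a shifted cosine, with `ρ` the length of
the pair of channels. If `|h i u| ≥ η` then `ρ ≥ η`, so rescaling `A` by `ρ⁻¹` enlarges its volume
by at most `η⁻¹` and `cosLaw` gives it mass below `ε`. -/
theorem measure_mem_le_add (hinv : ∀ R, M.map (leftMul R) = M) {i k : Fin p} (hik : i ≠ k) (u : T)
    {A : Set ℝ} (hA : MeasurableSet A) {ε δ : ENNReal} (hδ : ∀ A', volume A' < δ → cosLaw A' < ε)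
    {η : ℝ} (hη : 0 < η) (hvol : ENNReal.ofReal η⁻¹ * volume A < δ) :
    M {h | h i u ∈ A} ≤ M {h | |h i u| < η} + ε := by
  have hpi : (1 : ENNReal) ≤ ENNReal.ofReal (2 * Real.pi) := by
    rw [← ENNReal.ofReal_one]
    exact ENNReal.ofReal_le_ofReal (by linarith [Real.pi_gt_three])
  have hm : MeasurableSet {h : Fin p → T → ℝ | |h i u| < η} :=
    measurableSet_lt (by fun_prop) measurable_const
  have hpt : ∀ h : Fin p → T → ℝ, volume
      {θ ∈ Set.Ioo 0 (2 * Real.pi) | Real.cos θ * h i u + Real.sin θ * h k u ∈ A}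
      ≤ {h | |h i u| < η}.indicator (fun _ => ENNReal.ofReal (2 * Real.pi)) h + ε := by
    intro h
    by_cases hh : |h i u| < η
    · rw [Set.indicator_of_mem (by exact hh)]
      refine le_trans (measure_mono (Set.sep_subset _ _)) ?_
      rw [Real.volume_Ioo, sub_zero]
      exact le_self_add
    · refine le_trans (volume_angle_le_cosLaw hA) (le_trans (hδ _ ?_).le le_add_self)
      push Not at hh
      set ρ := √(h i u ^ 2 + h k u ^ 2)
      have hρ : η ≤ ρ := hh.trans (Real.abs_le_sqrt (by nlinarith [sq_nonneg (h k u)]))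
      have hρ0 : 0 < ρ := by linarith
      rw [Real.volume_preimage_mul_left hρ0.ne', abs_of_pos (inv_pos.mpr hρ0)]
      refine lt_of_le_of_lt ?_ hvol
      gcongr
  have h1 := two_pi_mul_measure_eq hinv hik u hA
  have h2 : ENNReal.ofReal (2 * Real.pi) * M {h | h i u ∈ A}
      ≤ ENNReal.ofReal (2 * Real.pi) * (M {h | |h i u| < η} + ε) := by
    rw [h1]
    refine (lintegral_mono hpt).trans ?_
    rw [lintegral_add_right _ measurable_const, lintegral_indicator_const hm, mul_add]
    gcongr
    simp only [lintegral_const, measure_univ, mul_one]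
    exact le_mul_of_one_le_left zero_le hpi
  exact (ENNReal.mul_le_mul_iff_right (zero_lt_one.trans_le hpi).ne' ENNReal.ofReal_ne_top).mp h2

/-- As soon as the pair of channels is nonzero, almost no angle brings the rotated coordinate into a
null set. -/
theorem measure_mem_null_le (hinv : ∀ R, M.map (leftMul R) = M) {i k : Fin p} (hik : i ≠ k) (u : T)
    {Z : Set ℝ} (hZm : MeasurableSet Z) (hZ : volume Z = 0) :
    M {h | h i u ∈ Z} ≤ M {h | (h i u = 0 ∧ h k u = 0) ∧ (0 : ℝ) ∈ Z} := by
  have hpi : ENNReal.ofReal (2 * Real.pi) ≠ 0 := by simp [Real.pi_pos]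
  have hm : MeasurableSet {h : Fin p → T → ℝ | (h i u = 0 ∧ h k u = 0) ∧ (0 : ℝ) ∈ Z} := by
    by_cases h0 : (0 : ℝ) ∈ Z
    · simp only [h0, and_true]
      exact (measurableSet_eq_fun (by fun_prop) measurable_const).inter
        (measurableSet_eq_fun (by fun_prop) measurable_const)
    · simp [h0]
  have hpt : ∀ h : Fin p → T → ℝ, volume
      {θ ∈ Set.Ioo 0 (2 * Real.pi) | Real.cos θ * h i u + Real.sin θ * h k u ∈ Z}
      ≤ {h | (h i u = 0 ∧ h k u = 0) ∧ (0 : ℝ) ∈ Z}.indicator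
        (fun _ => ENNReal.ofReal (2 * Real.pi)) h := by
    intro h
    by_cases hh : h i u = 0 ∧ h k u = 0
    · by_cases h0 : (0 : ℝ) ∈ Z
      · rw [Set.indicator_of_mem (by exact ⟨hh, h0⟩)]
        refine le_trans (measure_mono (Set.sep_subset _ _)) ?_
        rw [Real.volume_Ioo, sub_zero]
      · simp [hh, h0]
    · refine le_trans (volume_angle_le_cosLaw hZm) (le_of_eq_of_le ?_ zero_le)
      refine cosLaw_absolutelyContinuous ?_
      have hρ0 : √(h i u ^ 2 + h k u ^ 2) ≠ 0 := by
        intro hρ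
        rw [Real.sqrt_eq_zero (by positivity)] at hρ
        exact hh ⟨by nlinarith [sq_nonneg (h k u), sq_nonneg (h i u)],
          by nlinarith [sq_nonneg (h k u), sq_nonneg (h i u)]⟩
      rw [Real.volume_preimage_mul_left hρ0, hZ, mul_zero]
  have h2 : ENNReal.ofReal (2 * Real.pi) * M {h | h i u ∈ Z}
      ≤ ENNReal.ofReal (2 * Real.pi) * M {h | (h i u = 0 ∧ h k u = 0) ∧ (0 : ℝ) ∈ Z} := by
    rw [two_pi_mul_measure_eq hinv hik u hZm]
    refine (lintegral_mono hpt).trans ?_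
    rw [lintegral_indicator_const hm]
  exact (ENNReal.mul_le_mul_iff_right hpi ENNReal.ofReal_ne_top).mp h2

/-- If `Z` is null, then almost surely no coordinate lies in `Z`, unless all coordinates vanish. -/
theorem measure_exists_mem_null_le (hinv : ∀ R, M.map (leftMul R) = M) {i₀ i₁ : Fin p}
    (hi : i₀ ≠ i₁) (u : T) {Z : Set ℝ} (hZm : MeasurableSet Z) (hZ : volume Z = 0) :
    M {h | ∃ i, h i u ∈ Z} ≤ M {h | h i₀ u = 0} := by
  have hne : ∀ i : Fin p, ∃ k, i ≠ k := fun i => by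
    by_cases h : i = i₀
    · exact ⟨i₁, h ▸ hi⟩
    · exact ⟨i₀, h⟩
  have h1 : ∀ i, M {h | h i u ∈ Z \ {0}} = 0 := by
    intro i
    obtain ⟨k, hk⟩ := hne i
    refine le_antisymm ((measure_mem_null_le hinv hk u (hZm.diff (measurableSet_singleton 0))
      (measure_mono_null Set.sdiff_subset hZ)).trans ?_) zero_le
    simp
  -- The null set `{0}` shows that one channel vanishes, up to probability zero, only together with
  -- `i₀`.
  have h2 : ∀ i, i ≠ i₀ → M {h | h i u = 0 ∧ h i₀ u ≠ 0} = 0 := by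
    intro i hi0
    have h3 := measure_mem_null_le hinv hi0 u (measurableSet_singleton 0) Real.volume_singleton
    simp only [Set.mem_singleton_iff, and_true] at h3
    have h4 : {h : Fin p → T → ℝ | h i u = 0 ∧ h i₀ u ≠ 0}
        = {h | h i u = 0} \ {h | h i u = 0 ∧ h i₀ u = 0} := by
      ext h; simp; tauto
    rw [h4, measure_sdiff (fun h hh => hh.1) _ (measure_ne_top _ _)]
    · exact tsub_eq_zero_of_le h3
    · exact ((measurableSet_eq_fun (by fun_prop) measurable_const).inter
        (measurableSet_eq_fun (by fun_prop) measurable_const)).nullMeasurableSet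
  have hsub : {h : Fin p → T → ℝ | ∃ i, h i u ∈ Z} ⊆ {h | h i₀ u = 0} ∪
      ((⋃ i, {h | h i u ∈ Z \ {0}}) ∪ ⋃ i, ⋃ _ : i ≠ i₀, {h | h i u = 0 ∧ h i₀ u ≠ 0}) := by
    rintro h ⟨i, hi⟩
    by_cases h0 : h i₀ u = 0
    · exact Or.inl h0
    · right
      by_cases hi0 : h i u = 0
      · right
        have : i ≠ i₀ := fun e => h0 (e ▸ hi0)
        exact Set.mem_iUnion.mpr ⟨i, Set.mem_iUnion.mpr ⟨this, hi0, h0⟩⟩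
      · left
        exact Set.mem_iUnion.mpr ⟨i, hi, hi0⟩
  refine (measure_mono hsub).trans ((measure_union_le _ _).trans ?_)
  rw [measure_union_null (measure_iUnion_null h1)
    (measure_iUnion_null fun i => measure_iUnion_null fun hi => h2 i hi), add_zero]

end Invariant

/-! ### Consequences of convergence to Gaussian processes -/

/-- The channel `i` of `h`, or zero if there is no such channel. -/
def coord {T : Type*} {p : ℕ} (i : ℕ) (h : Fin p → T → ℝ) (u : T) : ℝ :=
  if hi : i < p then h ⟨i, hi⟩ u else 0

theorem coord_of_lt {T : Type*} {p i : ℕ} (hi : i < p) (h : Fin p → T → ℝ) (u : T) :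
    coord i h u = h ⟨i, hi⟩ u := dif_pos hi

@[fun_prop]
theorem measurable_coord {T : Type*} {p i : ℕ} (u : T) :
    Measurable fun h : Fin p → T → ℝ => coord i h u := by
  unfold coord
  by_cases hi : i < p
  · simp only [hi, dite_true]; fun_prop
  · simp only [hi, dite_false]; fun_prop

namespace AsymptoticGaussian

variable {T : Type*} {p : ℕ → ℕ} {M : ∀ ν, Measure (Fin (p ν) → T → ℝ)}
  [∀ ν, IsProbabilityMeasure (M ν)] {K : T → T → ℝ}

/-- The joint law of the first `r` channels is tested against a product function: `r = 1` gives the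
marginals, `r = 2` the asymptotic independence of two channels. -/
theorem tendsto_integral_prod (hM : AsymptoticGaussian p M K) (hp : Tendsto p atTop atTop) {D : ℕ}
    (X : Fin D → T) (r : ℕ) (G : BoundedContinuousFunction (EuclideanSpace ℝ (Fin D)) ℝ) :
    Tendsto (fun ν => ∫ h, ∏ i ∈ Finset.range r, G (WithLp.toLp 2 fun a => coord i h (X a)) ∂(M ν))
      atTop (𝓝 ((∫ x, G x ∂(gpMarginal K X)) ^ r)) := by
  have hI : ∀ᶠ ν in atTop, ∀ i ∈ Finset.range r, i < p ν := by
    filter_upwards [hp.eventually_ge_atTop r] with ν hν i hi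
    exact (Finset.mem_range.mp hi).trans_le hν
  have hT := hM.tendsto_iid.2 D X (Finset.range r) hI
  let F : BoundedContinuousFunction (Finset.range r → EuclideanSpace ℝ (Fin D)) ℝ :=
    BoundedContinuousFunction.ofNormedAddCommGroup (fun x => ∏ i, G (x i)) (by fun_prop)
      (‖G‖ ^ r) (fun x => by
        rw [norm_prod]
        refine (Finset.prod_le_prod (fun _ _ => norm_nonneg _)
          fun i _ => G.norm_coe_le_norm (x i)).trans ?_
        simp)
  have hF : ∀ x, F x = ∏ i, G (x i) := fun x => rfl
  have h1 := ProbabilityMeasure.tendsto_iff_forall_integral_tendsto.mp hT.tendsto F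
  simp only [ProbabilityMeasure.coe_mk] at h1
  have h2 : ∫ x, F x ∂((Measure.pi fun _ : Finset.range r => gpMarginal K X).map id)
      = (∫ x, G x ∂(gpMarginal K X)) ^ r := by
    rw [Measure.map_id]
    simp_rw [hF]
    rw [integral_fintype_prod_eq_prod (𝕜 := ℝ) (fun _ x => G x)]
    simp
  rw [h2] at h1
  refine h1.congr fun ν => ?_
  rw [integral_map (hT.forall_aemeasurable ν) F.continuous.aestronglyMeasurable]
  refine integral_congr_ae (.of_forall fun h => ?_)
  simp only [hF]
  exact Finset.prod_coe_sort (Finset.range r)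
    (fun i => G (WithLp.toLp 2 fun a => coord i h (X a)))

theorem diag_nonneg (hM : AsymptoticGaussian p M K) (u : T) : 0 ≤ K u u := by
  have := (hM.tendsto_iid.1 1 fun _ => u).diag_nonneg (i := 0)
  simpa [kernelMatrix] using this

theorem tendsto_integral_coord (hM : AsymptoticGaussian p M K) (hp : Tendsto p atTop atTop) (u : T)
    (f : BoundedContinuousFunction ℝ ℝ) :
    Tendsto (fun ν => ∫ h, f (coord 0 h u) ∂(M ν)) atTop
      (𝓝 (∫ x, f x ∂(gaussianReal 0 (K u u).toNNReal))) := by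
  have h := hM.tendsto_integral_prod hp (fun _ : Fin 1 => u) 1
    (f.compContinuous ⟨fun x => x 0, by fun_prop⟩)
  simp only [Finset.range_one, Finset.prod_singleton, pow_one,
    BoundedContinuousFunction.compContinuous_apply, ContinuousMap.coe_mk] at h
  have hmp := measurePreserving_eval_multivariateGaussian (μ := 0)
    (hM.tendsto_iid.1 1 fun _ => u) (i := 0)
  have h2 : ∫ x, f x ∂(gaussianReal 0 (K u u).toNNReal)
      = ∫ x, f (x 0) ∂(gpMarginal K fun _ : Fin 1 => u) := by
    have h3 := hmp.map_eq
    simp only [kernelMatrix, Matrix.of_apply, PiLp.zero_apply] at h3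
    rw [← h3, integral_map hmp.measurable.aemeasurable f.continuous.aestronglyMeasurable]
    rfl
  rw [h2]
  exact h

/-- A nondegenerate Gaussian has no atom at `0`, so some ball of radius `r` has small limiting mass.
A continuous function equal to one for `|x| ≤ r / 2` and to zero for `|x| ≥ r` transfers this to the
sequence. -/
theorem exists_small_ball (hM : AsymptoticGaussian p M K) (hp : Tendsto p atTop atTop) {u : T}
    (hu : K u u ≠ 0) {ε : ENNReal} (hε : ε ≠ 0) :
    ∃ η : ℝ, 0 < η ∧ ∀ᶠ ν in atTop, M ν {h | |coord 0 h u| < η} ≤ ε := by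
  wlog hεt : ε ≠ ⊤ generalizing ε
  · exact ⟨1, one_pos, .of_forall fun ν => by simp [not_not.mp hεt]⟩
  set γ := gaussianReal 0 (K u u).toNNReal
  have hv : (K u u).toNNReal ≠ 0 := by
    simpa using lt_of_le_of_ne (hM.diag_nonneg u) hu.symm
  have : NullSingletonClass γ := nullSingletonClass_gaussianReal hv
  obtain ⟨U, hU0, hUo, hUε⟩ := Set.exists_isOpen_lt_of_lt ({0} : Set ℝ) ε
    (μ := γ) (by rw [measure_singleton]; exact pos_iff_ne_zero.mpr hε)
  obtain ⟨r, hr, hball⟩ := Metric.isOpen_iff.mp hUo 0 (hU0 rfl)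
  let f : BoundedContinuousFunction ℝ ℝ := BoundedContinuousFunction.ofNormedAddCommGroup
    (fun x => max 0 (min 1 (2 - |x| / (r / 2)))) (by fun_prop) 1 (fun x => by
      rw [Real.norm_eq_abs, abs_of_nonneg (le_max_left _ _)]
      exact max_le zero_le_one (min_le_left _ _))
  have hf : ∀ x, f x = max 0 (min 1 (2 - |x| / (r / 2))) := fun x => rfl
  have hf0 : ∀ x, 0 ≤ f x := fun x => le_max_left _ _
  have hf1 : ∀ x, f x ≤ 1 := fun x => max_le zero_le_one (min_le_left _ _)
  have hfint : ∀ (μ : Measure ℝ) [IsFiniteMeasure μ], Integrable f μ := fun μ _ => f.integrable μ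
  have hlt : ∫ x, f x ∂γ < ε.toReal := by
    refine lt_of_le_of_lt ?_ ((ENNReal.toReal_lt_toReal (measure_ne_top _ _) hεt).mpr hUε)
    rw [← measureReal_def, ← integral_indicator_one hUo.measurableSet]
    refine integral_mono (hfint γ) ((integrable_const 1).indicator hUo.measurableSet) fun x => ?_
    by_cases hx : x ∈ U
    · simp only [Set.indicator_of_mem hx, Pi.one_apply]; exact hf1 x
    · rw [Set.indicator_of_notMem hx, hf]
      refine max_le le_rfl ((min_le_right _ _).trans ?_)
      have : r ≤ |x| := by
        by_contra! h
        exact hx (hball (by simpa using h))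
      rw [sub_nonpos, le_div_iff₀ (by linarith)]
      linarith
  refine ⟨r / 2, by linarith, ?_⟩
  filter_upwards [(hM.tendsto_integral_coord hp u f).eventually_lt_const hlt] with ν hν
  have hm : MeasurableSet {h : Fin (p ν) → T → ℝ | |coord 0 h u| < r / 2} :=
    measurableSet_lt (by fun_prop) measurable_const
  have h1 : (M ν).real {h | |coord 0 h u| < r / 2} ≤ ∫ h, f (coord 0 h u) ∂(M ν) := by
    rw [← integral_indicator_one hm]
    refine integral_mono ((integrable_const 1).indicator hm) ?_ fun h => ?_
    · exact Integrable.of_bound (f.continuous.measurable.comp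
        (measurable_coord u)).aestronglyMeasurable 1 (.of_forall fun h => by
          rw [Real.norm_eq_abs, abs_of_nonneg (hf0 _)]; exact hf1 _)
    · by_cases hh : |coord 0 h u| < r / 2
      · rw [Set.indicator_of_mem (by exact hh), hf]
        refine le_max_of_le_right (le_min le_rfl ?_)
        have : |coord 0 h u| / (r / 2) ≤ 1 := by rw [div_le_one (by linarith)]; exact hh.le
        simp only [Pi.one_apply]
        linarith
      · rw [Set.indicator_of_notMem (by exact hh)]; exact hf0 _
  rw [← ENNReal.toReal_le_toReal (measure_ne_top _ _) hεt]
  exact h1.trans hν.le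

end AsymptoticGaussian

/-! ### Tameness of the one-dimensional marginals -/

/-- Truncated squares `min (x²) n` converge by weak convergence and full squares by hypothesis, so
the excess `x² - min (x²) n` is eventually small in mean. Where `x² > 2n`, twice the excess
dominates `x²`; hence the radius `√(2n)`. -/
theorem exists_tail_le_of_tendsto {μ : ℕ → Measure ℝ} [∀ ν, IsProbabilityMeasure (μ ν)]
    {γ : Measure ℝ} [IsProbabilityMeasure γ]
    (hweak : ∀ f : BoundedContinuousFunction ℝ ℝ,
      Tendsto (fun ν => ∫ x, f x ∂(μ ν)) atTop (𝓝 (∫ x, f x ∂γ)))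
    (hInt : ∀ᶠ ν in atTop, Integrable (fun x => x ^ 2) (μ ν)) (hIntγ : Integrable (fun x => x ^ 2) γ)
    (hsq : Tendsto (fun ν => ∫ x, x ^ 2 ∂(μ ν)) atTop (𝓝 (∫ x, x ^ 2 ∂γ)))
    {ε : ENNReal} (hε : ε ≠ 0) :
    ∃ R : ℝ, 1 ≤ R ∧ ∀ᶠ ν in atTop,
      ∫⁻ x in {x | R < |x|}, ENNReal.ofReal (x ^ 2) ∂(μ ν) ≤ ε := by
  wlog hεt : ε ≠ ⊤ generalizing ε
  · exact ⟨1, le_rfl, .of_forall fun ν => by simp [not_not.mp hεt]⟩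
  have hε0 : 0 < ε.toReal / 2 := half_pos (ENNReal.toReal_pos hε hεt)
  let f : ℕ → BoundedContinuousFunction ℝ ℝ := fun n =>
    BoundedContinuousFunction.ofNormedAddCommGroup (fun x : ℝ => min (x ^ 2) n) (by fun_prop) n
      (fun x => by
        rw [Real.norm_eq_abs, abs_of_nonneg (le_min (sq_nonneg x) (Nat.cast_nonneg n))]
        exact min_le_right _ _)
  have hf : ∀ n x, f n x = min (x ^ 2) n := fun n x => rfl
  have hlim : Tendsto (fun n => ∫ x, f n x ∂γ) atTop (𝓝 (∫ x, x ^ 2 ∂γ)) := by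
    refine tendsto_integral_of_dominated_convergence (fun x => x ^ 2)
      (fun n => (f n).continuous.aestronglyMeasurable) hIntγ (fun n => .of_forall fun x => ?_)
      (.of_forall fun x => ?_)
    · rw [hf, Real.norm_eq_abs, abs_of_nonneg (le_min (sq_nonneg x) (Nat.cast_nonneg n))]
      exact min_le_left _ _
    · refine tendsto_const_nhds.congr' ?_
      filter_upwards [eventually_ge_atTop ⌈x ^ 2⌉₊] with n hn
      rw [hf, min_eq_left (Nat.ceil_le.mp hn)]
  obtain ⟨n, hn1, hn⟩ := ((eventually_ge_atTop 1).and
    (hlim.eventually_const_lt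
      (show (∫ x, x ^ 2 ∂γ) - ε.toReal / 2 < ∫ x, x ^ 2 ∂γ by linarith))).exists
  have hlim2 := hsq.sub (hweak (f n))
  have hn0 : (1 : ℝ) ≤ n := by exact_mod_cast hn1
  refine ⟨√(2 * n), Real.one_le_sqrt.mpr (by linarith), ?_⟩
  filter_upwards [hInt, hlim2.eventually_lt_const
    (show ∫ x, x ^ 2 ∂γ - ∫ x, f n x ∂γ < ε.toReal / 2 by linarith)] with ν hν hlt
  have hm : MeasurableSet {x : ℝ | √(2 * n) < |x|} :=
    measurableSet_lt measurable_const (by fun_prop)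
  have hdint : Integrable (fun x => 2 * (x ^ 2 - f n x)) (μ ν) :=
    (hν.sub ((f n).integrable _)).const_mul 2
  rw [← integral_sub hν ((f n).integrable _)] at hlt
  calc ∫⁻ x in {x | √(2 * n) < |x|}, ENNReal.ofReal (x ^ 2) ∂(μ ν)
      ≤ ∫⁻ x, ENNReal.ofReal (2 * (x ^ 2 - f n x)) ∂(μ ν) := by
        rw [← lintegral_indicator hm]
        refine lintegral_mono fun x => ?_
        by_cases hx : √(2 * n) < |x|
        · rw [Set.indicator_of_mem (by exact hx)]
          refine ENNReal.ofReal_le_ofReal ?_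
          have h1 : 2 * (n : ℝ) < x ^ 2 := by
            rw [← sq_abs]
            exact (Real.sqrt_lt' (by linarith [Real.sqrt_nonneg (2 * (n : ℝ))])).mp hx
          have h2 : f n x ≤ n := min_le_right _ _
          linarith
        · rw [Set.indicator_of_notMem (by exact hx)]
          exact zero_le
    _ = ENNReal.ofReal (∫ x, 2 * (x ^ 2 - f n x) ∂(μ ν)) := by
        rw [ofReal_integral_eq_lintegral_ofReal hdint (.of_forall fun x => ?_)]
        have : f n x ≤ x ^ 2 := min_le_left _ _
        simp only [Pi.zero_apply]
        linarith
    _ ≤ ENNReal.ofReal ε.toReal := by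
        rw [integral_const_mul]
        exact ENNReal.ofReal_le_ofReal (by linarith)
    _ = ε := ENNReal.ofReal_toReal hεt

theorem integrable_sq_gaussianReal (v : NNReal) : Integrable (fun x => x ^ 2) (gaussianReal 0 v) :=
  (memLp_id_gaussianReal (μ := 0) (v := v) 2).integrable_sq

theorem integral_sq_gaussianReal (v : NNReal) : ∫ x, x ^ 2 ∂(gaussianReal 0 v) = v := by
  have h := variance_fun_id_gaussianReal (μ := 0) (v := v)
  rw [variance_eq_sub (X := fun x : ℝ => x) (memLp_id_gaussianReal 2)] at h
  simpa using h

theorem uniformlyTame_gaussianReal (v : NNReal) : UniformlyTame fun _ => gaussianReal 0 v := by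
  refine ⟨⟨1, ENNReal.one_ne_top, fun _ => by simp⟩, fun ε hε => ?_, fun ε hε => ?_⟩
  · exact exists_tail_le_of_tendsto (fun f => tendsto_const_nhds)
      (.of_forall fun _ => integrable_sq_gaussianReal v) (integrable_sq_gaussianReal v)
      tendsto_const_nhds hε
  · rcases eq_or_ne v 0 with rfl | hv
    · refine ⟨1, one_ne_zero, fun A hA _ h0 => .of_forall fun _ => ?_⟩
      rw [gaussianReal_zero_var, Measure.dirac_apply' _ hA]
      simp [h0]
    · obtain ⟨δ, hδ, H⟩ := (gaussianReal_absolutelyContinuous 0 hv).exists_pos_forall_lt hε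
      obtain ⟨δ', hδ', hlt⟩ := ENNReal.lt_iff_exists_nnreal_btwn.mp hδ
      refine ⟨δ', hδ'.ne', fun A _ hA _ => .of_forall fun _ => (H A (hA.trans_lt hlt)).le⟩

namespace AsymptoticGaussian

variable {T : Type*} {p : ℕ → ℕ} {M : ∀ ν, Measure (Fin (p ν) → T → ℝ)}
  [∀ ν, IsProbabilityMeasure (M ν)] {K : T → T → ℝ}

theorem integrable_coord_sq (hM : AsymptoticGaussian p M K) (ν : ℕ) (i : ℕ) (u : T) :
    Integrable (fun h => coord i h u ^ 2) (M ν) := by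
  by_cases hi : i < p ν
  · simp only [coord_of_lt hi]; exact hM.integrable_sq ν _ u
  · simp [coord, hi]

theorem tendsto_integral_coord_sq (hM : AsymptoticGaussian p M K) (hp : Tendsto p atTop atTop)
    (u : T) : Tendsto (fun ν => ∫ h, coord 0 h u ^ 2 ∂(M ν)) atTop (𝓝 (K u u)) := by
  obtain ⟨s, hs, H⟩ := hM.tendsto_sq u
  refine hs.congr' ?_
  filter_upwards [hp.eventually_gt_atTop 0] with ν hν
  simp only [coord_of_lt hν, H]

theorem uniformlyTame_coord (hM : AsymptoticGaussian p M K) (hp : Tendsto p atTop atTop) (u : T) :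
    UniformlyTame fun ν => (M ν).map fun h => coord 0 h u := by
  have hcm : ∀ ν, Measurable fun h : Fin (p ν) → T → ℝ => coord 0 h u := fun ν => by fun_prop
  have : ∀ ν, IsProbabilityMeasure ((M ν).map fun h => coord 0 h u) := fun ν =>
    Measure.isProbabilityMeasure_map (hcm ν).aemeasurable
  have hsqm : ∀ ν, AEStronglyMeasurable (fun x : ℝ => x ^ 2) ((M ν).map fun h => coord 0 h u) :=
    fun ν => Measurable.aestronglyMeasurable (by fun_prop)
  refine ⟨⟨1, ENNReal.one_ne_top, fun ν => by simp⟩, fun ε hε => ?_, fun ε hε => ?_⟩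
  · refine exists_tail_le_of_tendsto (γ := gaussianReal 0 (K u u).toNNReal) (fun f => ?_)
      (.of_forall fun ν => ?_) (integrable_sq_gaussianReal _) ?_ hε
    · refine (hM.tendsto_integral_coord hp u f).congr fun ν => ?_
      rw [integral_map (hcm ν).aemeasurable f.continuous.aestronglyMeasurable]
    · rw [integrable_map_measure (hsqm ν) (hcm ν).aemeasurable]
      exact hM.integrable_coord_sq ν 0 u
    · rw [integral_sq_gaussianReal, Real.coe_toNNReal _ (hM.diag_nonneg u)]
      refine (hM.tendsto_integral_coord_sq hp u).congr fun ν => ?_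
      rw [integral_map (hcm ν).aemeasurable (hsqm ν)]
  · by_cases hu : K u u = 0
    -- Degenerate case: a set avoiding `0` is reached only when the layer does not vanish at `u`,
    -- which has probability tending to zero.
    · refine ⟨1, one_ne_zero, fun A hA _ h0 => ?_⟩
      have h1 := (ENNReal.tendsto_toReal_zero_iff fun ν => measure_ne_top (M ν) _).mp
        (hM.tendsto_support u hu)
      filter_upwards [h1.eventually_le_const (pos_iff_ne_zero.mpr hε),
        hp.eventually_gt_atTop 0] with ν hν hpν
      rw [Measure.map_apply (hcm ν) hA]
      refine (measure_mono fun h hh => ?_).trans hν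
      refine ⟨⟨0, hpν⟩, fun h2 => h0 ?_⟩
      rw [← coord_of_lt hpν h u] at h2
      rw [← h2]
      exact hh
    · have hε2 : ε / 2 ≠ 0 := by simpa using hε
      obtain ⟨η, hη, hsmall⟩ := hM.exists_small_ball hp hu hε2
      obtain ⟨δ, hδ, H⟩ := cosLaw_absolutelyContinuous.exists_pos_forall_lt hε2
      obtain ⟨δ', hδ', hlt⟩ := ENNReal.lt_iff_exists_nnreal_btwn.mp hδ
      -- The factor `η` compensates the dilation by at most `η⁻¹` in `measure_mem_le_add`.
      refine ⟨ENNReal.ofReal η * δ', mul_ne_zero (by simpa using hη) hδ'.ne', fun A hA hvol _ => ?_⟩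
      filter_upwards [hsmall, hp.eventually_gt_atTop 1] with ν hν hpν
      rw [Measure.map_apply (hcm ν) hA, ← ENNReal.add_halves ε]
      have h0 : 0 < p ν := by omega
      have h1 := measure_mem_le_add (hM.map_leftMul ν)
        (i := ⟨0, h0⟩) (k := ⟨1, hpν⟩) (by simp) u hA H hη (by
          refine lt_of_le_of_lt (mul_le_mul_right hvol _) ?_
          rw [← mul_assoc, ← ENNReal.ofReal_mul (by positivity), inv_mul_cancel₀ hη.ne',
            ENNReal.ofReal_one, one_mul]
          exact hlt)
      simp only [← coord_of_lt h0] at h1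
      exact h1.trans (add_le_add_left hν _)

end AsymptoticGaussian

/-! ### Exchangeability and the law of large numbers -/

section Invariant

variable {T : Type*} {p : ℕ} {M : Measure (Fin p → T → ℝ)}

theorem integral_comp_perm (hinv : ∀ R, M.map (leftMul R) = M) (σ : Equiv.Perm (Fin p))
    {f : (Fin p → T → ℝ) → ℝ} (hf : Measurable f) :
    ∫ h, f (fun i => h (σ i)) ∂M = ∫ h, f h ∂M := by
  conv_rhs => rw [← map_perm_eq_self hinv σ]
  rw [integral_map (measurable_pi_lambda _ fun i => measurable_pi_apply (σ i)).aemeasurable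
    hf.aestronglyMeasurable]

theorem integral_channel_eq (hinv : ∀ R, M.map (leftMul R) = M) {X : (T → ℝ) → ℝ}
    (hX : Measurable X) (i j : Fin p) : ∫ h, X (h i) ∂M = ∫ h, X (h j) ∂M := by
  have := integral_comp_perm hinv (Equiv.swap j i) (f := fun h => X (h j)) (by fun_prop)
  simpa using this

theorem integral_channel_mul_eq (hinv : ∀ R, M.map (leftMul R) = M) {X : (T → ℝ) → ℝ}
    (hX : Measurable X) {i j i₀ i₁ : Fin p} (hij : i ≠ j) (h01 : i₀ ≠ i₁) :
    ∫ h, X (h i) * X (h j) ∂M = ∫ h, X (h i₀) * X (h i₁) ∂M := by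
  -- The first swap sends `i₀` to `i`; the second sends the image of `i₁` to `j` and fixes `i`.
  let τ := Equiv.swap (Equiv.swap i₀ i i₁) j * Equiv.swap i₀ i
  have h0 : τ i₀ = i := by
    have : Equiv.swap i₀ i i₁ ≠ i := fun h => h01 ((Equiv.swap i₀ i).injective
      (by rw [h, Equiv.swap_apply_left]))
    simp only [τ, Equiv.Perm.mul_apply, Equiv.swap_apply_left]
    exact Equiv.swap_apply_of_ne_of_ne this.symm hij
  have h1 : τ i₁ = j := by
    simp only [τ, Equiv.Perm.mul_apply, Equiv.swap_apply_left]
  have := integral_comp_perm hinv τ (f := fun h => X (h i₀) * X (h i₁)) (by fun_prop)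
  simpa only [h0, h1] using this

/-- In the expanded second moment, the `p` diagonal terms are at most `C²` each, and by
exchangeability all off-diagonal terms are equal. -/
theorem integral_abs_average_le [IsProbabilityMeasure M] (hinv : ∀ R, M.map (leftMul R) = M)
    {X : (T → ℝ) → ℝ} (hX : Measurable X) {C : ℝ} (hC : ∀ f, |X f| ≤ C) {i₀ i₁ : Fin p}
    (h01 : i₀ ≠ i₁) :
    ∫ h, |(p : ℝ)⁻¹ * ∑ j, X (h j)| ∂M ≤ √(C ^ 2 / p + |∫ h, X (h i₀) * X (h i₁) ∂M|) := by
  have hp : (0 : ℝ) < p := by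
    have : 0 < p := i₀.pos
    exact_mod_cast this
  set a := ∫ h, X (h i₀) * X (h i₁) ∂M
  have hXi : ∀ j, Measurable fun h : Fin p → T → ℝ => X (h j) := fun j => by fun_prop
  have hL : ∀ j, MemLp (fun h : Fin p → T → ℝ => X (h j)) 2 M := fun j =>
    MemLp.of_bound (hXi j).aestronglyMeasurable C (.of_forall fun h => hC _)
  have hA : MemLp (fun h : Fin p → T → ℝ => (p : ℝ)⁻¹ * ∑ j, X (h j)) 2 M :=
    (memLp_finsetSum _ fun j _ => hL j).const_mul _
  have hle : (∫ h, |(p : ℝ)⁻¹ * ∑ j, X (h j)| ∂M) ^ 2 ≤ ∫ h, ((p : ℝ)⁻¹ * ∑ j, X (h j)) ^ 2 ∂M := by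
    have := variance_nonneg (fun h : Fin p → T → ℝ => |(p : ℝ)⁻¹ * ∑ j, X (h j)|) M
    rw [variance_eq_sub (X := fun h : Fin p → T → ℝ => |(p : ℝ)⁻¹ * ∑ j, X (h j)|) hA.abs] at this
    simp only [Pi.pow_apply, sq_abs] at this
    linarith
  refine Real.le_sqrt_of_sq_le (hle.trans ?_)
  have hInt : ∀ j k, Integrable (fun h : Fin p → T → ℝ => X (h j) * X (h k)) M := fun j k =>
    (hL j).integrable_mul (hL k)
  have hexp : ∀ h : Fin p → T → ℝ, ((p : ℝ)⁻¹ * ∑ j, X (h j)) ^ 2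
      = ((p : ℝ)⁻¹) ^ 2 * ∑ j, ∑ k, X (h j) * X (h k) := by
    intro h
    rw [mul_pow, sq (∑ j, X (h j)), Finset.sum_mul_sum]
  simp_rw [hexp]
  rw [integral_const_mul, integral_finsetSum _ fun j _ => integrable_finsetSum _ fun k _ => hInt j k]
  have hterm : ∀ j k, ∫ h, X (h j) * X (h k) ∂M ≤ (if j = k then C ^ 2 else 0) + |a| := by
    intro j k
    by_cases hjk : j = k
    · subst hjk
      rw [if_pos rfl]
      have : ∫ h, X (h j) * X (h j) ∂M ≤ ∫ _h : Fin p → T → ℝ, C ^ 2 ∂M :=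
        integral_mono (hInt j j) (integrable_const _) fun h => by
          simp only
          rw [← sq, ← sq_abs]
          gcongr
          exact hC _
      simp only [integral_const, probReal_univ, one_smul] at this
      linarith [abs_nonneg a]
    · rw [if_neg hjk, zero_add, integral_channel_mul_eq hinv hX hjk h01]
      exact le_abs_self a
  calc ((p : ℝ)⁻¹) ^ 2 * ∑ j, ∫ h, ∑ k, X (h j) * X (h k) ∂M
      ≤ ((p : ℝ)⁻¹) ^ 2 * ∑ j : Fin p, ∑ k : Fin p, ((if j = k then C ^ 2 else 0) + |a|) := by
        gcongr with j
        rw [integral_finsetSum _ fun k _ => hInt j k]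
        exact Finset.sum_le_sum fun k _ => hterm j k
    _ = C ^ 2 / p + |a| := by
        simp [Finset.sum_add_distrib]
        field_simp

end Invariant

/-- Young's inequality with weight `r`, applied to `b(a - a') + a(b - b') - (a - a')(b - b')`. The
right side contains squares of `a` and `b` only, so no moment bound on the approximants `a'` and
`b'` is needed. -/
theorem abs_mul_sub_mul_le {a b a' b' r : ℝ} (hr : 0 < r) :
    |a * b - a' * b'| ≤ r / 2 * (a ^ 2 + b ^ 2)
      + (1 / (2 * r) + 1 / 2) * ((a - a') ^ 2 + (b - b') ^ 2) := by
  have key : ∀ x y : ℝ, |x * y| ≤ r / 2 * x ^ 2 + 1 / (2 * r) * y ^ 2 := by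
    intro x y
    have h1 : r / 2 * x ^ 2 + 1 / (2 * r) * y ^ 2 - |x * y| = (r * |x| - |y|) ^ 2 / (2 * r) := by
      rw [abs_mul, sub_sq, mul_pow, sq_abs, sq_abs]
      field_simp
      ring
    have h2 : 0 ≤ (r * |x| - |y|) ^ 2 / (2 * r) := by positivity
    linarith
  have h1 := key b (a - a')
  have h2 := key a (b - b')
  have h3 : |(a - a') * (b - b')| ≤ 1 / 2 * ((a - a') ^ 2 + (b - b') ^ 2) := by
    rw [abs_le]
    constructor <;> nlinarith [sq_nonneg ((a - a') + (b - b')), sq_nonneg ((a - a') - (b - b'))]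
  have h4 : a * b - a' * b' = b * (a - a') + a * (b - b') - (a - a') * (b - b') := by ring
  rw [h4]
  have h5 := abs_sub (b * (a - a') + a * (b - b')) ((a - a') * (b - b'))
  have h6 := abs_add_le (b * (a - a')) (a * (b - b'))
  linarith

/-! ### Activations of linear growth -/

section Activation

variable {φ : ℝ → ℝ} {c m : ℝ}

theorem sq_le_of_linear_growth (hlin : ∀ x, |φ x| ≤ c + m * |x|) (x : ℝ) :
    φ x ^ 2 ≤ 2 * c ^ 2 + 2 * m ^ 2 * x ^ 2 := by
  have h := hlin x
  have h2 : φ x ^ 2 ≤ (c + m * |x|) ^ 2 := by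
    rw [← sq_abs]
    gcongr
  have h3 : (m * |x|) ^ 2 = m ^ 2 * x ^ 2 := by rw [mul_pow, sq_abs]
  nlinarith [sq_nonneg (c - m * |x|)]

theorem integrable_sq_comp {Ω : Type*} [MeasurableSpace Ω] {P : Measure Ω} [IsProbabilityMeasure P]
    (hφ : Measurable φ) (hlin : ∀ x, |φ x| ≤ c + m * |x|) {X : Ω → ℝ} (hX : Measurable X)
    (hInt : Integrable (fun ω => X ω ^ 2) P) : Integrable (fun ω => φ (X ω) ^ 2) P := by
  refine Integrable.mono' ((integrable_const (2 * c ^ 2)).add (hInt.const_mul (2 * m ^ 2)))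
    (Measurable.aestronglyMeasurable (by fun_prop)) (.of_forall fun ω => ?_)
  rw [Real.norm_eq_abs, abs_of_nonneg (sq_nonneg _)]
  exact sq_le_of_linear_growth hlin _

theorem integral_sq_comp_le {Ω : Type*} [MeasurableSpace Ω] {P : Measure Ω} [IsProbabilityMeasure P]
    (hφ : Measurable φ) (hlin : ∀ x, |φ x| ≤ c + m * |x|) {X : Ω → ℝ} (hX : Measurable X)
    (hInt : Integrable (fun ω => X ω ^ 2) P) :
    ∫ ω, φ (X ω) ^ 2 ∂P ≤ 2 * c ^ 2 + 2 * m ^ 2 * ∫ ω, X ω ^ 2 ∂P := by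
  have h := integral_mono (integrable_sq_comp hφ hlin hX hInt)
    ((integrable_const (2 * c ^ 2)).add (hInt.const_mul (2 * m ^ 2)))
    fun ω => sq_le_of_linear_growth hlin (X ω)
  refine h.trans (le_of_eq ?_)
  refine (integral_add (integrable_const _) (hInt.const_mul _)).trans ?_
  simp [integral_const_mul]

theorem integrable_mul_comp {Ω : Type*} [MeasurableSpace Ω] {P : Measure Ω} [IsProbabilityMeasure P]
    (hφ : Measurable φ) (hlin : ∀ x, |φ x| ≤ c + m * |x|) {X Y : Ω → ℝ} (hX : Measurable X)
    (hY : Measurable Y) (hXi : Integrable (fun ω => X ω ^ 2) P)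
    (hYi : Integrable (fun ω => Y ω ^ 2) P) : Integrable (fun ω => φ (X ω) * φ (Y ω)) P := by
  have hL : ∀ {Z : Ω → ℝ}, Measurable Z → Integrable (fun ω => Z ω ^ 2) P →
      MemLp (fun ω => φ (Z ω)) 2 P := fun hZ hZi =>
    (memLp_two_iff_integrable_sq (Measurable.aestronglyMeasurable (by fun_prop))).mpr
      (integrable_sq_comp hφ hlin hZ hZi)
  exact (hL hX hXi).integrable_mul (hL hY hYi)

/-- Since `C` involves only `φ`, the weight `r`, the accuracy `ε` and the approximant `ψ` can be
chosen in this order. -/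
theorem integral_abs_mul_sub_mul_le {Ω : Type*} [MeasurableSpace Ω] {P : Measure Ω}
    [IsProbabilityMeasure P] (hφ : Measurable φ) (hlin : ∀ x, |φ x| ≤ c + m * |x|)
    (ψ : BoundedContinuousFunction ℝ ℝ) {X Y : Ω → ℝ} (hX : Measurable X)
    (hY : Measurable Y) (hXi : Integrable (fun ω => X ω ^ 2) P)
    (hYi : Integrable (fun ω => Y ω ^ 2) P) {C r ε : ℝ} (hr : 0 < r) (hε : 0 ≤ ε)
    (hXC : ∫ ω, φ (X ω) ^ 2 ∂P ≤ C) (hYC : ∫ ω, φ (Y ω) ^ 2 ∂P ≤ C)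
    (hXψ : ∫⁻ x, ENNReal.ofReal ((φ x - ψ x) ^ 2) ∂(P.map X) ≤ ENNReal.ofReal ε)
    (hYψ : ∫⁻ x, ENNReal.ofReal ((φ x - ψ x) ^ 2) ∂(P.map Y) ≤ ENNReal.ofReal ε) :
    ∫ ω, |φ (X ω) * φ (Y ω) - ψ (X ω) * ψ (Y ω)| ∂P ≤ r * C + (1 / r + 1) * ε := by
  have hψ := ψ.continuous.measurable
  have hd : ∀ {Z : Ω → ℝ}, Measurable Z → Integrable (fun ω => Z ω ^ 2) P →
      ∫⁻ x, ENNReal.ofReal ((φ x - ψ x) ^ 2) ∂(P.map Z) ≤ ENNReal.ofReal ε →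
      Integrable (fun ω => (φ (Z ω) - ψ (Z ω)) ^ 2) P ∧
        ∫ ω, (φ (Z ω) - ψ (Z ω)) ^ 2 ∂P ≤ ε := by
    intro Z hZ hZi hZψ
    have hmeas : Measurable fun ω => (φ (Z ω) - ψ (Z ω)) ^ 2 := by fun_prop
    rw [lintegral_map (by fun_prop) hZ] at hZψ
    have hi : Integrable (fun ω => (φ (Z ω) - ψ (Z ω)) ^ 2) P := by
      refine ⟨hmeas.aestronglyMeasurable, ?_⟩
      rw [hasFiniteIntegral_iff_ofReal (.of_forall fun ω => sq_nonneg _)]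
      exact hZψ.trans_lt ENNReal.ofReal_lt_top
    refine ⟨hi, ?_⟩
    rw [integral_eq_lintegral_of_nonneg_ae (.of_forall fun ω => sq_nonneg _)
      hmeas.aestronglyMeasurable]
    exact ENNReal.toReal_le_of_le_ofReal hε hZψ
  obtain ⟨iX, dX⟩ := hd hX hXi hXψ
  obtain ⟨iY, dY⟩ := hd hY hYi hYψ
  have jX := integrable_sq_comp hφ hlin hX hXi
  have jY := integrable_sq_comp hφ hlin hY hYi
  have hbound := integral_mono_of_nonneg (μ := P)
    (f := fun ω => |φ (X ω) * φ (Y ω) - ψ (X ω) * ψ (Y ω)|)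
    (g := fun ω => r / 2 * (φ (X ω) ^ 2 + φ (Y ω) ^ 2) + (1 / (2 * r) + 1 / 2)
      * ((φ (X ω) - ψ (X ω)) ^ 2 + (φ (Y ω) - ψ (Y ω)) ^ 2))
    (.of_forall fun ω => abs_nonneg _)
    (((jX.add jY).const_mul _).add ((iX.add iY).const_mul _))
    (.of_forall fun ω => abs_mul_sub_mul_le hr)
  refine hbound.trans ?_
  have e1 : ∫ ω, (r / 2 * (φ (X ω) ^ 2 + φ (Y ω) ^ 2) + (1 / (2 * r) + 1 / 2)
      * ((φ (X ω) - ψ (X ω)) ^ 2 + (φ (Y ω) - ψ (Y ω)) ^ 2)) ∂P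
      = r / 2 * (∫ ω, φ (X ω) ^ 2 ∂P + ∫ ω, φ (Y ω) ^ 2 ∂P) + (1 / (2 * r) + 1 / 2)
      * (∫ ω, (φ (X ω) - ψ (X ω)) ^ 2 ∂P + ∫ ω, (φ (Y ω) - ψ (Y ω)) ^ 2 ∂P) := by
    refine (integral_add ((jX.add jY).const_mul _) ((iX.add iY).const_mul _)).trans ?_
    rw [integral_const_mul, integral_const_mul]
    congr 2
    · exact integral_add jX jY
    · exact integral_add iX iY
  rw [e1]
  calc _ ≤ r / 2 * (C + C) + (1 / (2 * r) + 1 / 2) * (ε + ε) := by gcongr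
    _ = _ := by field_simp; ring

end Activation

/-! ### Gaussian expectations of the activation -/

section GaussianProcess

variable {T : Type*} {K : T → T → ℝ}

theorem measurePreserving_eval_gpMarginal
    (hK : ∀ (D : ℕ) (X : Fin D → T), (kernelMatrix K X).PosSemidef) {D : ℕ} (X : Fin D → T)
    (a : Fin D) :
    MeasurePreserving (fun f : EuclideanSpace ℝ (Fin D) => f a) (gpMarginal K X)
      (gaussianReal 0 (K (X a) (X a)).toNNReal) :=
  measurePreserving_eval_multivariateGaussian (μ := 0) (hK D X) (i := a)

theorem integrable_eval_sq_gpMarginal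
    (hK : ∀ (D : ℕ) (X : Fin D → T), (kernelMatrix K X).PosSemidef) {D : ℕ} (X : Fin D → T)
    (a : Fin D) : Integrable (fun f : EuclideanSpace ℝ (Fin D) => f a ^ 2) (gpMarginal K X) :=
  (measurePreserving_eval_gpMarginal hK X a).integrable_comp_of_integrable
    (integrable_sq_gaussianReal _)

theorem integral_eval_sq_gpMarginal
    (hK : ∀ (D : ℕ) (X : Fin D → T), (kernelMatrix K X).PosSemidef) {D : ℕ} (X : Fin D → T)
    (a : Fin D) : ∫ f : EuclideanSpace ℝ (Fin D), f a ^ 2 ∂(gpMarginal K X) = K (X a) (X a) := by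
  have hmp := measurePreserving_eval_gpMarginal hK X a
  have h := integral_sq_gaussianReal (K (X a) (X a)).toNNReal
  rw [← hmp.map_eq, integral_map hmp.measurable.aemeasurable
    (Measurable.aestronglyMeasurable (by fun_prop))] at h
  have h0 : 0 ≤ K (X a) (X a) := by
    simpa [kernelMatrix] using (hK D X).diag_nonneg (i := a)
  rw [h, Real.coe_toNNReal _ h0]

/-- At a repeated point the mean square of `f 0 - f 1` is `K u u - 2 K u u + K u u = 0`. -/
theorem ae_eq_gpMarginal_same
    (hK : ∀ (D : ℕ) (X : Fin D → T), (kernelMatrix K X).PosSemidef) (u : T) :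
    ∀ᵐ f ∂(gpMarginal K ![u, u]), f 0 = f 1 := by
  have hL : ∀ a : Fin 2, MemLp (fun f : EuclideanSpace ℝ (Fin 2) => f a) 2 (gpMarginal K ![u, u]) :=
    fun a => (memLp_two_iff_integrable_sq (Measurable.aestronglyMeasurable (by fun_prop))).mpr
      (integrable_eval_sq_gpMarginal hK _ a)
  have hmean : ∀ a : Fin 2, ∫ f : EuclideanSpace ℝ (Fin 2), f a ∂(gpMarginal K ![u, u]) = 0 := by
    intro a
    have hmp := measurePreserving_eval_gpMarginal hK ![u, u] a
    have h := integral_id_gaussianReal (μ := 0) (v := (K (![u, u] a) (![u, u] a)).toNNReal)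
    rwa [← hmp.map_eq, integral_map hmp.measurable.aemeasurable
      (Measurable.aestronglyMeasurable (by fun_prop))] at h
  have hc : ∫ f : EuclideanSpace ℝ (Fin 2), f 0 * f 1 ∂(gpMarginal K ![u, u]) = K u u := by
    have h := covariance_eval_multivariateGaussian (μ := 0) (hK 2 ![u, u]) 0 1
    have h2 := covariance_eq_sub (hL 0) (hL 1)
    rw [gpMarginal] at h2 hmean ⊢
    rw [h, hmean 0] at h2
    simpa [kernelMatrix] using h2.symm
  have i0 := integrable_eval_sq_gpMarginal hK ![u, u] 0
  have i1 := integrable_eval_sq_gpMarginal hK ![u, u] 1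
  have i2 : Integrable (fun f : EuclideanSpace ℝ (Fin 2) => f 0 * f 1) (gpMarginal K ![u, u]) :=
    (hL 0).integrable_mul (hL 1)
  have e0 := integral_eval_sq_gpMarginal hK ![u, u] 0
  have e1 := integral_eval_sq_gpMarginal hK ![u, u] 1
  have hsq : ∀ f : EuclideanSpace ℝ (Fin 2),
      (f 0 - f 1) ^ 2 = f 0 ^ 2 + f 1 ^ 2 - 2 * (f 0 * f 1) := fun f => by ring
  have hz : ∫ f : EuclideanSpace ℝ (Fin 2), (f 0 - f 1) ^ 2 ∂(gpMarginal K ![u, u]) = 0 := by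
    simp_rw [hsq]
    refine (integral_sub (i0.add i1) (i2.const_mul 2)).trans ?_
    rw [integral_const_mul, hc]
    have := integral_add i0 i1
    rw [e0, e1] at this
    simp only [Pi.add_apply]
    rw [this]
    simp
    ring
  have hi : Integrable (fun f : EuclideanSpace ℝ (Fin 2) => (f 0 - f 1) ^ 2)
      (gpMarginal K ![u, u]) := by
    simp_rw [hsq]
    exact (i0.add i1).sub (i2.const_mul 2)
  filter_upwards [(integral_eq_zero_iff_of_nonneg (fun f => sq_nonneg _) hi).mp hz] with f hf
  simpa [sub_eq_zero] using hf

variable {φ : ℝ → ℝ}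

theorem gpExp_self (hK : ∀ (D : ℕ) (X : Fin D → T), (kernelMatrix K X).PosSemidef)
    (hφ : Measurable φ) (u : T) :
    gpExp φ K u u = ∫ x, φ x ^ 2 ∂(gaussianReal 0 (K u u).toNNReal) := by
  have hmp := measurePreserving_eval_gpMarginal hK ![u, u] 0
  have h : ∫ x, φ x ^ 2 ∂(gaussianReal 0 (K u u).toNNReal)
      = ∫ f, φ (f 0) ^ 2 ∂(gpMarginal K ![u, u]) := by
    have h3 := hmp.map_eq
    simp only [Matrix.cons_val_zero] at h3
    rw [← h3, integral_map hmp.measurable.aemeasurable (by fun_prop)]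
  rw [h, gpExp]
  refine integral_congr_ae ?_
  filter_upwards [ae_eq_gpMarginal_same hK u] with f hf
  rw [← hf, sq]

theorem ae_eq_zero_of_gpExp_self_eq_zero
    (hK : ∀ (D : ℕ) (X : Fin D → T), (kernelMatrix K X).PosSemidef) (hφ : Measurable φ) {c m : ℝ}
    (hlin : ∀ x, |φ x| ≤ c + m * |x|) {u : T} (h : gpExp φ K u u = 0) :
    ∀ᵐ x ∂(gaussianReal 0 (K u u).toNNReal), φ x = 0 := by
  rw [gpExp_self hK hφ] at h
  have hi : Integrable (fun x => φ x ^ 2) (gaussianReal 0 (K u u).toNNReal) :=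
    integrable_sq_comp hφ hlin measurable_id (integrable_sq_gaussianReal _)
  filter_upwards [(integral_eq_zero_iff_of_nonneg (fun f => sq_nonneg _) hi).mp h] with x hx
  simpa using hx

end GaussianProcess

/-! ### The activation step -/

namespace AsymptoticGaussian

variable {T : Type*} {p : ℕ → ℕ} {M : ∀ ν, Measure (Fin (p ν) → T → ℝ)}
  [∀ ν, IsProbabilityMeasure (M ν)] {K : T → T → ℝ} {φ : ℝ → ℝ} {c m : ℝ}

/-- The summands are bounded and centered for the limiting process. The mean product over two
distinct channels therefore tends to `0²`, and the diagonal contributes at most `‖G‖² / p`. -/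
theorem tendsto_average (hM : AsymptoticGaussian p M K) (hp : Tendsto p atTop atTop)
    (ψ : BoundedContinuousFunction ℝ ℝ) (u v : T) :
    Tendsto (fun ν => ∫ h, |(p ν : ℝ)⁻¹ * ∑ j, (ψ (h j u) * ψ (h j v) - gpExp ψ K u v)| ∂(M ν))
      atTop (𝓝 0) := by
  set μ := gpExp ψ K u v with hμ
  let F : BoundedContinuousFunction (EuclideanSpace ℝ (Fin 2)) ℝ :=
    ψ.compContinuous ⟨fun x => x 0, by fun_prop⟩ * ψ.compContinuous ⟨fun x => x 1, by fun_prop⟩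
  let G : BoundedContinuousFunction (EuclideanSpace ℝ (Fin 2)) ℝ :=
    F - BoundedContinuousFunction.const _ μ
  have hG : ∀ x, G x = ψ (x 0) * ψ (x 1) - μ := fun x => rfl
  have hGint : ∫ x, G x ∂(gpMarginal K ![u, v]) = 0 := by
    simp only [hG]
    refine (integral_sub (F.integrable _) (integrable_const _)).trans ?_
    simp only [integral_const, probReal_univ, one_smul, sub_eq_zero, hμ, gpExp]
    rfl
  have hlim := hM.tendsto_integral_prod hp ![u, v] 2 G
  rw [hGint] at hlim
  have hlim2 : Tendsto (fun ν => √(‖G‖ ^ 2 / p ν + |∫ h, ∏ i ∈ Finset.range 2,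
      G (WithLp.toLp 2 fun a => coord i h (![u, v] a)) ∂(M ν)|)) atTop (𝓝 0) := by
    have h1 : Tendsto (fun ν => ‖G‖ ^ 2 / (p ν : ℝ)) atTop (𝓝 0) :=
      tendsto_const_nhds.div_atTop (tendsto_natCast_atTop_atTop.comp hp)
    have h2 := (h1.add hlim.abs).sqrt
    simpa using h2
  refine tendsto_of_tendsto_of_tendsto_of_le_of_le' tendsto_const_nhds hlim2
    (.of_forall fun ν => integral_nonneg fun _ => abs_nonneg _) ?_
  filter_upwards [hp.eventually_ge_atTop 2] with ν hν
  have hX : Measurable fun f : T → ℝ => ψ (f u) * ψ (f v) - μ := by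
    have := ψ.continuous.measurable
    fun_prop
  have h := integral_abs_average_le (hM.map_leftMul ν) hX (C := ‖G‖)
    (fun f => G.norm_coe_le_norm (WithLp.toLp 2 ![f u, f v]))
    (i₀ := ⟨0, by omega⟩) (i₁ := ⟨1, by omega⟩) (by simp)
  refine h.trans (le_of_eq ?_)
  congr 3
  refine integral_congr_ae (.of_forall fun h => ?_)
  simp only [Finset.prod_range_succ, Finset.prod_range_zero, one_mul, hG]
  simp [coord_of_lt (show 0 < p ν by omega), coord_of_lt (show 1 < p ν by omega)]

/-- The error splits into the replacement of `φ` by `ψ` in the empirical average, the law of large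
numbers for `ψ`, and the replacement of `ψ` by `φ` in the Gaussian expectation. Exchangeability
reduces the first to a single channel. Each part is at most `ε / 4`. -/
theorem tendsto_gram_comp (hM : AsymptoticGaussian p M K) (hp : Tendsto p atTop atTop)
    (hφ : Measurable φ) (hc : 0 ≤ c) (hm : 0 ≤ m) (hlin : ∀ x, |φ x| ≤ c + m * |x|) (u v : T) :
    Tendsto (fun ν => ∫ h, |gram (fun i w => φ (h i w)) u v - gpExp φ K u v| ∂(M ν))
      atTop (𝓝 0) := by
  have hK := hM.tendsto_iid.1
  have hKu := hM.diag_nonneg u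
  have hKv := hM.diag_nonneg v
  refine tendsto_order.mpr ⟨fun a ha => .of_forall fun ν =>
    ha.trans_le (integral_nonneg fun _ => abs_nonneg _), fun ε hε => ?_⟩
  -- `C` eventually bounds the second moments of `φ` at `u` and `v`, under the network and under the
  -- limit. Then `r` and `δ` make both `r * C` and `(1 / r + 1) * δ` equal to `ε / 8`.
  set C := 2 * c ^ 2 + 2 * m ^ 2 * (K u u + K v v + 1) + 1 with hC
  have hC0 : 0 < C := by positivity
  set r := ε / (8 * C) with hr
  have hr0 : 0 < r := by positivity
  set δ := ε / 8 / (1 / r + 1) with hδ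
  have hδ0 : 0 < δ := by positivity
  have hsmall : r * C + (1 / r + 1) * δ = ε / 4 := by
    have h1 : r * C = ε / 8 := by rw [hr]; field_simp
    have h2 : (1 / r + 1) * δ = ε / 8 := by
      have : 1 / r + 1 ≠ 0 := by positivity
      rw [hδ, mul_div_cancel₀ _ this]
    rw [h1, h2]; ring
  obtain ⟨ψ, hψ⟩ := (((hM.uniformlyTame_coord hp u).add (hM.uniformlyTame_coord hp v)).add
    ((uniformlyTame_gaussianReal (K u u).toNNReal).add
      (uniformlyTame_gaussianReal (K v v).toNNReal))).exists_approx hφ hc hm hlin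
    (ENNReal.ofReal_pos.mpr hδ0).ne'
  have hψm := ψ.continuous.measurable
  have hbound : ∀ {I S : ℝ}, I ≤ 2 * c ^ 2 + 2 * m ^ 2 * S → S ≤ K u u + K v v + 1 → I ≤ C := by
    intro I S hI hS
    have := mul_le_mul_of_nonneg_left hS (show 0 ≤ 2 * m ^ 2 by positivity)
    linarith
  have hgauss : |gpExp ψ K u v - gpExp φ K u v| ≤ ε / 4 := by
    -- The Gaussian summands do not depend on `ν`, so a single index suffices.
    obtain ⟨ν, hν⟩ := hψ.exists
    simp only [lintegral_add_measure] at hν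
    have hmp0 := measurePreserving_eval_gpMarginal hK ![u, v] 0
    have hmp1 := measurePreserving_eval_gpMarginal hK ![u, v] 1
    have hi0 := integrable_eval_sq_gpMarginal hK ![u, v] 0
    have hi1 := integrable_eval_sq_gpMarginal hK ![u, v] 1
    have hle := integral_abs_mul_sub_mul_le hφ hlin ψ hmp0.measurable hmp1.measurable hi0 hi1
      hr0 hδ0.le
      (hbound (integral_sq_comp_le hφ hlin hmp0.measurable hi0) (by
        rw [integral_eval_sq_gpMarginal hK]; simp; linarith))
      (hbound (integral_sq_comp_le hφ hlin hmp1.measurable hi1) (by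
        rw [integral_eval_sq_gpMarginal hK]; simp; linarith))
      (by
        rw [hmp0.map_eq]
        exact le_trans (le_add_right le_rfl) (le_trans (le_add_left le_rfl) hν))
      (by
        rw [hmp1.map_eq]
        exact le_trans (le_add_left le_rfl) (le_trans (le_add_left le_rfl) hν))
    rw [hsmall] at hle
    refine le_trans ?_ hle
    have hiφ := integrable_mul_comp hφ hlin hmp0.measurable hmp1.measurable hi0 hi1
    have hiψ : Integrable (fun f : EuclideanSpace ℝ (Fin 2) => ψ (f 0) * ψ (f 1))
        (gpMarginal K ![u, v]) :=
      integrable_mul_comp hψm (c := ‖ψ‖) (m := 0) (fun x => by simpa using ψ.norm_coe_le_norm x)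
        hmp0.measurable hmp1.measurable hi0 hi1
    rw [abs_sub_comm, gpExp, gpExp, ← integral_sub hiφ hiψ]
    exact abs_integral_le_integral_abs
  have hsqu := (hM.tendsto_integral_coord_sq hp u).eventually_lt_const
    (show K u u < K u u + K v v + 1 by linarith)
  have hsqv := (hM.tendsto_integral_coord_sq hp v).eventually_lt_const
    (show K v v < K u u + K v v + 1 by linarith)
  have havg := (hM.tendsto_average hp ψ u v).eventually_lt_const (show 0 < ε / 4 by linarith)
  filter_upwards [hψ, hsqu, hsqv, havg, hp.eventually_gt_atTop 0] with ν hν hu hv ha hp0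
  simp only [lintegral_add_measure] at hν
  have hpos : (0 : ℝ) < p ν := by exact_mod_cast hp0
  have hchan : ∫ h, |φ (h ⟨0, hp0⟩ u) * φ (h ⟨0, hp0⟩ v) - ψ (h ⟨0, hp0⟩ u) * ψ (h ⟨0, hp0⟩ v)|
      ∂(M ν) ≤ ε / 4 := by
    rw [← hsmall]
    have hle := integral_abs_mul_sub_mul_le (P := M ν) hφ hlin ψ
      (measurable_coord (i := 0) u) (measurable_coord (i := 0) v)
      (hM.integrable_coord_sq ν 0 u) (hM.integrable_coord_sq ν 0 v) hr0 hδ0.le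
      (hbound (integral_sq_comp_le hφ hlin (measurable_coord u)
        (hM.integrable_coord_sq ν 0 u)) hu.le)
      (hbound (integral_sq_comp_le hφ hlin (measurable_coord v)
        (hM.integrable_coord_sq ν 0 v)) hv.le)
      (le_trans (le_add_right le_rfl) (le_trans (le_add_right le_rfl) hν))
      (le_trans (le_add_left le_rfl) (le_trans (le_add_right le_rfl) hν))
    simpa only [coord_of_lt hp0] using hle
  have hiφ : ∀ j, Integrable (fun h => φ (h j u) * φ (h j v)) (M ν) := fun j =>
    integrable_mul_comp hφ hlin (by fun_prop) (by fun_prop) (hM.integrable_sq ν j u)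
      (hM.integrable_sq ν j v)
  have hiψ : ∀ j, Integrable (fun h => ψ (h j u) * ψ (h j v)) (M ν) := fun j =>
    integrable_mul_comp hψm (c := ‖ψ‖) (m := 0) (fun x => by simpa using ψ.norm_coe_le_norm x)
      (by fun_prop) (by fun_prop) (hM.integrable_sq ν j u) (hM.integrable_sq ν j v)
  have hid : ∀ j, Integrable (fun h => |φ (h j u) * φ (h j v) - ψ (h j u) * ψ (h j v)|) (M ν) :=
    fun j => ((hiφ j).sub (hiψ j)).abs
  have i1 : Integrable (fun h => (p ν : ℝ)⁻¹ *
      ∑ j, |φ (h j u) * φ (h j v) - ψ (h j u) * ψ (h j v)|) (M ν) :=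
    (integrable_finsetSum _ fun j _ => hid j).const_mul _
  have i2 : Integrable (fun h => |(p ν : ℝ)⁻¹ *
      ∑ j, (ψ (h j u) * ψ (h j v) - gpExp ψ K u v)|) (M ν) :=
    ((integrable_finsetSum _ fun j _ => (hiψ j).sub (integrable_const _)).const_mul _).abs
  have hpt : ∀ h : Fin (p ν) → T → ℝ, |gram (fun i w => φ (h i w)) u v - gpExp φ K u v|
      ≤ ((p ν : ℝ)⁻¹ * ∑ j, |φ (h j u) * φ (h j v) - ψ (h j u) * ψ (h j v)|
        + |(p ν : ℝ)⁻¹ * ∑ j, (ψ (h j u) * ψ (h j v) - gpExp ψ K u v)|) + ε / 4 := by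
    intro h
    have e : gram (fun i w => φ (h i w)) u v - gpExp φ K u v
        = (p ν : ℝ)⁻¹ * ∑ j, (φ (h j u) * φ (h j v) - ψ (h j u) * ψ (h j v))
          + (p ν : ℝ)⁻¹ * ∑ j, (ψ (h j u) * ψ (h j v) - gpExp ψ K u v)
          + (gpExp ψ K u v - gpExp φ K u v) := by
      simp only [gram, Finset.sum_sub_distrib, Finset.sum_const, Finset.card_univ,
        Fintype.card_fin, nsmul_eq_mul]
      field_simp
      ring
    rw [e]
    refine (abs_add_three _ _ _).trans ?_
    gcongr
    rw [abs_mul, abs_of_pos (inv_pos.mpr hpos)]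
    gcongr
    exact Finset.abs_sum_le_sum_abs _ _
  have hX : Measurable fun f : T → ℝ => |φ (f u) * φ (f v) - ψ (f u) * ψ (f v)| := by fun_prop
  have e1 : ∫ h, (p ν : ℝ)⁻¹ * ∑ j, |φ (h j u) * φ (h j v) - ψ (h j u) * ψ (h j v)| ∂(M ν)
      ≤ ε / 4 := by
    rw [integral_const_mul, integral_finsetSum _ fun j _ => hid j]
    rw [Finset.sum_congr rfl fun j _ => integral_channel_eq (hM.map_leftMul ν) hX j ⟨0, hp0⟩]
    rw [Finset.sum_const, Finset.card_univ, Fintype.card_fin, nsmul_eq_mul,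
      inv_mul_cancel_left₀ hpos.ne']
    exact hchan
  have hmono := integral_mono_of_nonneg (μ := M ν) (.of_forall fun h => abs_nonneg _)
    ((i1.add i2).add (integrable_const (ε / 4))) (.of_forall hpt)
  refine hmono.trans_lt ?_
  have e2 := integral_add (i1.add i2) (integrable_const (μ := M ν) (ε / 4))
  have e3 := integral_add i1 i2
  simp only [Pi.add_apply] at e2 e3 ⊢
  rw [e2, e3]
  simp only [integral_const, probReal_univ, one_smul]
  linarith

/-- If `K u u = 0` then `φ 0 = 0`, and a layer vanishing at `u` still vanishes after the activation.
Otherwise `φ = 0` Lebesgue almost everywhere, and rotation invariance keeps every channel off the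
exceptional null set unless a fixed channel is exactly zero, which is asymptotically improbable. -/
theorem tendsto_support_comp (hM : AsymptoticGaussian p M K) (hp : Tendsto p atTop atTop)
    (hφ : Measurable φ) (hlin : ∀ x, |φ x| ≤ c + m * |x|) {u : T} (h0 : gpExp φ K u u = 0) :
    Tendsto (fun ν => (M ν).real {h | ∃ i, φ (h i u) ≠ 0}) atTop (𝓝 0) := by
  have hae := ae_eq_zero_of_gpExp_self_eq_zero hM.tendsto_iid.1 hφ hlin h0
  by_cases hu : K u u = 0
  · have hφ0 : φ 0 = 0 := by
      rw [hu, Real.toNNReal_zero, gaussianReal_zero_var] at hae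
      exact (ae_dirac_iff (p := fun x => φ x = 0) (hφ (measurableSet_singleton 0))).mp hae
    refine squeeze_zero (fun ν => measureReal_nonneg) (fun ν => ?_) (hM.tendsto_support u hu)
    refine measureReal_mono (fun h hh => ?_)
    obtain ⟨i, hi⟩ := hh
    exact ⟨i, fun hz => hi (by rw [hz, hφ0])⟩
  · have hv : (K u u).toNNReal ≠ 0 := by
      simpa using lt_of_le_of_ne (hM.diag_nonneg u) (Ne.symm hu)
    have hZ : volume {x | φ x ≠ 0} = 0 := gaussianReal_absolutelyContinuous' 0 hv hae
    have hZm : MeasurableSet {x | φ x ≠ 0} :=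
      (hφ (measurableSet_singleton 0)).compl
    refine tendsto_order.mpr ⟨fun a ha => .of_forall fun ν => ha.trans_le measureReal_nonneg,
      fun ε hε => ?_⟩
    obtain ⟨η, hη, hball⟩ := hM.exists_small_ball hp hu
      (ENNReal.ofReal_pos.mpr (half_pos hε)).ne'
    filter_upwards [hball, hp.eventually_ge_atTop 2] with ν hν h2
    have hle := measure_exists_mem_null_le (hM.map_leftMul ν) (i₀ := ⟨0, by omega⟩)
      (i₁ := ⟨1, by omega⟩) (by simp) u hZm hZ
    have hle2 : M ν {h | h ⟨0, by omega⟩ u = 0} ≤ ENNReal.ofReal (ε / 2) := by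
      refine le_trans (measure_mono fun h hh => ?_) hν
      show |coord 0 h u| < η
      rw [coord_of_lt (show 0 < p ν by omega), show h ⟨0, by omega⟩ u = 0 from hh]
      simpa using hη
    have : (M ν).real {h | ∃ i, φ (h i u) ≠ 0} ≤ ε / 2 :=
      ENNReal.toReal_le_of_le_ofReal (half_pos hε).le (hle.trans hle2)
    linarith

theorem asymptoticGram_comp (hM : AsymptoticGaussian p M K) (hp : Tendsto p atTop atTop)
    (hφ : Measurable φ) (hc : 0 ≤ c) (hm : 0 ≤ m) (hlin : ∀ x, |φ x| ≤ c + m * |x|) :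
    AsymptoticGram p (fun ν => (M ν).map fun h i u => φ (h i u)) (gpExp φ K) := by
  have hmeas : ∀ ν, Measurable fun (h : Fin (p ν) → T → ℝ) i u => φ (h i u) := fun ν => by fun_prop
  refine ⟨fun ν j u => ?_, fun u v => ?_, fun u h0 => ?_⟩
  · rw [integrable_map_measure (Measurable.aestronglyMeasurable (by fun_prop))
      (hmeas ν).aemeasurable]
    exact integrable_sq_comp hφ hlin (by fun_prop) (hM.integrable_sq ν j u)
  · refine (hM.tendsto_gram_comp hp hφ hc hm hlin u v).congr fun ν => ?_
    rw [integral_map (hmeas ν).aemeasurable (Measurable.aestronglyMeasurable (by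
      unfold gram; fun_prop))]
  · refine (hM.tendsto_support_comp hp hφ hlin h0).congr fun ν => ?_
    rw [map_measureReal_apply (hmeas ν) (measurableSet_exists_ne_zero u)]
    rfl

end AsymptoticGaussian

/-! ### Layers driven by independent parameters -/

/-- Resampling one coordinate by an independent copy expresses independence: a function that ignores
this coordinate is unaffected by the replacement. -/
theorem measurePreserving_update_pi {ι : Type*} [Fintype ι] [DecidableEq ι] {Ω : ι → Type*}
    [∀ i, MeasurableSpace (Ω i)] (μ : ∀ i, Measure (Ω i)) [∀ i, IsProbabilityMeasure (μ i)]
    (i : ι) :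
    MeasurePreserving (fun z : (∀ j, Ω j) × Ω i => Function.update z.1 i z.2)
      ((Measure.pi μ).prod (μ i)) (Measure.pi μ) := by
  refine ⟨measurable_update', (Measure.pi_eq fun s hs => ?_).symm⟩
  rw [Measure.map_apply measurable_update' (MeasurableSet.univ_pi hs)]
  have hpre : (fun z : (∀ j, Ω j) × Ω i => Function.update z.1 i z.2) ⁻¹' Set.univ.pi s
      = Set.univ.pi (Function.update s i Set.univ) ×ˢ s i := by
    ext z
    simp only [Set.mem_preimage, Set.mem_univ_pi, Set.mem_prod]
    constructor
    · refine fun h => ⟨fun j => ?_, by simpa using h i⟩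
      rcases eq_or_ne j i with rfl | hj
      · simp
      · simpa [hj] using h j
    · rintro ⟨h, hi⟩ j
      rcases eq_or_ne j i with rfl | hj
      · simpa using hi
      · simpa [hj] using h j
  rw [hpre, Measure.prod_prod, Measure.pi_pi, ← Finset.mul_prod_erase _ _ (Finset.mem_univ i),
    ← Finset.mul_prod_erase _ (fun j => μ j (s j)) (Finset.mem_univ i)]
  simp only [Function.update_self, measure_univ, one_mul]
  rw [mul_comm]
  congr 1
  refine Finset.prod_congr rfl fun j hj => ?_
  rw [Function.update_of_ne (Finset.ne_of_mem_erase hj)]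

theorem map_prodMk_pi_eq_prod {ι : Type*} [Fintype ι] [DecidableEq ι] {Ω : ι → Type*}
    [∀ i, MeasurableSpace (Ω i)] (μ : ∀ i, Measure (Ω i)) [∀ i, IsProbabilityMeasure (μ i)]
    (i : ι) {E : Type*} [MeasurableSpace E] {f : (∀ j, Ω j) → E} (hf : Measurable f)
    (hdep : ∀ θ z, f (Function.update θ i z) = f θ) :
    (Measure.pi μ).map (fun θ => (f θ, θ i)) = ((Measure.pi μ).map f).prod (μ i) := by
  conv_lhs => rw [← (measurePreserving_update_pi μ i).map_eq]
  rw [Measure.map_map (hf.prodMk (measurable_pi_apply i)) measurable_update']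
  conv_rhs => rw [← Measure.map_id (μ := μ i), Measure.map_prod_map _ _ hf measurable_id]
  congr 1
  ext z
  · simp [hdep]
  · simp

theorem map_genLayer_eq_layerLaw {Θ B T T' : Type*} [MeasurableSpace Θ] [Fintype B]
    {P : Measure Θ} {p q : ℕ} {y : Θ → Fin q → T' → ℝ} (hy : Measurable y)
    {w : Θ → (B → Fin p → Fin q → ℝ) × (Fin p → ℝ)} (hw : Measurable w)
    (h : P.map (fun θ => (y θ, w θ)) = (P.map y).prod (layerWeights B p q)) (c σ : ℝ)
    (τ : B → T → T') :
    P.map (fun θ => genLayer c σ τ (w θ) (y θ)) = layerLaw c σ τ p (P.map y) := by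
  rw [layerLaw, ← h, Measure.map_map (measurable_genLayer c σ τ) (hy.prodMk hw)]
  rfl

theorem TendstoIIDGaussianProcesses.of_map_eq {T : Type*} {Θ : ℕ → Type*}
    [∀ ν, MeasurableSpace (Θ ν)] {P : ∀ ν, Measure (Θ ν)} [∀ ν, IsProbabilityMeasure (P ν)]
    {p : ℕ → ℕ} {h : ∀ ν, Θ ν → Fin (p ν) → T → ℝ} {K : T → T → ℝ}
    {M : ∀ ν, Measure (Fin (p ν) → T → ℝ)} [∀ ν, IsProbabilityMeasure (M ν)]
    (hh : ∀ ν, Measurable (h ν)) (hmap : ∀ ν, (P ν).map (h ν) = M ν)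
    (hM : TendstoIIDGaussianProcesses M p (fun _ y i u => y i u) K) :
    TendstoIIDGaussianProcesses P p h K := by
  refine ⟨hM.1, fun D X I hI => ?_⟩
  have hT := hM.2 D X I hI
  have hmeas : ∀ ν, Measurable fun (y : Fin (p ν) → T → ℝ) (i : I) =>
      WithLp.toLp 2 fun a : Fin D => if hi : (i : ℕ) < p ν then y ⟨i, hi⟩ (X a) else 0 := by
    refine fun ν => measurable_pi_lambda _ fun i => (WithLp.measurable_toLp 2 _).comp
      (measurable_pi_lambda _ fun a => ?_)
    exact measurable_coord (i := i) (X a)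
  refine ⟨fun ν => ((hmeas ν).comp (hh ν)).aemeasurable, hT.aemeasurable_limit, ?_⟩
  refine hT.tendsto.congr fun ν => Subtype.ext ?_
  simp only
  rw [← hmap ν, Measure.map_map (hmeas ν) (hh ν)]
  rfl

/-- The base of the induction over layers. For a deterministic input, zero second moment at `u`
means that every channel is zero there. -/
theorem asymptoticGram_dirac {T : Type*} {q : ℕ} (y : Fin q → T → ℝ) :
    AsymptoticGram (fun _ => q) (fun _ => Measure.dirac y) (gram y) := by
  refine ⟨fun _ j u => ?_, fun u v => ?_, fun u hu => ?_⟩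
  · exact integrable_dirac' (Measurable.stronglyMeasurable (by fun_prop)) (by simp)
  · refine tendsto_const_nhds.congr fun _ => ?_
    rw [integral_dirac' _ _ (Measurable.stronglyMeasurable (by unfold gram; fun_prop))]
    simp
  · refine tendsto_const_nhds.congr fun _ => ?_
    have hy : ∀ j, y j u = 0 := by
      intro j
      have hq : (q : ℝ) ≠ 0 := by
        have : q ≠ 0 := j.pos.ne'
        exact_mod_cast this
      rw [gram, mul_eq_zero, or_iff_right (inv_ne_zero hq),
        Finset.sum_eq_zero_iff_of_nonneg fun j _ => mul_self_nonneg _] at hu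
      exact mul_self_eq_zero.mp (hu j (Finset.mem_univ j))
    rw [measureReal_def, Measure.dirac_apply' _ (measurableSet_exists_ne_zero u)]
    simp [hy]

/-! ### Fully connected networks -/

section FCN

variable {φ : ℝ → ℝ} {σw σb : ℝ} {L n₀ : ℕ} {n : ℕ → ℕ}

theorem measurable_fcnPost (hφ : Measurable φ) (l : ℕ) (hl : l ≤ L) :
    Measurable fun (θ : FCNParams L n₀ n) j x => fcnPost φ σw σb θ x l hl j := by
  induction l with
  | zero =>
    simp only [fcnPost]
    exact measurable_const
  | succ l ih =>
    have ih := ih (Nat.le_of_succ_le hl)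
    refine measurable_pi_lambda _ fun j => measurable_pi_lambda _ fun x => hφ.comp ?_
    have hj : ∀ j, Measurable fun θ : FCNParams L n₀ n =>
        fcnPost φ σw σb θ x l (Nat.le_of_succ_le hl) j := fun j =>
      (measurable_pi_apply x).comp ((measurable_pi_apply j).comp ih)
    unfold fcnLayer
    fun_prop

theorem measurable_fcnPre (hφ : Measurable φ) (l : ℕ) (hl : l < L) :
    Measurable fun (θ : FCNParams L n₀ n) i x => fcnPre φ σw σb θ x l hl i := by
  refine measurable_pi_lambda _ fun j => measurable_pi_lambda _ fun x => ?_
  have hj : ∀ j, Measurable fun θ : FCNParams L n₀ n => fcnPost φ σw σb θ x l hl.le j := fun j =>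
    (measurable_pi_apply x).comp ((measurable_pi_apply j).comp (measurable_fcnPost hφ l hl.le))
  unfold fcnPre fcnLayer
  fun_prop

theorem fcnPost_congr {θ θ' : FCNParams L n₀ n} (x : Fin n₀ → ℝ) (l : ℕ) (hl : l ≤ L)
    (h : ∀ i : Fin L, (i : ℕ) < l → θ i = θ' i) :
    fcnPost φ σw σb θ x l hl = fcnPost φ σw σb θ' x l hl := by
  induction l with
  | zero => rfl
  | succ l ih =>
    funext i
    simp only [fcnPost]
    rw [ih (Nat.le_of_succ_le hl) fun i hi => h i (hi.trans l.lt_succ_self),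
      h ⟨l, hl⟩ l.lt_succ_self]

/-- The post-activations of layer `l` depend only on parameters of earlier layers, hence are
independent of those of the next one. A fully connected layer is the case of one weight matrix, `B =
Unit`, and `e` merely repackages it. -/
theorem map_fcnPre_eq_layerLaw (hφ : Measurable φ) (l : ℕ) (hl : l < L) :
    (fcnInit L n₀ n).map (fun θ i x => fcnPre φ σw σb θ x l hl i)
      = layerLaw σw σb (fun _ : Unit => id) (n (l + 1))
        ((fcnInit L n₀ n).map fun θ j x => fcnPost φ σw σb θ x l hl.le j) := by
  let e : (Fin (n (l + 1)) → Fin (width n₀ n l) → ℝ) × (Fin (n (l + 1)) → ℝ) →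
      (Unit → Fin (n (l + 1)) → Fin (width n₀ n l) → ℝ) × (Fin (n (l + 1)) → ℝ) :=
    Prod.map (MeasurableEquiv.funUnique Unit _).symm id
  have he : MeasurePreserving e ((orthWeight (n (l + 1)) (width n₀ n l)).prod (biasLaw (n (l + 1))))
      (layerWeights Unit (n (l + 1)) (width n₀ n l)) :=
    ((measurePreserving_funUnique (orthWeight (n (l + 1)) (width n₀ n l)) Unit).symm).prod
      (.id _)
  have hpost := measurable_fcnPost (φ := φ) (σw := σw) (σb := σb) (n₀ := n₀) (n := n) hφ l hl.le
  have hw : Measurable fun θ : FCNParams L n₀ n => e (θ ⟨l, hl⟩) :=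
    he.measurable.comp (measurable_pi_apply _)
  have hind := map_prodMk_pi_eq_prod (fun i : Fin L =>
    (orthWeight (n (i + 1)) (width n₀ n i)).prod (biasLaw (n (i + 1)))) ⟨l, hl⟩ hpost
    (fun θ z => by
      funext j x
      rw [fcnPost_congr x l hl.le fun i hi => ?_]
      rw [Function.update_of_ne (Fin.ne_of_val_ne hi.ne)])
  rw [← map_genLayer_eq_layerLaw hpost hw]
  · congr 1
    funext θ i x
    simp [fcnPre, fcnLayer, genLayer, e]
  · have h2 := congrArg (Measure.map (Prod.map id e)) hind
    rw [Measure.map_map (measurable_id.prodMap he.measurable)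
      (hpost.prodMk (measurable_pi_apply _))] at h2
    refine h2.trans ?_
    rw [← Measure.map_prod_map _ _ measurable_id he.measurable, Measure.map_id]
    exact congrArg _ he.map_eq

theorem map_fcnPost_succ (hφ : Measurable φ) (l : ℕ) (hl : l + 1 ≤ L) :
    (fcnInit L n₀ n).map (fun θ j x => fcnPost φ σw σb θ x (l + 1) hl j)
      = ((fcnInit L n₀ n).map (fun θ i x => fcnPre φ σw σb θ x l hl i)).map
        fun h i x => φ (h i x) := by
  rw [Measure.map_map (by fun_prop) (measurable_fcnPre hφ l hl)]
  rfl

end FCN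

/-! ### Induction over the layers of a fully connected network -/

section FCNLimit

variable {φ : ℝ → ℝ} {c m : ℝ} {L n₀ : ℕ} {n : ℕ → ℕ → ℕ}

theorem asymptoticGaussian_fcnPre (hφ : Measurable φ) (σw σb : ℝ) {l : ℕ} (hl : l < L)
    {κ : (Fin n₀ → ℝ) → (Fin n₀ → ℝ) → ℝ}
    (hκ : AsymptoticGram (fun ν => width n₀ (n ν) l)
      (fun ν => (fcnInit L n₀ (n ν)).map fun θ j x => fcnPost φ σw σb θ x l hl.le j) κ)
    (hcov : ∀ x x', fcnCov φ σw σb l x x' = σw ^ 2 * κ x x' + σb ^ 2)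
    (hpq : Tendsto (fun ν => max (n ν (l + 1)) (width n₀ (n ν) l)) atTop atTop) :
    ∃ _ : ∀ ν, IsProbabilityMeasure
        ((fcnInit L n₀ (n ν)).map fun θ i x => fcnPre φ σw σb θ x l hl i),
      AsymptoticGaussian (fun ν => n ν (l + 1))
        (fun ν => (fcnInit L n₀ (n ν)).map fun θ i x => fcnPre φ σw σb θ x l hl i)
        (fcnCov φ σw σb l) := by
  have : ∀ ν, IsProbabilityMeasure
      ((fcnInit L n₀ (n ν)).map fun θ j x => fcnPost φ σw σb θ x l hl.le j) := fun ν =>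
    Measure.isProbabilityMeasure_map (measurable_fcnPost hφ l hl.le).aemeasurable
  have h := hκ.asymptoticGaussian_layer σw σb (fun _ : Unit => id) (fun ν => n ν (l + 1)) hpq
  refine ⟨fun ν => Measure.isProbabilityMeasure_map (measurable_fcnPre hφ l hl).aemeasurable, ?_⟩
  convert h using 1
  · funext ν
    exact map_fcnPre_eq_layerLaw hφ l hl
  · funext x x'
    simp [hcov]

/-- Leaving `κ` existential treats the input, where it is the normalized inner product, on the same
footing as the hidden layers, where it is a Gaussian expectation. -/
theorem exists_asymptoticGram_fcnPost (hφ : Measurable φ) (hc : 0 ≤ c) (hm : 0 ≤ m)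
    (hlin : ∀ x, |φ x| ≤ c + m * |x|) (σw σb : ℝ) (l : ℕ) (hl : l ≤ L)
    (hn : ∀ i, 1 ≤ i → i ≤ l → Tendsto (fun ν => n ν i) atTop atTop) :
    ∃ κ, AsymptoticGram (fun ν => width n₀ (n ν) l)
      (fun ν => (fcnInit L n₀ (n ν)).map fun θ j x => fcnPost φ σw σb θ x l hl j) κ ∧
      ∀ x x', fcnCov φ σw σb l x x' = σw ^ 2 * κ x x' + σb ^ 2 := by
  induction l with
  | zero =>
    refine ⟨gram fun j x => x j, ?_, fun x x' => ?_⟩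
    · have h := asymptoticGram_dirac fun (j : Fin n₀) (x : Fin n₀ → ℝ) => x j
      have e : ∀ ν, (fcnInit L n₀ (n ν)).map (fun θ j x => fcnPost φ σw σb θ x 0 hl j)
          = Measure.dirac fun j x => x j := fun ν => by
        simp only [fcnPost]
        rw [Measure.map_const, measure_univ, one_smul]
      simp_rw [e]
      exact h
    · simp only [fcnCov, gram]
      ring
  | succ l ih =>
    obtain ⟨κ, hκ, hcov⟩ := ih (Nat.le_of_succ_le hl) fun i h1 h2 => hn i h1 (h2.trans l.le_succ)
    have hp := hn (l + 1) (by omega) le_rfl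
    obtain ⟨_, hG⟩ := asymptoticGaussian_fcnPre hφ σw σb hl hκ hcov
      (tendsto_atTop_mono (fun ν => le_max_left _ _) hp)
    refine ⟨gpExp φ (fcnCov φ σw σb l), ?_, fun x x' => rfl⟩
    have h := hG.asymptoticGram_comp hp hφ hc hm hlin
    simp_rw [map_fcnPost_succ hφ l hl]
    exact h

end FCNLimit

/-! ### Convolutional networks -/

/-- The translations `(α, x) ↦ (α + β, x)` by the filter offsets. -/
def convShift (k m n₀ : ℕ) (β : Offset k) (u : ZMod m × (Fin n₀ → ZMod m → ℝ)) :
    ZMod m × (Fin n₀ → ZMod m → ℝ) :=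
  (u.1 + ((β : ℤ) : ZMod m), u.2)

theorem map_prod_eq_map_prodMap {α β γ : Type*} [MeasurableSpace α] [MeasurableSpace β]
    [MeasurableSpace γ] (μ : Measure α) (ν : Measure γ) [SFinite μ] [SFinite ν] {f : α → β}
    (hf : Measurable f) : (μ.map f).prod ν = (μ.prod ν).map (Prod.map f id) := by
  rw [← Measure.map_prod_map _ _ hf measurable_id, Measure.map_id]

theorem Measurable.genLayer {Θ B T T' : Type*} [MeasurableSpace Θ] [Fintype B] {p q : ℕ}
    {y : Θ → Fin q → T' → ℝ} (hy : Measurable y)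
    {w : Θ → (B → Fin p → Fin q → ℝ) × (Fin p → ℝ)} (hw : Measurable w) (c σ : ℝ)
    (τ : B → T → T') : Measurable fun θ => genLayer c σ τ (w θ) (y θ) := by
  unfold _root_.genLayer
  fun_prop

section CNN

variable {φ : ℝ → ℝ} {σw σb : ℝ} {H k m n₀ : ℕ} {n : ℕ → ℕ}

/-- Treating the pair (location, input) as the argument turns a convolution into a sum over offsets
of weight matrices applied at shifted arguments; `1 / √(2k + 1)` is absorbed into the scale. -/
theorem cnnPre_eq_genLayer (θ : CNNParams H k m n₀ n) (l : ℕ) (hl : l < H) :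
    (fun i (u : ZMod m × (Fin n₀ → ZMod m → ℝ)) => cnnPre φ σw σb θ u.2 l hl i u.1)
      = genLayer (σw / √(2 * (k : ℝ) + 1)) σb (convShift k m n₀) (θ.1 ⟨l, hl⟩)
        fun j u => cnnPost φ σw σb θ u.2 l hl.le j u.1 := by
  funext i u
  have h : (0 : ℝ) ≤ 2 * (k : ℝ) + 1 := by positivity
  rw [cnnPre, convLayer, genLayer, Real.sqrt_mul h, div_div]
  rfl

theorem cnnPost_succ (θ : CNNParams H k m n₀ n) (x : Fin n₀ → ZMod m → ℝ) (l : ℕ)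
    (hl : l + 1 ≤ H) (j : Fin (n (l + 1))) (α : ZMod m) :
    cnnPost φ σw σb θ x (l + 1) hl j α = φ (cnnPre φ σw σb θ x l hl j α) := by
  rw [cnnPost, cnnPre]

theorem measurable_cnnPost (hφ : Measurable φ) (l : ℕ) (hl : l ≤ H) :
    Measurable fun (θ : CNNParams H k m n₀ n) j (u : ZMod m × (Fin n₀ → ZMod m → ℝ)) =>
      cnnPost φ σw σb θ u.2 l hl j u.1 := by
  induction l with
  | zero =>
    simp only [cnnPost]
    exact measurable_const
  | succ l ih =>
    have h : (fun (θ : CNNParams H k m n₀ n) j (u : ZMod m × (Fin n₀ → ZMod m → ℝ)) =>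
        cnnPost φ σw σb θ u.2 (l + 1) hl j u.1) = fun θ j u =>
        φ (genLayer (σw / √(2 * (k : ℝ) + 1)) σb (convShift k m n₀) (θ.1 ⟨l, hl⟩)
          (fun j u => cnnPost φ σw σb θ u.2 l (Nat.le_of_succ_le hl) j u.1) j u) := by
      funext θ j u
      exact (cnnPost_succ θ u.2 l hl j u.1).trans
        (congrArg φ (congrFun (congrFun (cnnPre_eq_genLayer θ l hl) j) u))
    rw [h]
    have hw : Measurable fun θ : CNNParams H k m n₀ n => θ.1 ⟨l, hl⟩ :=
      (measurable_pi_apply (⟨l, hl⟩ : Fin H)).comp measurable_fst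
    have hg := (ih (Nat.le_of_succ_le hl)).genLayer hw (σw / √(2 * (k : ℝ) + 1)) σb
      (convShift k m n₀)
    exact measurable_pi_lambda _ fun j => measurable_pi_lambda _ fun u =>
      hφ.comp ((measurable_pi_apply u).comp ((measurable_pi_apply j).comp hg))

theorem measurable_cnnPre (hφ : Measurable φ) (l : ℕ) (hl : l < H) :
    Measurable fun (θ : CNNParams H k m n₀ n) i (u : ZMod m × (Fin n₀ → ZMod m → ℝ)) =>
      cnnPre φ σw σb θ u.2 l hl i u.1 := by
  rw [funext fun θ : CNNParams H k m n₀ n => cnnPre_eq_genLayer θ l hl]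
  have hw : Measurable fun θ : CNNParams H k m n₀ n => θ.1 ⟨l, hl⟩ :=
    (measurable_pi_apply (⟨l, hl⟩ : Fin H)).comp measurable_fst
  have hpost := measurable_cnnPost (φ := φ) (σw := σw) (σb := σb) (k := k) (m := m) (n₀ := n₀)
    (n := n) hφ l hl.le
  exact hpost.genLayer hw _ _ _

theorem cnnPost_congr {θ θ' : CNNParams H k m n₀ n} (x : Fin n₀ → ZMod m → ℝ) (l : ℕ) (hl : l ≤ H)
    (h : ∀ i : Fin H, (i : ℕ) < l → θ.1 i = θ'.1 i) :
    cnnPost φ σw σb θ x l hl = cnnPost φ σw σb θ' x l hl := by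
  induction l with
  | zero => rfl
  | succ l ih =>
    funext i
    simp only [cnnPost]
    rw [ih (Nat.le_of_succ_le hl) fun i hi => h i (hi.trans l.lt_succ_self),
      h ⟨l, hl⟩ l.lt_succ_self]

/-- The output weights are replaced by a dummy `0`, so that hidden activations become functions of
the convolutional parameters alone. -/
theorem cnnPost_eq_fst (θ : CNNParams H k m n₀ n) (x : Fin n₀ → ZMod m → ℝ) (l : ℕ) (hl : l ≤ H) :
    cnnPost φ σw σb θ x l hl = cnnPost φ σw σb ((θ.1, 0) : CNNParams H k m n₀ n) x l hl :=
  cnnPost_congr x l hl fun _ _ => rfl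

theorem measurable_cnnPost_fst (hφ : Measurable φ) (l : ℕ) (hl : l ≤ H) :
    Measurable fun (θ : ∀ l : Fin H, ConvParams k (n (l + 1)) (width n₀ n l)) j
      (u : ZMod m × (Fin n₀ → ZMod m → ℝ)) =>
      cnnPost φ σw σb ((θ, 0) : CNNParams H k m n₀ n) u.2 l hl j u.1 :=
  (measurable_cnnPost hφ l hl).comp measurable_prodMk_right

variable [NeZero m]

theorem map_cnnPost_eq (hφ : Measurable φ) (l : ℕ) (hl : l ≤ H) :
    (cnnInit H k m n₀ n).map (fun θ j (u : ZMod m × (Fin n₀ → ZMod m → ℝ)) =>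
        cnnPost φ σw σb θ u.2 l hl j u.1)
      = (Measure.pi fun l : Fin H => layerWeights (Offset k) (n (l + 1)) (width n₀ n l)).map
        (fun θ j (u : ZMod m × (Fin n₀ → ZMod m → ℝ)) =>
          cnnPost φ σw σb ((θ, 0) : CNNParams H k m n₀ n) u.2 l hl j u.1) := by
  have hfst : MeasurePreserving Prod.fst (cnnInit H k m n₀ n)
      (Measure.pi fun l : Fin H => layerWeights (Offset k) (n (l + 1)) (width n₀ n l)) :=
    measurePreserving_fst
  rw [← hfst.map_eq, Measure.map_map (measurable_cnnPost_fst hφ l hl) measurable_fst]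
  congr 1
  funext θ j u
  exact congrFun (congrFun (cnnPost_eq_fst θ u.2 l hl) j) u.1

theorem map_cnnPre_eq_layerLaw (hφ : Measurable φ) (l : ℕ) (hl : l < H) :
    (cnnInit H k m n₀ n).map (fun θ i (u : ZMod m × (Fin n₀ → ZMod m → ℝ)) =>
        cnnPre φ σw σb θ u.2 l hl i u.1)
      = layerLaw (σw / √(2 * (k : ℝ) + 1)) σb (convShift k m n₀) (n (l + 1))
        ((cnnInit H k m n₀ n).map fun θ j (u : ZMod m × (Fin n₀ → ZMod m → ℝ)) =>
          cnnPost φ σw σb θ u.2 l hl.le j u.1) := by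
  have hpost := measurable_cnnPost (φ := φ) (σw := σw) (σb := σb) (k := k) (m := m) (n₀ := n₀)
    (n := n) hφ l hl.le
  have hpost' := measurable_cnnPost_fst (φ := φ) (σw := σw) (σb := σb) (k := k) (m := m) (n₀ := n₀)
    (n := n) hφ l hl.le
  have hw : Measurable fun θ : CNNParams H k m n₀ n => θ.1 ⟨l, hl⟩ :=
    (measurable_pi_apply (⟨l, hl⟩ : Fin H)).comp measurable_fst
  rw [funext fun θ : CNNParams H k m n₀ n => cnnPre_eq_genLayer θ l hl]
  refine map_genLayer_eq_layerLaw hpost hw ?_ _ _ _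
  have hfst : MeasurePreserving Prod.fst (cnnInit H k m n₀ n)
      (Measure.pi fun l : Fin H => layerWeights (Offset k) (n (l + 1)) (width n₀ n l)) :=
    measurePreserving_fst
  have hind := map_prodMk_pi_eq_prod
    (fun i : Fin H => layerWeights (Offset k) (n (i + 1)) (width n₀ n i)) ⟨l, hl⟩ hpost'
    (fun θ z => by
      funext j u
      rw [cnnPost_congr (θ' := (θ, 0)) u.2 l hl.le fun i hi => ?_]
      exact Function.update_of_ne (Fin.ne_of_val_ne hi.ne) _ _)
  rw [← map_cnnPost_eq hφ l hl.le] at hind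
  refine Eq.trans ?_ hind
  rw [← hfst.map_eq, Measure.map_map (hpost'.prodMk (measurable_pi_apply _)) measurable_fst]
  congr 1
  funext θ
  refine Prod.ext ?_ rfl
  funext j u
  exact congrFun (congrFun (cnnPost_eq_fst θ u.2 l hl.le) j) u.1

theorem map_cnnPost_succ (hφ : Measurable φ) (l : ℕ) (hl : l + 1 ≤ H) :
    (cnnInit H k m n₀ n).map (fun θ j (u : ZMod m × (Fin n₀ → ZMod m → ℝ)) =>
        cnnPost φ σw σb θ u.2 (l + 1) hl j u.1)
      = ((cnnInit H k m n₀ n).map (fun θ i (u : ZMod m × (Fin n₀ → ZMod m → ℝ)) =>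
        cnnPre φ σw σb θ u.2 l hl i u.1)).map fun h i u => φ (h i u) := by
  rw [Measure.map_map (by fun_prop) (measurable_cnnPre hφ l hl)]
  rfl

theorem measurable_cnnOut (hφ : Measurable φ) (s : ℝ) :
    Measurable fun (θ : CNNParams H k m n₀ n) i x => cnnOut φ σw σb s θ x i := by
  refine measurable_pi_lambda _ fun i => measurable_pi_lambda _ fun x => ?_
  have hj : ∀ j α, Measurable fun θ : CNNParams H k m n₀ n =>
      cnnPost φ σw σb θ x H le_rfl j α := fun j α =>
    (measurable_pi_apply ((α, x) : ZMod m × (Fin n₀ → ZMod m → ℝ))).comp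
      ((measurable_pi_apply j).comp (measurable_cnnPost hφ H le_rfl))
  unfold cnnOut
  fun_prop

/-- The output layer carries no bias, whereas `layerWeights` always includes one; at scale `0` it
can be integrated out. -/
theorem layerLaw_zero_bias {B T T' : Type*} [Fintype B] (c : ℝ) (τ : B → T → T') (p : ℕ) {q : ℕ}
    (Λ : Measure (Fin q → T' → ℝ)) [IsProbabilityMeasure Λ] :
    layerLaw c 0 τ p Λ = (Λ.prod (Measure.pi fun _ : B => orthWeight p q)).map
      fun z => genLayer c 0 τ (z.2, 0) z.1 := by
  have hg : Measurable fun z : (Fin q → T' → ℝ) × (B → Fin p → Fin q → ℝ) =>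
      genLayer c 0 τ (z.2, 0) z.1 :=
    measurable_fst.genLayer (w := fun z => (z.2, 0)) (measurable_snd.prodMk measurable_const) c 0 τ
  have hdrop : MeasurePreserving (Prod.map id Prod.fst) (Λ.prod (layerWeights B p q))
      (Λ.prod (Measure.pi fun _ : B => orthWeight p q)) :=
    (MeasurePreserving.id Λ).prod
      (measurePreserving_fst (μ := Measure.pi fun _ : B => orthWeight p q) (ν := biasLaw p))
  rw [← hdrop.map_eq, Measure.map_map hg hdrop.measurable, layerLaw]
  congr 1
  funext z i x
  simp [genLayer]

theorem cnnOut_eq_genLayer (s : ℝ) (θ : CNNParams H k m n₀ n) :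
    (fun i x => cnnOut φ σw σb s θ x i)
      = genLayer s 0 (fun (α : ZMod m) (x : Fin n₀ → ZMod m → ℝ) => (α, x)) (θ.2, 0)
        fun j u => cnnPost φ σw σb ((θ.1, 0) : CNNParams H k m n₀ n) u.2 H le_rfl j u.1 := by
  funext i x
  rw [cnnOut, genLayer, cnnPost_eq_fst]
  simp

theorem map_cnnOut_eq_layerLaw (hφ : Measurable φ) (s : ℝ) :
    (cnnInit H k m n₀ n).map (fun θ i x => cnnOut φ σw σb s θ x i)
      = layerLaw s 0 (fun (α : ZMod m) (x : Fin n₀ → ZMod m → ℝ) => (α, x)) (n (H + 1))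
        ((cnnInit H k m n₀ n).map fun θ j (u : ZMod m × (Fin n₀ → ZMod m → ℝ)) =>
          cnnPost φ σw σb θ u.2 H le_rfl j u.1) := by
  have hpost := measurable_cnnPost_fst (φ := φ) (σw := σw) (σb := σb) (k := k) (m := m) (n₀ := n₀)
    (n := n) hφ H le_rfl
  have hp : IsProbabilityMeasure ((cnnInit H k m n₀ n).map
      fun θ j (u : ZMod m × (Fin n₀ → ZMod m → ℝ)) => cnnPost φ σw σb θ u.2 H le_rfl j u.1) :=
    Measure.isProbabilityMeasure_map (measurable_cnnPost hφ H le_rfl).aemeasurable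
  rw [layerLaw_zero_bias, map_cnnPost_eq hφ]
  have hB : SFinite (Measure.pi fun _ : ZMod m => orthWeight (n (H + 1)) (width n₀ n H)) :=
    inferInstance
  rw [@map_prod_eq_map_prodMap _ _ _ _ _ _ _ _ _ hB _ hpost,
    Measure.map_map _ (hpost.prodMap measurable_id),
    funext fun θ : CNNParams H k m n₀ n => cnnOut_eq_genLayer s θ]
  · rfl
  · exact measurable_fst.genLayer (w := fun z => (z.2, 0)) (measurable_snd.prodMk measurable_const)
      s 0 _

end CNN

/-! ### Induction over the layers of a convolutional network -/

section CNNLimit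

variable {φ : ℝ → ℝ} {c b : ℝ} {H k m n₀ : ℕ} [NeZero m] {n : ℕ → ℕ → ℕ}

theorem asymptoticGaussian_cnnPre (hφ : Measurable φ) (σw σb : ℝ) {l : ℕ} (hl : l < H)
    {κ : ZMod m × (Fin n₀ → ZMod m → ℝ) → ZMod m × (Fin n₀ → ZMod m → ℝ) → ℝ}
    (hκ : AsymptoticGram (fun ν => width n₀ (n ν) l)
      (fun ν => (cnnInit H k m n₀ (n ν)).map fun θ j (u : ZMod m × (Fin n₀ → ZMod m → ℝ)) =>
        cnnPost φ σw σb θ u.2 l hl.le j u.1) κ)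
    (hcov : ∀ u v, cnnCov φ σw σb k l u v = σw ^ 2 / (2 * k + 1) *
      ∑ β, κ (convShift k m n₀ β u) (convShift k m n₀ β v) + σb ^ 2)
    (hp : Tendsto (fun ν => n ν (l + 1)) atTop atTop) :
    ∃ _ : ∀ ν, IsProbabilityMeasure ((cnnInit H k m n₀ (n ν)).map
        fun θ i (u : ZMod m × (Fin n₀ → ZMod m → ℝ)) => cnnPre φ σw σb θ u.2 l hl i u.1),
      AsymptoticGaussian (fun ν => n ν (l + 1))
        (fun ν => (cnnInit H k m n₀ (n ν)).map
          fun θ i (u : ZMod m × (Fin n₀ → ZMod m → ℝ)) => cnnPre φ σw σb θ u.2 l hl i u.1)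
        (cnnCov φ σw σb k l) := by
  have : ∀ ν, IsProbabilityMeasure ((cnnInit H k m n₀ (n ν)).map
      fun θ j (u : ZMod m × (Fin n₀ → ZMod m → ℝ)) => cnnPost φ σw σb θ u.2 l hl.le j u.1) :=
    fun ν => Measure.isProbabilityMeasure_map (measurable_cnnPost hφ l hl.le).aemeasurable
  have h := hκ.asymptoticGaussian_layer (σw / √(2 * (k : ℝ) + 1)) σb (convShift k m n₀)
    (fun ν => n ν (l + 1)) (tendsto_atTop_mono (fun ν => le_max_left _ _) hp)
  refine ⟨fun ν => Measure.isProbabilityMeasure_map (measurable_cnnPre hφ l hl).aemeasurable, ?_⟩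
  convert h using 1
  · funext ν
    exact map_cnnPre_eq_layerLaw hφ l hl
  · funext u v
    rw [hcov, div_pow, Real.sq_sqrt (by positivity)]

theorem asymptoticGram_cnnPost_succ (hφ : Measurable φ) (hc : 0 ≤ c) (hb : 0 ≤ b)
    (hlin : ∀ x, |φ x| ≤ c + b * |x|) (σw σb : ℝ) {l : ℕ} (hl : l + 1 ≤ H)
    {κ : ZMod m × (Fin n₀ → ZMod m → ℝ) → ZMod m × (Fin n₀ → ZMod m → ℝ) → ℝ}
    (hκ : AsymptoticGram (fun ν => width n₀ (n ν) l)
      (fun ν => (cnnInit H k m n₀ (n ν)).map fun θ j (u : ZMod m × (Fin n₀ → ZMod m → ℝ)) =>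
        cnnPost φ σw σb θ u.2 l (Nat.le_of_succ_le hl) j u.1) κ)
    (hcov : ∀ u v, cnnCov φ σw σb k l u v = σw ^ 2 / (2 * k + 1) *
      ∑ β, κ (convShift k m n₀ β u) (convShift k m n₀ β v) + σb ^ 2)
    (hp : Tendsto (fun ν => n ν (l + 1)) atTop atTop) :
    AsymptoticGram (fun ν => width n₀ (n ν) (l + 1))
      (fun ν => (cnnInit H k m n₀ (n ν)).map fun θ j (u : ZMod m × (Fin n₀ → ZMod m → ℝ)) =>
        cnnPost φ σw σb θ u.2 (l + 1) hl j u.1) (gpExp φ (cnnCov φ σw σb k l)) := by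
  obtain ⟨_, hG⟩ := asymptoticGaussian_cnnPre hφ σw σb hl hκ hcov hp
  have h := hG.asymptoticGram_comp hp hφ hc hb hlin
  simp_rw [map_cnnPost_succ hφ l hl]
  exact h

theorem exists_asymptoticGram_cnnPost (hφ : Measurable φ) (hc : 0 ≤ c) (hb : 0 ≤ b)
    (hlin : ∀ x, |φ x| ≤ c + b * |x|) (σw σb : ℝ) (l : ℕ) (hl : l ≤ H)
    (hn : ∀ i, 1 ≤ i → i ≤ l → Tendsto (fun ν => n ν i) atTop atTop) :
    ∃ κ, AsymptoticGram (fun ν => width n₀ (n ν) l)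
      (fun ν => (cnnInit H k m n₀ (n ν)).map fun θ j (u : ZMod m × (Fin n₀ → ZMod m → ℝ)) =>
        cnnPost φ σw σb θ u.2 l hl j u.1) κ ∧
      ∀ u v, cnnCov φ σw σb k l u v = σw ^ 2 / (2 * k + 1) *
        ∑ β, κ (convShift k m n₀ β u) (convShift k m n₀ β v) + σb ^ 2 := by
  induction l with
  | zero =>
    refine ⟨gram fun j u => u.2 j u.1, ?_, fun u v => ?_⟩
    · have h := asymptoticGram_dirac
        fun (j : Fin n₀) (u : ZMod m × (Fin n₀ → ZMod m → ℝ)) => u.2 j u.1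
      have e : ∀ ν, (cnnInit H k m n₀ (n ν)).map
          (fun θ j (u : ZMod m × (Fin n₀ → ZMod m → ℝ)) => cnnPost φ σw σb θ u.2 0 hl j u.1)
          = Measure.dirac fun j u => u.2 j u.1 := fun ν => by
        simp only [cnnPost]
        rw [Measure.map_const, measure_univ, one_smul]
      simp_rw [e]
      exact h
    · simp only [cnnCov, gram, convShift, ← Finset.mul_sum]
      field_simp
  | succ l ih =>
    obtain ⟨κ, hκ, hcov⟩ := ih (Nat.le_of_succ_le hl) fun i h1 h2 => hn i h1 (h2.trans l.le_succ)
    exact ⟨_, asymptoticGram_cnnPost_succ hφ hc hb hlin σw σb hl hκ hcov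
      (hn (l + 1) (by omega) le_rfl), fun u v => rfl⟩

theorem asymptoticGram_cnnPost_last (hφ : Measurable φ) (hc : 0 ≤ c) (hb : 0 ≤ b)
    (hlin : ∀ x, |φ x| ≤ c + b * |x|) (σw σb : ℝ) (hH : 1 ≤ H)
    (hn : ∀ i, 1 ≤ i → i ≤ H → Tendsto (fun ν => n ν i) atTop atTop) :
    AsymptoticGram (fun ν => width n₀ (n ν) H)
      (fun ν => (cnnInit H k m n₀ (n ν)).map fun θ j (u : ZMod m × (Fin n₀ → ZMod m → ℝ)) =>
        cnnPost φ σw σb θ u.2 H le_rfl j u.1) (gpExp φ (cnnCov φ σw σb k (H - 1))) := by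
  obtain ⟨l, rfl⟩ : ∃ l, H = l + 1 := ⟨H - 1, by omega⟩
  obtain ⟨κ, hκ, hcov⟩ := exists_asymptoticGram_cnnPost (H := l + 1) (k := k) (m := m) (n₀ := n₀)
    hφ hc hb hlin σw σb l l.le_succ fun i h1 h2 => hn i h1 (h2.trans l.le_succ)
  exact asymptoticGram_cnnPost_succ hφ hc hb hlin σw σb le_rfl hκ hcov (hn (l + 1) hH le_rfl)

end CNNLimit

theorem tendsto_width {n₀ : ℕ} {n : ℕ → ℕ → ℕ} {l : ℕ} (hl : 1 ≤ l)
    (h : Tendsto (fun ν => n ν l) atTop atTop) :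
    Tendsto (fun ν => width n₀ (n ν) l) atTop atTop := by
  obtain ⟨i, rfl⟩ : ∃ i, l = i + 1 := ⟨l - 1, by omega⟩
  exact h

end

/-- Networks with `H ≥ 1` hidden layers, that is, of depth `L = H + 1`, along any sequence of
widths `n ν` whose hidden widths all tend to infinity. The index `l` below stands for layer
`l + 1`. -/
theorem theorem1 (φ : ℝ → ℝ) (hφ : Measurable φ)
    (hlin : ∃ c m : ℝ, 0 ≤ c ∧ 0 ≤ m ∧ ∀ x : ℝ, |φ x| ≤ c + m * |x|)
    (σw σb : ℝ) (H : ℕ) (hH : 1 ≤ H) (n₀ : ℕ) (n : ℕ → ℕ → ℕ)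
    (hn : ∀ l : ℕ, 1 ≤ l → l ≤ H → Tendsto (fun ν => n ν l) atTop atTop) :
    (∀ (l : ℕ) (hl : l < H + 1),
      TendstoIIDGaussianProcesses (T := Fin n₀ → ℝ)
        (fun ν => fcnInit (H + 1) n₀ (n ν)) (fun ν => n ν (l + 1))
        (fun _ θ i x => fcnPre φ σw σb θ x l hl i)
        (fcnCov φ σw σb l)) ∧
    (∀ (k m : ℕ) [NeZero m] (s : ℝ),
      (∀ (l : ℕ) (hl : l < H),
        TendstoIIDGaussianProcesses (T := ZMod m × (Fin n₀ → ZMod m → ℝ))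
          (fun ν => cnnInit H k m n₀ (n ν)) (fun ν => n ν (l + 1))
          (fun _ θ i u => cnnPre φ σw σb θ u.2 l hl i u.1)
          (cnnCov φ σw σb k l)) ∧
      TendstoIIDGaussianProcesses (T := Fin n₀ → ZMod m → ℝ)
        (fun ν => cnnInit H k m n₀ (n ν)) (fun ν => n ν (H + 1))
        (fun _ θ i x => cnnOut φ σw σb s θ x i)
        (cnnOutCov φ σw σb s H k)) := by
  obtain ⟨c, b, hc, hb, hlin⟩ := hlin
  refine ⟨fun l hl => ?_, fun k m _ s => ⟨fun l hl => ?_, ?_⟩⟩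
  · obtain ⟨κ, hκ, hcov⟩ := exists_asymptoticGram_fcnPost (L := H + 1) (n₀ := n₀) hφ hc hb hlin
      σw σb l hl.le fun i h1 h2 => hn i h1 (h2.trans (Nat.le_of_lt_succ hl))
    -- For the first layer the input width is fixed, and `H ≥ 1` makes the output width diverge; for
    -- every later layer, including the last, the input width does.
    have hpq : Tendsto (fun ν => max (n ν (l + 1)) (width n₀ (n ν) l)) atTop atTop := by
      rcases Nat.eq_zero_or_pos l with rfl | hpos
      · exact tendsto_atTop_mono (fun ν => le_max_left _ _) (hn 1 le_rfl hH)
      · exact tendsto_atTop_mono (fun ν => le_max_right _ _)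
          (tendsto_width hpos (hn l hpos (Nat.le_of_lt_succ hl)))
    obtain ⟨_, hG⟩ := asymptoticGaussian_fcnPre hφ σw σb hl hκ hcov hpq
    exact .of_map_eq (fun ν => measurable_fcnPre hφ l hl) (fun ν => rfl) hG.tendsto_iid
  · obtain ⟨κ, hκ, hcov⟩ := exists_asymptoticGram_cnnPost (H := H) (k := k) (m := m) (n₀ := n₀)
      hφ hc hb hlin σw σb l hl.le fun i h1 h2 => hn i h1 (h2.trans hl.le)
    obtain ⟨_, hG⟩ := asymptoticGaussian_cnnPre hφ σw σb hl hκ hcov (hn (l + 1) (by omega) hl)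
    exact .of_map_eq (fun ν => measurable_cnnPre hφ l hl) (fun ν => rfl) hG.tendsto_iid
  · have hκ := asymptoticGram_cnnPost_last (k := k) (m := m) (n₀ := n₀) hφ hc hb hlin σw σb hH hn
    have : ∀ ν, IsProbabilityMeasure ((cnnInit H k m n₀ (n ν)).map
        fun θ j (u : ZMod m × (Fin n₀ → ZMod m → ℝ)) => cnnPost φ σw σb θ u.2 H le_rfl j u.1) :=
      fun ν => Measure.isProbabilityMeasure_map (measurable_cnnPost hφ H le_rfl).aemeasurable
    -- The sum over locations plays the role of the sum over offsets: location `α` sends the input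
    -- `x` to the argument `(α, x)`, and the bias scale is `0`.
    have hG := hκ.asymptoticGaussian_layer s 0
      (fun (α : ZMod m) (x : Fin n₀ → ZMod m → ℝ) => (α, x)) (fun ν => n ν (H + 1))
      (tendsto_atTop_mono (fun ν => le_max_right _ _) (tendsto_width hH (hn H hH le_rfl)))
    have hcov : cnnOutCov φ σw σb s H k = fun x x' : Fin n₀ → ZMod m → ℝ => s ^ 2 *
        ∑ α : ZMod m, gpExp φ (cnnCov φ σw σb k (H - 1)) (α, x) (α, x') + 0 ^ 2 := by
      funext x x'
      simp [cnnOutCov]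
    rw [hcov]
    exact .of_map_eq (fun ν => measurable_cnnOut hφ s) (fun ν => map_cnnOut_eq_layerLaw hφ s)
      hG.tendsto_iid
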